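/- **Setting.** Let $k$ be a commutative ring. A *linear cubic norm pair* over $k$ is a pair $(J,J')$ of $k$-modules with symmetric $k$-bilinear maps $\times\colon J\times J\to J'$, $\times\colon J'\times J'\to J$ and a $k$-bilinear map $T\colon J\times J'\to k$ (we also write $T(a',a)=T(a,a')$) such that, with $\{a,b',c\}:=T(a,b')c+T(c,b')a-(a\times c)\times b'$ and $\{b',a,d'\}:=T(a,b')d'+T(a,d')b'-(b'\times d')\times a$, $$T(a\times b,c)=T(a,b\times c),$$ $$(a\times b)\times(c\times d)+(b\times c)\times(a\times d)+(c\times a)\times(b\times d)=T(a\times b,c)d+T(b\times c,d)a+T(c\times d,a)b+T(d\times a,b)c,$$ $$a\times(b'\times(c\times d))+c\times(b'\times(d\times a))+d\times(b'\times(a\times c))=T(a,b')\,c\times d+T(c,b')\,d\times a+T(d,b')\,a\times c+T(a\times c,d)b',$$ $$T(\{a,b',c\},d')=T(c,\{b',a,d'\})$$ for all $a,b,c,d\in J$, $b',d'\in J'$, and also with the roles of $J$ and $J'$ interchanged. (Every cubic norm pair is one, forgetting its norms and adjoints.) Put $D_{a,a'}(b)=\{a,a',b\}$ and $D_{a',a}(b')=\{a',a,b'\}$.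 **The Lie algebra.** Let $L_{-2}=kx$ and $L_2=ky$ be free of rank one, and let $L_{-1}$, $L_1$ be copies of $k\oplus J\oplus J'\oplus k$, with elements $(\lambda,b,b',\mu)_\mp$. Let $M=\mathfrak{gl}(L_{-2})\oplus\mathfrak{gl}(L_{-1})\oplus\mathfrak{gl}(L_1)\oplus\mathfrak{gl}(L_2)$. Embed $J$ and $J'$ in $M$ by letting $a\in J$, $a'\in J'$ act as $0$ on $L_{\pm2}$ and by $$a\cdot(\lambda,b,b',\mu)_\pm=(0,\lambda a,a\times b,T(a,b'))_\pm,\qquad a'\cdot(\lambda,b,b',\mu)_\pm=-(T(b,a'),a'\times b',\mu a',0)_\pm .$$ Let $\mathbf d_{a,a'}=[a',a]\in M$; let $\xi\in M$ act on $L_i$ as $i\cdot\mathrm{id}$; let $\zeta\in M$ be given by $x\mapsto -x$, $y\mapsto y$, $(\lambda,b,b',\mu)_-\mapsto(-2\lambda,-b,0,\mu)_-$, $(\lambda,b,b',\mu)_+\mapsto(-\lambda,0,b',2\mu)_+$. Put $L_{0,0}=\langle\mathbf d_{a,a'}\mid a\in J,a'\in J'\rangle+k\zeta+k\xi$ and $L_0=J'\oplus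 L_{0,0}\oplus J\le M$. Then $L=L(J,J')=L_{-2}\oplus L_{-1}\oplus L_0\oplus L_1\oplus L_2$ is a Lie algebra over $k$, where $L_0$ has the commutator bracket and acts naturally on the other $L_i$, where $[L_i,L_j]=0$ if $|i+j|>2$, and where $$[x,q_+]=-q_-,\quad [y,q_-]=q_+,\quad [x,y]=\xi,$$ $$[(\lambda,b,b',\mu)_\mp,(\nu,c,c',\rho)_\mp]=\big(T(b,c')-T(c,b')+\mu\nu-\lambda\rho\big)z,\qquad z=x \text{ for } - \text{ and } z=y \text{ for } +,$$ $$[(\lambda,b,b',\mu)_-,(\nu,c,c',\rho)_+]=(-\lambda c'+b\times c-\nu b')+\big((\lambda\rho-T(b,c'))\zeta+(T(c,b')-\mu\nu)(\xi-\zeta)+\mathbf d_{b,c'}+\mathbf d_{c,b'}\big)+(-\rho b+b'\times c'-\mu c).$$ As a module, $L$ is the direct sum of $L_{0,0}$ and the images $L_\alpha$ of twelve injective "root homomorphisms" $\vartheta_\alpha$, indexed by $\alpha$ in the root system $G_2$, realized in $\mathbb Z^2$: six (the long roots) defined on $k$, namely $t\mapsto tx$, $(t,0,0,0)_-$, $(0,0,0,t)_-$,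 $(t,0,0,0)_+$, $(0,0,0,t)_+$, $ty$ for $\alpha=(-2,-1)$, $(-1,-2)$, $(-1,1)$, $(1,-1)$, $(1,2)$, $(2,1)$; three defined on $J$, namely $b\mapsto(0,b,0,0)_-$, $b\in L_0$, $(0,b,0,0)_+$ for $\alpha=(-1,-1)$, $(0,1)$, $(1,0)$; three defined on $J'$, namely $b'\mapsto(0,0,b',0)_-$, $b'\in L_0$, $(0,0,b',0)_+$ for $\alpha=(-1,0)$, $(0,-1)$, $(1,1)$. An ideal $I$ of $L$ is *graded* if $I=\bigoplus_{\alpha\in G_2\cup\{0\}}(I\cap L_\alpha)$, where $L_0$ for $\alpha=0$ is to be read as $L_{0,0}$. **Ideals of the triple.** An *ideal of $(k,J,J')$* is a triple $(\ell,U,U')$ of an ideal $\ell$ of $k$ and $k$-submodules $U\le J$, $U'\le J'$ with $\ell J\subseteq U$, $\ell J'\subseteq U'$, $T(U,J')\subseteq\ell$, $T(J,U')\subseteq\ell$, $U\times J\subseteq U'$, $U'\times J'\subseteq U$. For such an ideal put $$Z(\ell,U,U')=\ell\xi+\ell\zeta+\langle\mathbf d_{a,a'}\mid a\in U,a'\in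 J'\text{ or }a\in J,a'\in U'\rangle ,$$ and let $\mathrm{Rad}(\ell,U,U')$ be the set of all elements $\sum\lambda_{a,a'}\mathbf d_{a,a'}+\lambda_\xi\xi+\lambda_\zeta\zeta$ (finite sums) such that $\lambda_\zeta+2\lambda_\xi\in\ell$, $\sum\lambda_{a,a'}T(a,a')-3\lambda_\xi\in\ell$, and the maps $\sum\lambda_{a,a'}D_{a,a'}-2\lambda_\xi\mathrm{id}_J$ and $\sum\lambda_{a,a'}D_{a',a}-2\lambda_\xi\mathrm{id}_{J'}$ have image in $U$ and $U'$, respectively. Let $L(\ell,U,U')_{\min}$ (respectively $L(\ell,U,U')_{\max}$) be the sum of $Z(\ell,U,U')$ (respectively $\mathrm{Rad}(\ell,U,U')$) and of all $\vartheta_\alpha(\ell)$, $\vartheta_\alpha(U)$, $\vartheta_\alpha(U')$, where $\alpha$ runs through the roots parametrized by $k$, $J$, $J'$, respectively. **Theorem.** Let $(J,J')$ be a linear cubic norm pair (for example, a cubic norm pair) over a commutative ring $k$, and let $L=L(J,J')$. 1. Every ideal of $L$ is graded. 2. For every ideal $I$ of $L$ there is a unique ideal $(\ell,U,U')$ of $(k,J,J')$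 such that $L(\ell,U,U')_{\min}\subseteq I\subseteq L(\ell,U,U')_{\max}$. Moreover, there is then a unique $k$-submodule $V$ with $Z(\ell,U,U')\subseteq V\subseteq\mathrm{Rad}(\ell,U,U')$ and $I=L(\ell,U,U')_{\min}+V$. 3. The following are equivalent: (i) $(k,J,J')$ is simple, that is, its only ideals are $(0,0,0)$ and $(k,J,J')$; (ii) $L$ is simple, that is, its only ideals are $0$ and $L$; (iii) the only ideals of $k$ are $0$ and $k$, and $T$ is non-degenerate, that is, $T(a,J')=0$ implies $a=0$ and $T(J,a')=0$ implies $a'=0$. In particular, if $k\neq0$, then $L$ is simple if and only if $k$ is a field and $T$ is non-degenerate. -/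

import Mathlib

universe u v w

/-- A linear cubic norm pair `(J, J')` over `k`.  The second trace `T'` is the flip of `T`. -/
structure LinearCubicNormPair (k : Type u) (J : Type v) (J' : Type w) [CommRing k]
    [AddCommGroup J] [Module k J] [AddCommGroup J'] [Module k J'] where
  /-- The product `× : J × J → J'`. -/
  cross : J →ₗ[k] J →ₗ[k] J'
  /-- The product `×' : J' × J' → J`. -/
  cross' : J' →ₗ[k] J' →ₗ[k] J
  /-- The trace `T : J × J' → k`. -/
  T : J →ₗ[k] J' →ₗ[k] k
  cross_comm : ∀ a b, cross a b = cross b a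
  cross'_comm : ∀ a b, cross' a b = cross' b a
  /-- `T(a × b, c) = T(a, b × c)`. -/
  T_cross : ∀ a b c, T c (cross a b) = T a (cross b c)
  T_cross' : ∀ a b c, T (cross' a b) c = T (cross' b c) a
  /-- The full linearization of the adjoint identity. -/
  cross_cross : ∀ a b c d,
    cross' (cross a b) (cross c d) + cross' (cross b c) (cross a d)
        + cross' (cross c a) (cross b d) =
      T c (cross a b) • d + T d (cross b c) • a + T a (cross c d) • b + T b (cross d a) • c
  cross'_cross' : ∀ a b c d,
    cross (cross' a b) (cross' c d) + cross (cross' b c) (cross' a d)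
        + cross (cross' c a) (cross' b d) =
      T (cross' a b) c • d + T (cross' b c) d • a + T (cross' c d) a • b + T (cross' d a) b • c
  cross_cross_cross : ∀ (a c d : J) (b' : J'),
    cross a (cross' b' (cross c d)) + cross c (cross' b' (cross d a))
        + cross d (cross' b' (cross a c)) =
      T a b' • cross c d + T c b' • cross d a + T d b' • cross a c + T d (cross a c) • b'
  cross'_cross'_cross' : ∀ (a c d : J') (b : J),
    cross' a (cross b (cross' c d)) + cross' c (cross b (cross' d a))
        + cross' d (cross b (cross' a c)) =
      T b a • cross' c d + T b c • cross' d a + T b d • cross' a c + T (cross' a c) d • b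
  /-- `T({a, b', c}, d') = T(c, {b', a, d'})`; interchanging the roles of `J` and `J'` gives the
  same family of identities. -/
  T_triple : ∀ (a c : J) (b' d' : J'),
    T (T a b' • c + T c b' • a - cross' (cross a c) b') d' =
      T c (T a b' • d' + T a d' • b' - cross (cross' b' d') a)

namespace LinearCubicNormPair

variable {k : Type u} {J : Type v} {J' : Type w} [CommRing k]
  [AddCommGroup J] [Module k J] [AddCommGroup J'] [Module k J']
  (P : LinearCubicNormPair k J J')

/-- `D_{a,a'}(b) = T(a,a') b + T(b,a') a - (a × b) × a'`. -/
def D (a : J) (a' : J') : J →ₗ[k] J where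
  toFun b := P.T a a' • b + P.T b a' • a - P.cross' (P.cross a b) a'
  map_add' b c := by simp only [map_add, LinearMap.add_apply]; module
  map_smul' r b := by simp only [map_smul, LinearMap.smul_apply, RingHom.id_apply, smul_eq_mul]; module

/-- `D_{a',a}(b') = T(a,a') b' + T(a,b') a' - (a' × b') × a`. -/
def D' (a' : J') (a : J) : J' →ₗ[k] J' where
  toFun b' := P.T a a' • b' + P.T a b' • a' - P.cross (P.cross' a' b') a
  map_add' b c := by simp only [map_add, LinearMap.add_apply]; module
  map_smul' r b := by simp only [map_smul, LinearMap.smul_apply, RingHom.id_apply, smul_eq_mul]; module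

/-- The module of quadruples `(λ, b, b', μ)`; both `L₋₁` and `L₁` are copies of it. -/
abbrev Quad (_ : LinearCubicNormPair k J J') : Type (max u v w) := k × J × J' × k

/-- `M = 𝔤𝔩(L₋₂) ⊕ 𝔤𝔩(L₋₁) ⊕ 𝔤𝔩(L₁) ⊕ 𝔤𝔩(L₂)`, where `L₋₂ = kx` and `L₂ = ky` are identified with
`k`; its Lie bracket is the commutator `f * g - g * f`. -/
def M : Type (max u v w) :=
  Module.End k k × Module.End k P.Quad × Module.End k P.Quad × Module.End k k

instance : Ring P.M :=
  inferInstanceAs (Ring (Module.End k k × Module.End k P.Quad × Module.End k P.Quad × Module.End k k))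

instance : Algebra k P.M := inferInstanceAs
  (Algebra k (Module.End k k × Module.End k P.Quad × Module.End k P.Quad × Module.End k k))

instance : AddCommGroup P.M := inferInstance

instance : AddCommMonoid P.M := inferInstance

instance : Module k P.M := inferInstance

namespace M

variable {P}

/-- The element of `M` with the given components in `𝔤𝔩(L₋₂)`, `𝔤𝔩(L₋₁)`, `𝔤𝔩(L₁)`, `𝔤𝔩(L₂)`. -/
def mk (f₁ : Module.End k k) (f₂ f₃ : Module.End k P.Quad) (f₄ : Module.End k k) : P.M :=
  (f₁, f₂, f₃, f₄)

/-- The component in `𝔤𝔩(L₋₂)`. -/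
def onX : P.M →ₐ[k] Module.End k k :=
  AlgHom.fst k (Module.End k k) (Module.End k P.Quad × Module.End k P.Quad × Module.End k k)

/-- The component in `𝔤𝔩(L₋₁)`. -/
def onNeg : P.M →ₐ[k] Module.End k P.Quad :=
  (AlgHom.fst k (Module.End k P.Quad) (Module.End k P.Quad × Module.End k k)).comp
    (AlgHom.snd k (Module.End k k) (Module.End k P.Quad × Module.End k P.Quad × Module.End k k))

/-- The component in `𝔤𝔩(L₁)`. -/
def onPos : P.M →ₐ[k] Module.End k P.Quad :=
  (AlgHom.fst k (Module.End k P.Quad) (Module.End k k)).comp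
    ((AlgHom.snd k (Module.End k P.Quad) (Module.End k P.Quad × Module.End k k)).comp
      (AlgHom.snd k (Module.End k k)
        (Module.End k P.Quad × Module.End k P.Quad × Module.End k k)))

/-- The component in `𝔤𝔩(L₂)`. -/
def onY : P.M →ₐ[k] Module.End k k :=
  (AlgHom.snd k (Module.End k P.Quad) (Module.End k k)).comp
    ((AlgHom.snd k (Module.End k P.Quad) (Module.End k P.Quad × Module.End k k)).comp
      (AlgHom.snd k (Module.End k k)
        (Module.End k P.Quad × Module.End k P.Quad × Module.End k k)))

variable (f₁ : Module.End k k) (f₂ f₃ : Module.End k P.Quad) (f₄ : Module.End k k)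

@[simp] lemma onX_mk : onX (mk f₁ f₂ f₃ f₄) = f₁ := rfl
@[simp] lemma onNeg_mk : onNeg (mk f₁ f₂ f₃ f₄) = f₂ := rfl
@[simp] lemma onPos_mk : onPos (mk f₁ f₂ f₃ f₄) = f₃ := rfl
@[simp] lemma onY_mk : onY (mk f₁ f₂ f₃ f₄) = f₄ := rfl

lemma ext {f g : P.M} (h₁ : onX f = onX g) (h₂ : onNeg f = onNeg g) (h₃ : onPos f = onPos g)
    (h₄ : onY f = onY g) : f = g := Prod.ext h₁ (Prod.ext h₂ (Prod.ext h₃ h₄))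

end M

/-- The action `[a, (λ, b, b', μ)] = (0, λ a, a × b, T(a, b'))`. -/
def actJ : J →ₗ[k] Module.End k P.Quad :=
  LinearMap.mk₂ k (fun a q => (0, q.1 • a, P.cross a q.2.1, P.T a q.2.2.1))
    (fun a b q => by ext <;> simp) (fun r a q => by ext <;> simp [smul_comm r])
    (fun a q q' => by ext <;> simp [add_smul]) (fun r a q => by ext <;> simp [mul_smul])

/-- The action `[a', (λ, b, b', μ)] = -(T(b, a'), a' × b', μ a', 0)`. -/
def actJ' : J' →ₗ[k] Module.End k P.Quad :=
  LinearMap.mk₂ k (fun a' q => -(P.T q.2.1 a', P.cross' a' q.2.2.1, q.2.2.2 • a', 0))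
    (fun a b q => by ext <;> simp [add_comm]) (fun r a q => by ext <;> simp [smul_comm r])
    (fun a q q' => by ext <;> simp [add_smul, add_comm])
    (fun r a q => by ext <;> simp [mul_smul])

/-- `ad_a ∈ M` for `a ∈ J`. -/
def adJ : J →ₗ[k] P.M where
  toFun a := M.mk 0 (P.actJ a) (P.actJ a) 0
  map_add' a b := by apply M.ext <;> simp
  map_smul' r a := by apply M.ext <;> simp

/-- `ad_{a'} ∈ M` for `a' ∈ J'`. -/
def adJ' : J' →ₗ[k] P.M where
  toFun a' := M.mk 0 (P.actJ' a') (P.actJ' a') 0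
  map_add' a b := by apply M.ext <;> simp
  map_smul' r a := by apply M.ext <;> simp

/-- `𝐝_{a,a'} = [ad_{a'}, ad_a] ∈ M`. -/
def dM (a : J) (a' : J') : P.M := P.adJ' a' * P.adJ a - P.adJ a * P.adJ' a'

/-- `ξ ∈ M` acts on `L_i` as multiplication by `i`. -/
def xiM : P.M := M.mk (-2) (-1) 1 2

/-- `ζ` on `L₁`: `(λ, b, b', μ) ↦ (-λ, 0, b', 2μ)`. -/
def zetaPos : Module.End k P.Quad where
  toFun q := (-q.1, 0, q.2.2.1, 2 * q.2.2.2)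
  map_add' q q' := by ext <;> simp [add_comm, mul_add]
  map_smul' r q := by ext <;> simp [mul_left_comm]

/-- `ζ` on `L₋₁`: `(λ, b, b', μ) ↦ (-2λ, -b, 0, μ)`. -/
def zetaNeg : Module.End k P.Quad where
  toFun q := (-2 * q.1, -q.2.1, 0, q.2.2.2)
  map_add' q q' := by ext <;> simp [add_comm, mul_add]
  map_smul' r q := by ext <;> simp [mul_left_comm]

/-- `ζ ∈ M`. -/
def zetaM : P.M := M.mk (-1) P.zetaNeg P.zetaPos 1

/-- `Z = ⟨𝐝_{a,a'}⟩ + kζ + kξ`. -/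
def Z : Submodule k P.M :=
  Submodule.span k (Set.range fun p : J × J' => P.dM p.1 p.2) ⊔
    Submodule.span k {P.zetaM} ⊔ Submodule.span k {P.xiM}

/-- `L₀ = J' ⊕ Z ⊕ J ≤ M`. -/
def L0 : Submodule k P.M := LinearMap.range P.adJ' ⊔ P.Z ⊔ LinearMap.range P.adJ


lemma actJ_apply (a : J) (q : P.Quad) :
    P.actJ a q = (0, q.1 • a, P.cross a q.2.1, P.T a q.2.2.1) := rfl

lemma actJ'_apply (a' : J') (q : P.Quad) :
    P.actJ' a' q = -(P.T q.2.1 a', P.cross' a' q.2.2.1, q.2.2.2 • a', 0) := rfl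

lemma zetaPos_apply (q : P.Quad) : P.zetaPos q = (-q.1, 0, q.2.2.1, 2 * q.2.2.2) := rfl

lemma zetaNeg_eq : P.zetaNeg = P.zetaPos - 1 := by
  apply LinearMap.ext; intro q
  ext <;> simp [zetaPos, zetaNeg] <;> ring

/-- The action of `𝐝_{a,a'}` on quadruples. -/
def actD (a : J) (a' : J') : Module.End k P.Quad := P.actJ' a' * P.actJ a - P.actJ a * P.actJ' a'

lemma actD_apply (a : J) (a' : J') (q : P.Quad) : P.actD a a' q =
    (-(q.1 * P.T a a'), P.D a a' q.2.1 - P.T a a' • q.2.1,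
      - P.D' a' a q.2.2.1 + P.T a a' • q.2.2.1, q.2.2.2 * P.T a a') := by
  simp only [actD, LinearMap.sub_apply, Module.End.mul_apply, actJ_apply, actJ'_apply, D, D',
    LinearMap.coe_mk, AddHom.coe_mk]
  refine Prod.ext ?_ (Prod.ext ?_ (Prod.ext ?_ ?_))
  · simp
  · simp [P.cross'_comm a']; abel
  · simp [P.cross_comm a]; abel
  · simp

lemma dM_eq (a : J) (a' : J') : P.dM a a' = M.mk 0 (P.actD a a') (P.actD a a') 0 := by
  apply M.ext <;> simp [dM, adJ, adJ', actD]

lemma adJ_eq (a : J) : P.adJ a = M.mk 0 (P.actJ a) (P.actJ a) 0 := rfl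
lemma adJ'_eq (a' : J') : P.adJ' a' = M.mk 0 (P.actJ' a') (P.actJ' a') 0 := rfl

lemma actJ_comm (a c : J) : P.actJ a * P.actJ c = P.actJ c * P.actJ a := by
  apply LinearMap.ext; intro q
  simp only [Module.End.mul_apply, actJ_apply]
  refine Prod.ext ?_ (Prod.ext ?_ (Prod.ext ?_ ?_))
  · simp
  · simp
  · simp [P.cross_comm a c]
  · simp only
    rw [P.T_cross c q.2.1 a, P.cross_comm q.2.1]

lemma actJ'_comm (a c : J') : P.actJ' a * P.actJ' c = P.actJ' c * P.actJ' a := by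
  apply LinearMap.ext; intro q
  simp only [Module.End.mul_apply, actJ'_apply]
  refine Prod.ext ?_ (Prod.ext ?_ (Prod.ext ?_ ?_))
  · simp [P.T_cross' c, P.cross'_comm a q.2.2.1]
  · simp [P.cross'_comm a c]
  · simp
  · simp

lemma T_D (a b : J) (a' b' : J') : P.T (P.D a a' b) b' = P.T b (P.D' a' a b') := P.T_triple a b a' b'

lemma D'_cross (a b c : J) (a' : J') :
    P.D' a' a (P.cross b c) + P.cross (P.D a a' b) c + P.cross b (P.D a a' c) =
      (2 * P.T a a') • P.cross b c := by
  have h := P.cross_cross_cross a b c a'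
  simp only [D, D', LinearMap.coe_mk, AddHom.coe_mk, map_add, map_sub, map_smul,
    LinearMap.add_apply, LinearMap.sub_apply, LinearMap.smul_apply]
  rw [P.cross'_comm (P.cross a b), P.cross'_comm (P.cross a c), P.cross_comm _ a,
    P.cross_comm (P.cross' a' (P.cross a b)) c, P.cross_comm a c, P.cross_comm b a]
  linear_combination (norm := module) -h - P.T_cross a b c • a'


lemma comm_comm {R : Type*} [Ring R] (x y z : R) : x * (y * z - z * y) - (y * z - z * y) * x =
    (y * (x * z - z * x) - (x * z - z * x) * y) - (z * (x * y - y * x) - (x * y - y * x) * z) := by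
  noncomm_ring
lemma comm_add_left {R : Type*} [Ring R] (x y z : R) :
    (x + y) * z - z * (x + y) = (x * z - z * x) + (y * z - z * y) := by noncomm_ring
lemma comm_add_right {R : Type*} [Ring R] (x y z : R) :
    x * (y + z) - (y + z) * x = (x * y - y * x) + (x * z - z * x) := by noncomm_ring

lemma D_cross' (a' b' c' : J') (a : J) :
    P.D a a' (P.cross' b' c') + P.cross' (P.D' a' a b') c' + P.cross' b' (P.D' a' a c') =
      (2 * P.T a a') • P.cross' b' c' := by
  have h := P.cross'_cross'_cross' a' b' c' a
  simp only [D, D', LinearMap.coe_mk, AddHom.coe_mk, map_add, map_sub, map_smul,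
    LinearMap.add_apply, LinearMap.sub_apply, LinearMap.smul_apply]
  rw [P.cross_comm (P.cross' a' b'), P.cross_comm (P.cross' a' c'), P.cross'_comm _ a',
    P.cross'_comm (P.cross a (P.cross' a' b')) c', P.cross'_comm a' c', P.cross'_comm b' a']
  have h2 := P.T_cross' a' b' c'
  linear_combination (norm := module) -h - h2 • a

lemma comm_actD_actJ (a c : J) (a' : J') :
    P.actD a a' * P.actJ c - P.actJ c * P.actD a a' = P.actJ (P.D a a' c) := by
  apply LinearMap.ext; intro q
  simp only [LinearMap.sub_apply, Module.End.mul_apply, actD_apply, actJ_apply]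
  refine Prod.ext ?_ (Prod.ext ?_ (Prod.ext ?_ ?_))
  · simp
  · simp; module
  · have h := P.D'_cross a c q.2.1 a'
    simp only [Prod.snd_sub, Prod.fst_sub, map_sub, map_smul]
    linear_combination (norm := module) -h
  · have h := P.T_D a c a' q.2.2.1
    simp only [Prod.snd_sub, map_add, map_neg, map_smul, smul_eq_mul]
    linear_combination -h

lemma comm_actD_actJ' (a : J) (a' c' : J') :
    P.actD a a' * P.actJ' c' - P.actJ' c' * P.actD a a' = -P.actJ' (P.D' a' a c') := by
  apply LinearMap.ext; intro q
  simp only [LinearMap.sub_apply, LinearMap.neg_apply, Module.End.mul_apply, map_neg, actD_apply,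
    actJ'_apply]
  refine Prod.ext ?_ (Prod.ext ?_ (Prod.ext ?_ ?_))
  · have h := P.T_D a q.2.1 a' c'
    simp only [Prod.fst_sub, Prod.fst_neg, map_sub, map_smul, LinearMap.sub_apply,
      LinearMap.smul_apply, smul_eq_mul]
    linear_combination h
  · have h := P.D_cross' a' c' q.2.2.1 a
    simp only [Prod.snd_sub, Prod.fst_sub, Prod.snd_neg, Prod.fst_neg, map_add, map_neg, map_smul]
    linear_combination (norm := module) -h
  · simp; module
  · simp

lemma comm_zeta_actJ (a : J) : P.zetaPos * P.actJ a - P.actJ a * P.zetaPos = P.actJ a := by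
  apply LinearMap.ext; intro q
  simp only [LinearMap.sub_apply, Module.End.mul_apply, zetaPos_apply, actJ_apply]
  refine Prod.ext ?_ (Prod.ext ?_ (Prod.ext ?_ ?_)) <;> simp
  ring

lemma comm_zeta_actJ' (a' : J') :
    P.zetaPos * P.actJ' a' - P.actJ' a' * P.zetaPos = -P.actJ' a' := by
  apply LinearMap.ext; intro q
  simp only [LinearMap.sub_apply, LinearMap.neg_apply, Module.End.mul_apply, zetaPos_apply,
    actJ'_apply]
  refine Prod.ext ?_ (Prod.ext ?_ (Prod.ext ?_ ?_)) <;> simp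
  module

lemma dM_add_left (a b : J) (a' : J') : P.dM (a + b) a' = P.dM a a' + P.dM b a' := by
  simp only [dM, map_add, mul_add, add_mul]; abel
lemma dM_add_right (a : J) (a' b' : J') : P.dM a (a' + b') = P.dM a a' + P.dM a b' := by
  simp only [dM, map_add, mul_add, add_mul]; abel
lemma dM_smul_left (r : k) (a : J) (a' : J') : P.dM (r • a) a' = r • P.dM a a' := by
  simp only [dM, map_smul, mul_smul_comm, smul_mul_assoc, smul_sub]
lemma dM_smul_right (r : k) (a : J) (a' : J') : P.dM a (r • a') = r • P.dM a a' := by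
  simp only [dM, map_smul, mul_smul_comm, smul_mul_assoc, smul_sub]

lemma comm_adJ_adJ (a c : J) : P.adJ a * P.adJ c - P.adJ c * P.adJ a = 0 := by
  apply M.ext <;> simp [adJ_eq, P.actJ_comm a c]
lemma comm_adJ'_adJ' (a c : J') : P.adJ' a * P.adJ' c - P.adJ' c * P.adJ' a = 0 := by
  apply M.ext <;> simp [adJ'_eq, P.actJ'_comm a c]
lemma comm_dM_adJ (a c : J) (a' : J') :
    P.dM a a' * P.adJ c - P.adJ c * P.dM a a' = P.adJ (P.D a a' c) := by
  apply M.ext <;>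
    simp [adJ_eq, dM_eq, P.comm_actD_actJ a c]
lemma comm_dM_adJ' (a : J) (a' c' : J') :
    P.dM a a' * P.adJ' c' - P.adJ' c' * P.dM a a' = -P.adJ' (P.D' a' a c') := by
  apply M.ext <;>
    simp [adJ'_eq, dM_eq, P.comm_actD_actJ' a]
lemma comm_zetaM_adJ (a : J) : P.zetaM * P.adJ a - P.adJ a * P.zetaM = P.adJ a := by
  have h := P.comm_zeta_actJ a
  apply M.ext <;>
    simp [adJ_eq, zetaM, zetaNeg_eq, sub_mul, mul_sub, h]
lemma comm_zetaM_adJ' (a' : J') : P.zetaM * P.adJ' a' - P.adJ' a' * P.zetaM = -P.adJ' a' := by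
  have h := P.comm_zeta_actJ' a'
  apply M.ext <;>
    simp [adJ'_eq, zetaM, zetaNeg_eq, sub_mul, mul_sub, h]
lemma xiM_comm (f : P.M) : P.xiM * f = f * P.xiM := by
  apply M.ext <;> simp only [xiM, map_mul, M.onX_mk, M.onNeg_mk, M.onPos_mk, M.onY_mk]
  · exact ((Commute.ofNat_left 2 (M.onX f)).neg_left).eq
  · exact ((Commute.one_left (M.onNeg f)).neg_left).eq
  · exact (Commute.one_left _).eq
  · exact (Commute.ofNat_left 2 (M.onY f)).eq
lemma comm_zetaM_dM (a : J) (a' : J') : P.zetaM * P.dM a a' - P.dM a a' * P.zetaM = 0 := by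
  have h1 := P.comm_zetaM_adJ a
  have h2 := P.comm_zetaM_adJ' a'
  rw [dM, comm_comm, h1, h2, mul_neg, neg_mul]
  abel
lemma comm_dM_dM (a b : J) (a' b' : J') : P.dM a a' * P.dM b b' - P.dM b b' * P.dM a a' =
    P.dM (P.D a a' b) b' - P.dM b (P.D' a' a b') := by
  have h1 := P.comm_dM_adJ a b a'
  have h2 := P.comm_dM_adJ' a a' b'
  rw [dM.eq_def P b b', comm_comm, h1, h2]
  simp only [dM, mul_neg, neg_mul]
  abel

/-- Generators of `L₀`. -/
def genSet : Set P.M := Set.range P.adJ' ∪ (Set.range fun p : J × J' => P.dM p.1 p.2) ∪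
  {P.zetaM} ∪ {P.xiM} ∪ Set.range P.adJ

lemma L0_eq_span : P.L0 = Submodule.span k P.genSet := by
  simp only [genSet, Submodule.span_union, L0, Z, ← LinearMap.coe_range, Submodule.span_eq,
    sup_assoc]

lemma adJ_mem (a : J) : P.adJ a ∈ P.L0 := Submodule.mem_sup_right ⟨a, rfl⟩
lemma adJ'_mem (a' : J') : P.adJ' a' ∈ P.L0 :=
  Submodule.mem_sup_left (Submodule.mem_sup_left ⟨a', rfl⟩)
lemma Z_le_L0 : P.Z ≤ P.L0 := le_sup_right.trans le_sup_left
lemma dM_mem_Z (a : J) (a' : J') : P.dM a a' ∈ P.Z := Submodule.mem_sup_left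
  (Submodule.mem_sup_left (Submodule.subset_span ⟨(a, a'), rfl⟩))
lemma zetaM_mem_Z : P.zetaM ∈ P.Z := Submodule.mem_sup_left
  (Submodule.mem_sup_right (Submodule.mem_span_singleton_self _))
lemma xiM_mem_Z : P.xiM ∈ P.Z := Submodule.mem_sup_right (Submodule.mem_span_singleton_self _)
lemma dM_mem (a : J) (a' : J') : P.dM a a' ∈ P.L0 := P.Z_le_L0 (P.dM_mem_Z a a')
lemma zetaM_mem : P.zetaM ∈ P.L0 := P.Z_le_L0 P.zetaM_mem_Z
lemma xiM_mem : P.xiM ∈ P.L0 := P.Z_le_L0 P.xiM_mem_Z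

/-- `L₀` is closed under the Lie bracket of `M`. -/
lemma comm_mem {f g : P.M} (hf : f ∈ P.L0) (hg : g ∈ P.L0) : f * g - g * f ∈ P.L0 := by
  have flip : ∀ {f g : P.M}, f * g - g * f ∈ P.L0 → g * f - f * g ∈ P.L0 := by
    intro f g h; rw [← neg_sub]; exact P.L0.neg_mem h
  rw [L0_eq_span] at hf hg
  induction hf, hg using Submodule.span_induction₂ with
  | mem_mem f g hf hg =>
    simp only [genSet, Set.mem_union, Set.mem_range, Set.mem_singleton_iff, Prod.exists] at hf hg
    obtain ((((⟨a', rfl⟩ | ⟨a, a', rfl⟩) | rfl) | rfl) | ⟨a, rfl⟩) := hf <;>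
    obtain ((((⟨b', rfl⟩ | ⟨b, b', rfl⟩) | rfl) | rfl) | ⟨b, rfl⟩) := hg
    · rw [comm_adJ'_adJ']; exact zero_mem _
    · apply flip; rw [comm_dM_adJ']; exact neg_mem (P.adJ'_mem _)
    · apply flip; rw [comm_zetaM_adJ']; exact neg_mem (P.adJ'_mem _)
    · rw [← xiM_comm, sub_self]; exact zero_mem _
    · exact P.dM_mem b a'
    · rw [comm_dM_adJ']; exact neg_mem (P.adJ'_mem _)
    · rw [comm_dM_dM]; exact sub_mem (P.dM_mem _ _) (P.dM_mem _ _)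
    · apply flip; rw [comm_zetaM_dM]; exact zero_mem _
    · rw [← xiM_comm, sub_self]; exact zero_mem _
    · rw [comm_dM_adJ]; exact P.adJ_mem _
    · rw [comm_zetaM_adJ']; exact neg_mem (P.adJ'_mem _)
    · rw [comm_zetaM_dM]; exact zero_mem _
    · rw [sub_self]; exact zero_mem _
    · rw [← xiM_comm, sub_self]; exact zero_mem _
    · rw [comm_zetaM_adJ]; exact P.adJ_mem _
    · rw [xiM_comm, sub_self]; exact zero_mem _
    · rw [xiM_comm, sub_self]; exact zero_mem _
    · rw [xiM_comm, sub_self]; exact zero_mem _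
    · rw [sub_self]; exact zero_mem _
    · rw [xiM_comm, sub_self]; exact zero_mem _
    · apply flip; exact P.dM_mem a b'
    · apply flip; rw [comm_dM_adJ]; exact P.adJ_mem _
    · apply flip; rw [comm_zetaM_adJ]; exact P.adJ_mem _
    · rw [← xiM_comm, sub_self]; exact zero_mem _
    · rw [comm_adJ_adJ]; exact zero_mem _
  | zero_left y _ => simp
  | zero_right y _ => simp
  | add_left x y z _ _ _ h1 h2 =>
    have : (x + y) * z - z * (x + y) = (x * z - z * x) + (y * z - z * y) := comm_add_left x y z
    rw [this]; exact add_mem h1 h2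
  | add_right x y z _ _ _ h1 h2 =>
    have : x * (y + z) - (y + z) * x = (x * y - y * x) + (x * z - z * x) := comm_add_right x y z
    rw [this]; exact add_mem h1 h2
  | smul_left r x y _ _ h =>
    rw [smul_mul_assoc, mul_smul_comm, ← smul_sub]; exact P.L0.smul_mem r h
  | smul_right r x y _ _ h =>
    rw [smul_mul_assoc, mul_smul_comm, ← smul_sub]; exact P.L0.smul_mem r h


/-- `ω((λ, b, b', μ), (ν, c, c', ρ)) = T(b, c') - T(c, b') + μν - λρ`. -/
def omega (p q : P.Quad) : k :=
  P.T p.2.1 q.2.2.1 - P.T q.2.1 p.2.2.1 + p.2.2.2 * q.1 - p.1 * q.2.2.2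

/-- The bracket `[(λ, b, b', μ)₋, (ν, c, c', ρ)₊] ∈ L₀`. -/
def negPos (p q : P.Quad) : P.M :=
  P.adJ' (-(p.1 • q.2.2.1) + P.cross p.2.1 q.2.1 - q.1 • p.2.2.1) +
    ((p.1 * q.2.2.2 - P.T p.2.1 q.2.2.1) • P.zetaM +
      (P.T q.2.1 p.2.2.1 - p.2.2.2 * q.1) • (P.xiM - P.zetaM) +
      P.dM p.2.1 q.2.2.1 + P.dM q.2.1 p.2.2.1) +
    P.adJ (-(q.2.2.2 • p.2.1) + P.cross' p.2.2.1 q.2.2.1 - p.2.2.2 • q.2.1)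

lemma negPos_mem (p q : P.Quad) : P.negPos p q ∈ P.L0 :=
  add_mem (add_mem (P.adJ'_mem _) (add_mem (add_mem (add_mem (P.L0.smul_mem _ P.zetaM_mem)
    (P.L0.smul_mem _ (sub_mem P.xiM_mem P.zetaM_mem))) (P.dM_mem _ _)) (P.dM_mem _ _)))
    (P.adJ_mem _)

lemma omega_add_left (p p' q : P.Quad) : P.omega (p + p') q = P.omega p q + P.omega p' q := by
  simp [omega]; ring
lemma omega_add_right (p q q' : P.Quad) : P.omega p (q + q') = P.omega p q + P.omega p q' := by
  simp [omega]; ring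
lemma omega_smul_left (r : k) (p q : P.Quad) : P.omega (r • p) q = r * P.omega p q := by
  simp [omega]; ring
lemma omega_smul_right (r : k) (p q : P.Quad) : P.omega p (r • q) = r * P.omega p q := by
  simp [omega]; ring
lemma omega_self (p : P.Quad) : P.omega p p = 0 := by
  simp [omega]; ring
lemma omega_skew (p q : P.Quad) : P.omega q p = - P.omega p q := by
  simp [omega]; ring

lemma negPos_add_left (p p' q : P.Quad) : P.negPos (p + p') q = P.negPos p q + P.negPos p' q := by
  simp only [negPos, Prod.fst_add, Prod.snd_add, map_add, map_sub, map_neg, map_smul,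
    LinearMap.add_apply, dM_add_left, dM_add_right]
  module
lemma negPos_add_right (p q q' : P.Quad) :
    P.negPos p (q + q') = P.negPos p q + P.negPos p q' := by
  simp only [negPos, Prod.fst_add, Prod.snd_add, map_add, map_sub, map_neg, map_smul,
    LinearMap.add_apply, dM_add_left, dM_add_right]
  module
lemma negPos_smul_left (r : k) (p q : P.Quad) : P.negPos (r • p) q = r • P.negPos p q := by
  simp only [negPos, Prod.smul_fst, Prod.smul_snd, map_add, map_sub, map_neg, map_smul,
    LinearMap.smul_apply, dM_smul_left, dM_smul_right, smul_eq_mul]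
  module
lemma negPos_smul_right (r : k) (p q : P.Quad) : P.negPos p (r • q) = r • P.negPos p q := by
  simp only [negPos, Prod.smul_fst, Prod.smul_snd, map_add, map_sub, map_neg, map_smul,
    LinearMap.smul_apply, dM_smul_left, dM_smul_right, smul_eq_mul]
  module

lemma negPos_skew (p q : P.Quad) : P.negPos q p = P.negPos p q + P.omega p q • P.xiM := by
  simp only [negPos, omega, map_add, map_sub, map_neg, map_smul, P.cross_comm q.2.1,
    P.cross'_comm q.2.2.1]
  module

lemma onX_negPos (p q : P.Quad) (t : k) : M.onX (P.negPos p q) t = P.omega p q * t := by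
  simp only [negPos, map_add, map_sub, map_smul, adJ_eq, adJ'_eq, dM_eq, zetaM, xiM, M.onX_mk,
    omega]
  simp; ring
lemma onY_negPos (p q : P.Quad) (t : k) : M.onY (P.negPos p q) t = -(P.omega p q * t) := by
  simp only [negPos, map_add, map_sub, map_smul, adJ_eq, adJ'_eq, dM_eq, zetaM, xiM, M.onY_mk,
    omega]
  simp; ring

lemma onPos_negPos (p q r : P.Quad) : M.onPos (P.negPos p q) r =
    P.actJ' (-(p.1 • q.2.2.1) + P.cross p.2.1 q.2.1 - q.1 • p.2.2.1) r +
    ((p.1 * q.2.2.2 - P.T p.2.1 q.2.2.1) • P.zetaPos r +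
      (P.T q.2.1 p.2.2.1 - p.2.2.2 * q.1) • (r - P.zetaPos r) +
      P.actD p.2.1 q.2.2.1 r + P.actD q.2.1 p.2.2.1 r) +
    P.actJ (-(q.2.2.2 • p.2.1) + P.cross' p.2.2.1 q.2.2.1 - p.2.2.2 • q.2.1) r := by
  simp only [negPos, map_add, map_sub, map_smul, adJ_eq, adJ'_eq, dM_eq, zetaM, xiM, M.onPos_mk]
  simp

lemma onPos_negPos_sub (p q r : P.Quad) :
    M.onPos (P.negPos p q) r - M.onPos (P.negPos p r) q = -(P.omega q r • p) := by
  rw [onPos_negPos, onPos_negPos]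
  simp only [actJ_apply, actJ'_apply, actD_apply, zetaPos_apply, D, D', LinearMap.coe_mk,
    AddHom.coe_mk, omega]
  obtain ⟨l, b, b', m⟩ := p
  obtain ⟨n, c, c', s⟩ := q
  obtain ⟨n₂, d, d', s₂⟩ := r
  have h1 : P.T d (P.cross b c) = P.T c (P.cross b d) := by
    rw [P.T_cross b c d, P.T_cross b d c, P.cross_comm d c]
  have h2 : P.T (P.cross' b' c') d' = P.T (P.cross' b' d') c' := by
    rw [P.T_cross' b' c' d', P.T_cross' b' d' c', P.cross'_comm d' c']
  refine Prod.ext ?_ (Prod.ext ?_ (Prod.ext ?_ ?_))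
  · simp only [Prod.fst_sub, Prod.fst_add, Prod.fst_neg, Prod.smul_fst, map_add, map_sub, map_neg,
      map_smul, smul_eq_mul]
    linear_combination -h1
  · simp only [Prod.fst_sub, Prod.fst_add, Prod.fst_neg, Prod.smul_fst, Prod.snd_sub, Prod.snd_add,
      Prod.snd_neg, Prod.smul_snd, map_add, map_sub, map_neg, map_smul, LinearMap.add_apply,
      LinearMap.sub_apply, LinearMap.neg_apply, LinearMap.smul_apply]
    rw [P.cross_comm d c, P.cross'_comm d' c']
    module
  · simp only [Prod.fst_sub, Prod.fst_add, Prod.fst_neg, Prod.smul_fst, Prod.snd_sub, Prod.snd_add,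
      Prod.snd_neg, Prod.smul_snd, map_add, map_sub, map_neg, map_smul, LinearMap.add_apply,
      LinearMap.sub_apply, LinearMap.neg_apply, LinearMap.smul_apply]
    rw [P.cross_comm d c, P.cross'_comm d' c']
    module
  · simp only [Prod.snd_sub, Prod.snd_add, Prod.snd_neg, Prod.smul_snd, map_add, map_sub, map_neg,
      map_smul, LinearMap.add_apply, LinearMap.sub_apply, LinearMap.neg_apply,
      LinearMap.smul_apply, smul_eq_mul]
    linear_combination h2


lemma D_triple (a b c : J) (e : J) :
    P.D a (P.cross b c) e + P.D b (P.cross c a) e + P.D c (P.cross a b) e =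
      (2 * P.T c (P.cross a b)) • e := by
  have h := P.cross_cross a b c e
  have h1 : P.T a (P.cross b c) = P.T c (P.cross a b) := (P.T_cross a b c).symm
  have h2 : P.T b (P.cross c a) = P.T c (P.cross a b) := by
    rw [P.T_cross c a b]
  have h4 : P.T e (P.cross c a) = P.T a (P.cross c e) := by
    rw [P.T_cross c a e, P.T_cross c e a, P.cross_comm a e]
  have h5 : P.T e (P.cross a b) = P.T b (P.cross e a) := (P.T_cross e a b).symm
  simp only [D, LinearMap.coe_mk, AddHom.coe_mk, h1, h2, h4, h5]
  rw [P.cross'_comm (P.cross a e), P.cross'_comm (P.cross b e), P.cross'_comm (P.cross c e)]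
  linear_combination (norm := module) -h

lemma D'_triple (a b c : J) (e : J') :
    P.D' (P.cross b c) a e + P.D' (P.cross c a) b e + P.D' (P.cross a b) c e =
      (2 * P.T c (P.cross a b)) • e := by
  have h := P.cross_cross_cross a b c e
  have h1 : P.T a (P.cross b c) = P.T c (P.cross a b) := (P.T_cross a b c).symm
  have h2 : P.T b (P.cross c a) = P.T c (P.cross a b) := by
    rw [P.T_cross c a b]
  simp only [D', LinearMap.coe_mk, AddHom.coe_mk, h1, h2]
  rw [P.cross_comm (P.cross' _ e) a, P.cross_comm (P.cross' _ e) b, P.cross_comm (P.cross' _ e) c,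
    P.cross'_comm _ e, P.cross'_comm _ e, P.cross'_comm _ e]
  linear_combination (norm := module) -h

lemma D_triple' (a b c : J') (e : J) :
    P.D (P.cross' b c) a e + P.D (P.cross' c a) b e + P.D (P.cross' a b) c e =
      (2 * P.T (P.cross' a b) c) • e := by
  have h := P.cross'_cross'_cross' a b c e
  have h1 : P.T (P.cross' b c) a = P.T (P.cross' a b) c := (P.T_cross' a b c).symm
  have h2 : P.T (P.cross' c a) b = P.T (P.cross' a b) c := by
    rw [P.T_cross' c a b]
  simp only [D, LinearMap.coe_mk, AddHom.coe_mk, h1, h2]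
  rw [P.cross'_comm (P.cross _ e) a, P.cross'_comm (P.cross _ e) b, P.cross'_comm (P.cross _ e) c,
    P.cross_comm _ e, P.cross_comm _ e, P.cross_comm _ e]
  linear_combination (norm := module) -h

lemma D'_triple' (a b c : J') (e : J') :
    P.D' a (P.cross' b c) e + P.D' b (P.cross' c a) e + P.D' c (P.cross' a b) e =
      (2 * P.T (P.cross' a b) c) • e := by
  have h := P.cross'_cross' a b c e
  have h1 : P.T (P.cross' b c) a = P.T (P.cross' a b) c := (P.T_cross' a b c).symm
  have h2 : P.T (P.cross' c a) b = P.T (P.cross' a b) c := by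
    rw [P.T_cross' c a b]
  have h4 : P.T (P.cross' c a) e = P.T (P.cross' c e) a := by
    rw [P.T_cross' c a e, P.T_cross' c e a, P.cross'_comm a e]
  have h5 : P.T (P.cross' a b) e = P.T (P.cross' e a) b := (P.T_cross' e a b).symm
  simp only [D', LinearMap.coe_mk, AddHom.coe_mk, h1, h2, h4, h5]
  rw [P.cross_comm (P.cross' a e), P.cross_comm (P.cross' b e), P.cross_comm (P.cross' c e)]
  linear_combination (norm := module) -h

/-- `𝐝_{a, b × c} + 𝐝_{b, c × a} + 𝐝_{c, a × b} = T(c, a × b) (2ζ - ξ)`. -/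
lemma dM_triple (a b c : J) :
    P.dM a (P.cross b c) + P.dM b (P.cross c a) + P.dM c (P.cross a b) =
      P.T c (P.cross a b) • ((2 : k) • P.zetaM - P.xiM) := by
  have h1 : P.T a (P.cross b c) = P.T c (P.cross a b) := (P.T_cross a b c).symm
  have h2 : P.T b (P.cross c a) = P.T c (P.cross a b) := by
    rw [P.T_cross c a b]
  have key : P.actD a (P.cross b c) + P.actD b (P.cross c a) + P.actD c (P.cross a b) =
      P.T c (P.cross a b) • ((2 : k) • P.zetaPos - 1) := by
    apply LinearMap.ext; intro q
    have h3 := P.D_triple a b c q.2.1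
    have h4 := P.D'_triple a b c q.2.2.1
    simp only [LinearMap.add_apply, LinearMap.smul_apply, LinearMap.sub_apply, actD_apply,
      zetaPos_apply, Module.End.one_apply, h1, h2]
    refine Prod.ext ?_ (Prod.ext ?_ (Prod.ext ?_ ?_)) <;>
      simp only [Prod.fst_add, Prod.snd_add, Prod.smul_fst, Prod.smul_snd, Prod.fst_sub,
        Prod.snd_sub, smul_eq_mul]
    · ring
    · linear_combination (norm := module) h3
    · linear_combination (norm := module) -h4
    · ring
  apply M.ext <;> simp only [dM_eq, map_add, map_sub, map_smul, zetaM, xiM, M.onX_mk, M.onNeg_mk,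
    M.onPos_mk, M.onY_mk, key]
  · apply LinearMap.ext; intro t; simp
  · rw [zetaNeg_eq]
    congr 1
    apply LinearMap.ext; intro t
    simp only [LinearMap.sub_apply, LinearMap.smul_apply, Module.End.one_apply, LinearMap.neg_apply]
    module
  · apply LinearMap.ext; intro t; simp

lemma dM_triple' (a b c : J') :
    P.dM (P.cross' b c) a + P.dM (P.cross' c a) b + P.dM (P.cross' a b) c =
      P.T (P.cross' a b) c • ((2 : k) • P.zetaM - P.xiM) := by
  have h1 : P.T (P.cross' b c) a = P.T (P.cross' a b) c := (P.T_cross' a b c).symm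
  have h2 : P.T (P.cross' c a) b = P.T (P.cross' a b) c := by
    rw [P.T_cross' c a b]
  have key : P.actD (P.cross' b c) a + P.actD (P.cross' c a) b + P.actD (P.cross' a b) c =
      P.T (P.cross' a b) c • ((2 : k) • P.zetaPos - 1) := by
    apply LinearMap.ext; intro q
    have h3 := P.D_triple' a b c q.2.1
    have h4 := P.D'_triple' a b c q.2.2.1
    simp only [LinearMap.add_apply, LinearMap.smul_apply, LinearMap.sub_apply, actD_apply,
      zetaPos_apply, Module.End.one_apply, h1, h2]
    refine Prod.ext ?_ (Prod.ext ?_ (Prod.ext ?_ ?_)) <;>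
      simp only [Prod.fst_add, Prod.snd_add, Prod.smul_fst, Prod.smul_snd, Prod.fst_sub,
        Prod.snd_sub, smul_eq_mul]
    · ring
    · linear_combination (norm := module) h3
    · linear_combination (norm := module) -h4
    · ring
  apply M.ext <;> simp only [dM_eq, map_add, map_sub, map_smul, zetaM, xiM, M.onX_mk, M.onNeg_mk,
    M.onPos_mk, M.onY_mk, key]
  · apply LinearMap.ext; intro t; simp
  · rw [zetaNeg_eq]
    congr 1
    apply LinearMap.ext; intro t
    simp only [LinearMap.sub_apply, LinearMap.smul_apply, Module.End.one_apply, LinearMap.neg_apply]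
    module
  · apply LinearMap.ext; intro t; simp


/-- The compatibility conditions of an element of `M` with the remaining brackets. -/
structure IsDer (f : P.M) : Prop where
  neg_eq : ∀ q, M.onNeg f q = M.onX f 1 • q + M.onPos f q
  onY_eq : M.onY f 1 = - M.onX f 1
  omega_eq : ∀ p q, P.omega (M.onPos f p) q + P.omega p (M.onPos f q) = M.onY f 1 * P.omega p q
  negPos_eq : ∀ p q, f * P.negPos p q - P.negPos p q * f =
    P.negPos (M.onNeg f p) q + P.negPos p (M.onPos f q)

lemma IsDer.zero : P.IsDer 0 where
  neg_eq q := by simp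
  onY_eq := by simp
  omega_eq p q := by simp [omega]
  negPos_eq p q := by
    have h1 := P.negPos_smul_left 0 p q
    have h2 := P.negPos_smul_right 0 p q
    simp only [zero_smul] at h1 h2
    simp [h1, h2]

lemma IsDer.add {f g : P.M} (hf : P.IsDer f) (hg : P.IsDer g) : P.IsDer (f + g) where
  neg_eq q := by simp only [map_add, LinearMap.add_apply, hf.neg_eq, hg.neg_eq]; module
  onY_eq := by simp only [map_add, LinearMap.add_apply, hf.onY_eq, hg.onY_eq]; ring
  omega_eq p q := by
    simp only [map_add, LinearMap.add_apply, omega_add_left, omega_add_right]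
    linear_combination hf.omega_eq p q + hg.omega_eq p q
  negPos_eq p q := by
    simp only [comm_add_left, map_add, LinearMap.add_apply, negPos_add_left, negPos_add_right,
      hf.negPos_eq, hg.negPos_eq]
    abel

lemma IsDer.smul (r : k) {f : P.M} (hf : P.IsDer f) : P.IsDer (r • f) where
  neg_eq q := by simp only [map_smul, LinearMap.smul_apply, hf.neg_eq, smul_eq_mul]; module
  onY_eq := by simp only [map_smul, LinearMap.smul_apply, hf.onY_eq, smul_eq_mul]; ring
  omega_eq p q := by
    simp only [map_smul, LinearMap.smul_apply, omega_smul_left, omega_smul_right, smul_eq_mul]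
    linear_combination r * hf.omega_eq p q
  negPos_eq p q := by
    simp only [map_smul, LinearMap.smul_apply, negPos_smul_left, negPos_smul_right,
      smul_mul_assoc, mul_smul_comm, ← smul_sub, ← smul_add, hf.negPos_eq]

lemma end_apply (g : Module.End k k) (t : k) : g t = t * g 1 := by
  rw [← smul_eq_mul, ← map_smul, smul_eq_mul, mul_one]

lemma negPos_sub_left (p p' q : P.Quad) : P.negPos (p - p') q = P.negPos p q - P.negPos p' q := by
  rw [eq_sub_iff_add_eq, ← negPos_add_left, sub_add_cancel]
lemma negPos_sub_right (p q q' : P.Quad) :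
    P.negPos p (q - q') = P.negPos p q - P.negPos p q' := by
  rw [eq_sub_iff_add_eq, ← negPos_add_right, sub_add_cancel]
lemma omega_sub_left (p p' q : P.Quad) : P.omega (p - p') q = P.omega p q - P.omega p' q := by
  rw [eq_sub_iff_add_eq, ← omega_add_left, sub_add_cancel]
lemma omega_sub_right (p q q' : P.Quad) : P.omega p (q - q') = P.omega p q - P.omega p q' := by
  rw [eq_sub_iff_add_eq, ← omega_add_right, sub_add_cancel]

lemma comm_jacobi {R : Type*} [Ring R] (f g h : R) : (f * g - g * f) * h - h * (f * g - g * f) =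
    (f * (g * h - h * g) - (g * h - h * g) * f) - (g * (f * h - h * f) - (f * h - h * f) * g) := by
  noncomm_ring

lemma IsDer.comm {f g : P.M} (hf : P.IsDer f) (hg : P.IsDer g) : P.IsDer (f * g - g * f) where
  neg_eq q := by
    simp only [map_sub, map_mul, LinearMap.sub_apply, Module.End.mul_apply, hf.neg_eq, hg.neg_eq,
      map_add, map_smul]
    rw [end_apply (M.onX f) (M.onX g 1), end_apply (M.onX g) (M.onX f 1)]
    module
  onY_eq := by
    simp only [map_sub, map_mul, LinearMap.sub_apply, Module.End.mul_apply]
    rw [end_apply (M.onX f) (M.onX g 1), end_apply (M.onX g) (M.onX f 1),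
      end_apply (M.onY f) (M.onY g 1), end_apply (M.onY g) (M.onY f 1)]
    ring
  omega_eq p q := by
    simp only [map_sub, map_mul, LinearMap.sub_apply, Module.End.mul_apply, omega_sub_left,
      omega_sub_right]
    rw [end_apply (M.onY f) (M.onY g 1), end_apply (M.onY g) (M.onY f 1)]
    linear_combination hf.omega_eq (M.onPos g p) q + hf.omega_eq p (M.onPos g q)
      - hg.omega_eq (M.onPos f p) q - hg.omega_eq p (M.onPos f q)
      + M.onY f 1 * hg.omega_eq p q - M.onY g 1 * hf.omega_eq p q
  negPos_eq p q := by
    rw [comm_jacobi, hf.negPos_eq, hg.negPos_eq]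
    simp only [comm_add_right, hf.negPos_eq, hg.negPos_eq, map_sub, map_mul, LinearMap.sub_apply,
      Module.End.mul_apply, negPos_sub_left, negPos_sub_right]
    abel


lemma dM_zero_left (a' : J') : P.dM 0 a' = 0 := by simp [dM]
lemma dM_zero_right (a : J) : P.dM a 0 = 0 := by simp [dM]
lemma onNeg_adJ (a : J) : M.onNeg (P.adJ a) = P.actJ a := rfl
lemma onPos_adJ (a : J) : M.onPos (P.adJ a) = P.actJ a := rfl
lemma onNeg_adJ' (a : J') : M.onNeg (P.adJ' a) = P.actJ' a := rfl
lemma onPos_adJ' (a : J') : M.onPos (P.adJ' a) = P.actJ' a := rfl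
lemma dM_neg_right (a : J) (a' : J') : P.dM a (-a') = -P.dM a a' := by
  simp only [dM, map_neg, mul_neg, neg_mul]; abel
lemma dM_neg_left (a : J) (a' : J') : P.dM (-a) a' = -P.dM a a' := by
  simp only [dM, map_neg, mul_neg, neg_mul]; abel
lemma dM_sub_right (a : J) (a' b' : J') : P.dM a (a' - b') = P.dM a a' - P.dM a b' := by
  rw [sub_eq_add_neg, dM_add_right, dM_neg_right, sub_eq_add_neg]
lemma dM_sub_left (a b : J) (a' : J') : P.dM (a - b) a' = P.dM a a' - P.dM b a' := by
  rw [sub_eq_add_neg, dM_add_left, dM_neg_left, sub_eq_add_neg]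

lemma comm_lin (A Z X d₁ d₂ B C : P.M) (s t : k) :
    C * (A + (s • Z + t • (X - Z) + d₁ + d₂) + B) - (A + (s • Z + t • (X - Z) + d₁ + d₂) + B) * C =
      (C * A - A * C) + (s • (C * Z - Z * C) + t • ((C * X - X * C) - (C * Z - Z * C))
        + (C * d₁ - d₁ * C) + (C * d₂ - d₂ * C)) + (C * B - B * C) := by
  simp only [mul_add, add_mul, mul_sub, sub_mul, mul_smul_comm, smul_mul_assoc, smul_sub]
  abel

lemma isDer_adJ (a : J) : P.IsDer (P.adJ a) where
  neg_eq q := by simp [adJ_eq]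
  onY_eq := by simp [adJ_eq]
  omega_eq p q := by
    simp only [adJ_eq, M.onPos_mk, M.onY_mk, actJ_apply, omega, map_smul, LinearMap.smul_apply,
      smul_eq_mul, LinearMap.zero_apply]
    have h : P.T p.2.1 (P.cross a q.2.1) = P.T q.2.1 (P.cross a p.2.1) := by
      rw [P.T_cross a q.2.1 p.2.1, P.T_cross a p.2.1 q.2.1, P.cross_comm q.2.1]
    linear_combination h
  negPos_eq p q := by
    obtain ⟨l, b, b', m⟩ := p
    obtain ⟨n, c, c', s⟩ := q
    have e1 : ∀ x' : J', P.adJ a * P.adJ' x' - P.adJ' x' * P.adJ a = - P.dM a x' := fun x' => by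
      rw [dM, neg_sub]
    have e2 : P.adJ a * P.zetaM - P.zetaM * P.adJ a = - P.adJ a := by
      rw [← P.comm_zetaM_adJ a, neg_sub, P.comm_zetaM_adJ]
    have e3 : P.adJ a * P.xiM - P.xiM * P.adJ a = 0 := by rw [xiM_comm, sub_self]
    have e4 : ∀ (x : J) (x' : J'), P.adJ a * P.dM x x' - P.dM x x' * P.adJ a =
        - P.adJ (P.D x x' a) := fun x x' => by
      rw [← P.comm_dM_adJ, neg_sub]
    have h := P.dM_triple a b c
    have hT : P.T b (P.cross a c) = P.T c (P.cross a b) := by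
      rw [P.T_cross a c b, P.T_cross a b c, P.cross_comm c b]
    simp only [negPos]
    rw [comm_lin, e1, e2, e3, e4, e4, comm_adJ_adJ]
    simp only [onNeg_adJ, onPos_adJ, actJ_apply, D, LinearMap.coe_mk, AddHom.coe_mk, dM_sub_right,
      dM_add_right, dM_neg_right, dM_smul_right, dM_smul_left, map_add, map_sub, map_smul, map_neg,
      LinearMap.smul_apply]
    rw [P.cross_comm c a] at h
    rw [P.cross_comm b a, P.cross_comm c a, hT, P.cross'_comm b' (P.cross a c)]
    linear_combination (norm := module) -h

lemma isDer_adJ' (a' : J') : P.IsDer (P.adJ' a') where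
  neg_eq q := by simp [adJ'_eq]
  onY_eq := by simp [adJ'_eq]
  omega_eq p q := by
    simp only [adJ'_eq, M.onPos_mk, M.onY_mk, actJ'_apply, omega, Prod.fst_neg, Prod.snd_neg,
      map_neg, LinearMap.neg_apply, map_smul, smul_eq_mul, LinearMap.zero_apply]
    have h : P.T (P.cross' a' q.2.2.1) p.2.2.1 = P.T (P.cross' a' p.2.2.1) q.2.2.1 := by
      rw [P.T_cross' a' q.2.2.1 p.2.2.1, P.T_cross' a' p.2.2.1 q.2.2.1, P.cross'_comm q.2.2.1]
    linear_combination h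
  negPos_eq p q := by
    obtain ⟨l, b, b', m⟩ := p
    obtain ⟨n, c, c', s⟩ := q
    have e1 : ∀ x : J, P.adJ' a' * P.adJ x - P.adJ x * P.adJ' a' = P.dM x a' := fun x => rfl
    have e2 : P.adJ' a' * P.zetaM - P.zetaM * P.adJ' a' = P.adJ' a' := by
      rw [← neg_sub, P.comm_zetaM_adJ', neg_neg]
    have e3 : P.adJ' a' * P.xiM - P.xiM * P.adJ' a' = 0 := by rw [xiM_comm, sub_self]
    have e4 : ∀ (x : J) (x' : J'), P.adJ' a' * P.dM x x' - P.dM x x' * P.adJ' a' =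
        P.adJ' (P.D' x' x a') := fun x x' => by
      rw [← neg_sub, P.comm_dM_adJ', neg_neg]
    have h := P.dM_triple' a' b' c'
    have hT : P.T (P.cross' a' c') b' = P.T (P.cross' a' b') c' := by
      rw [P.T_cross' a' c' b', P.T_cross' a' b' c', P.cross'_comm c' b']
    simp only [negPos]
    rw [comm_lin, e1, e2, e3, e4, e4, comm_adJ'_adJ']
    simp only [onNeg_adJ', onPos_adJ', actJ'_apply, D', LinearMap.coe_mk, AddHom.coe_mk,
      dM_sub_left, dM_add_left, dM_neg_left, dM_smul_right, dM_smul_left, dM_neg_right,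
      Prod.fst_neg, Prod.snd_neg, map_add, map_sub, map_smul, map_neg, LinearMap.neg_apply,
      LinearMap.smul_apply]
    rw [P.cross'_comm c' a'] at h
    rw [P.cross'_comm b' a', P.cross'_comm c' a', hT, P.cross_comm b (P.cross' a' c')]
    linear_combination (norm := module) h

lemma isDer_xiM : P.IsDer P.xiM where
  neg_eq q := by
    simp only [xiM, M.onNeg_mk, M.onX_mk, M.onPos_mk, LinearMap.neg_apply, Module.End.one_apply]
    simp
    module
  onY_eq := by simp [xiM]
  omega_eq p q := by
    simp only [xiM, M.onPos_mk, M.onY_mk, Module.End.one_apply]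
    simp
    ring
  negPos_eq p q := by
    rw [xiM_comm, sub_self]
    simp only [xiM, M.onPos_mk, M.onNeg_mk, Module.End.one_apply, LinearMap.neg_apply]
    have := P.negPos_smul_left (-1) p q
    rw [neg_one_smul, neg_one_smul] at this
    rw [this, neg_add_cancel]

lemma zetaNeg_apply (q : P.Quad) : P.zetaNeg q = (-2 * q.1, -q.2.1, 0, q.2.2.2) := rfl

lemma isDer_zetaM : P.IsDer P.zetaM where
  neg_eq q := by
    simp only [zetaM, M.onNeg_mk, M.onX_mk, M.onPos_mk, zetaNeg_eq]
    simp
    module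
  onY_eq := by simp [zetaM]
  omega_eq p q := by
    simp only [zetaM, M.onPos_mk, M.onY_mk, zetaPos_apply, omega, Module.End.one_apply]
    simp
    ring
  negPos_eq p q := by
    obtain ⟨l, b, b', m⟩ := p
    obtain ⟨n, c, c', s⟩ := q
    have e3 : P.zetaM * P.xiM - P.xiM * P.zetaM = 0 := by rw [xiM_comm, sub_self]
    simp only [negPos]
    rw [comm_lin, comm_zetaM_adJ, comm_zetaM_adJ', e3, sub_self, comm_zetaM_dM, comm_zetaM_dM]
    simp only [zetaM, M.onNeg_mk, M.onPos_mk, zetaPos_apply, zetaNeg_apply, dM_neg_left,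
      map_add, map_sub, map_smul, map_neg, LinearMap.neg_apply, dM_zero_left, dM_zero_right,
      map_zero, LinearMap.zero_apply]
    module

lemma isDer_of_mem {f : P.M} (hf : f ∈ P.L0) : P.IsDer f := by
  rw [L0_eq_span] at hf
  induction hf using Submodule.span_induction with
  | mem f hf =>
    simp only [genSet, Set.mem_union, Set.mem_range, Set.mem_singleton_iff, Prod.exists] at hf
    obtain ((((⟨a', rfl⟩ | ⟨a, a', rfl⟩) | rfl) | rfl) | ⟨a, rfl⟩) := hf
    · exact P.isDer_adJ' a'
    · exact (P.isDer_adJ' a').comm P (P.isDer_adJ a)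
    · exact P.isDer_zetaM
    · exact P.isDer_xiM
    · exact P.isDer_adJ a
  | zero => exact IsDer.zero P
  | add f g _ _ hf hg => exact hf.add P hg
  | smul r f _ hf => exact hf.smul P r


/-- The underlying module of the Lie algebra `L = L(J, J') = L₋₂ ⊕ L₋₁ ⊕ L₀ ⊕ L₁ ⊕ L₂`. -/
@[ext]
structure L where
  /-- The coefficient of `x` in `L₋₂ = kx`. -/
  x : k
  /-- The component `(λ, b, b', μ)₋` in `L₋₁`. -/
  neg : P.Quad
  /-- The component in `L₀`. -/
  zero : P.L0
  /-- The component `(λ, b, b', μ)₊` in `L₁`. -/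
  pos : P.Quad
  /-- The coefficient of `y` in `L₂ = ky`. -/
  y : k

namespace L

variable {P}

/-- `L` as a product of modules. -/
def equivProd : P.L ≃ k × P.Quad × P.L0 × P.Quad × k where
  toFun l := (l.x, l.neg, l.zero, l.pos, l.y)
  invFun l := ⟨l.1, l.2.1, l.2.2.1, l.2.2.2.1, l.2.2.2.2⟩
  left_inv _ := rfl
  right_inv _ := rfl

instance : AddCommGroup P.L := equivProd.addCommGroup

instance : Module k P.L := equivProd.module k

@[simp] lemma add_x (l m : P.L) : (l + m).x = l.x + m.x := rfl
@[simp] lemma add_neg (l m : P.L) : (l + m).neg = l.neg + m.neg := rfl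
@[simp] lemma add_zero (l m : P.L) : (l + m).zero = l.zero + m.zero := rfl
@[simp] lemma add_pos (l m : P.L) : (l + m).pos = l.pos + m.pos := rfl
@[simp] lemma add_y (l m : P.L) : (l + m).y = l.y + m.y := rfl
@[simp] lemma zero_x : (0 : P.L).x = 0 := rfl
@[simp] lemma zero_neg : (0 : P.L).neg = 0 := rfl
@[simp] lemma zero_zero : (0 : P.L).zero = 0 := rfl
@[simp] lemma zero_pos : (0 : P.L).pos = 0 := rfl
@[simp] lemma zero_y : (0 : P.L).y = 0 := rfl
@[simp] lemma smul_x (r : k) (m : P.L) : (r • m).x = r • m.x := rfl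
@[simp] lemma smul_neg (r : k) (m : P.L) : (r • m).neg = r • m.neg := rfl
@[simp] lemma smul_zero (r : k) (m : P.L) : (r • m).zero = r • m.zero := rfl
@[simp] lemma smul_pos (r : k) (m : P.L) : (r • m).pos = r • m.pos := rfl
@[simp] lemma smul_y (r : k) (m : P.L) : (r • m).y = r • m.y := rfl

/-- The Lie bracket of `L`, by components:
`[f, l] = f(l)` for `f ∈ L₀` and `l ∈ L_i`, `i ≠ 0`; `[f, g] = fg - gf` in `L₀`;
`[x, q₊] = -q₋`, `[y, q₋] = q₊`, `[x, y] = ξ`, `[p₋, q₋] = ω(p, q) x`, `[p₊, q₊] = ω(p, q) y`;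
and `[p₋, q₊] ∈ L₀` is `negPos p q`. -/
instance : Bracket P.L P.L where
  bracket l m :=
    { x := M.onX (l.zero : P.M) m.x - M.onX (m.zero : P.M) l.x + P.omega l.neg m.neg
      neg := M.onNeg (l.zero : P.M) m.neg - M.onNeg (m.zero : P.M) l.neg
        - l.x • m.pos + m.x • l.pos
      zero := ⟨((l.zero : P.M) * m.zero - m.zero * l.zero) + (l.x * m.y - m.x * l.y) • P.xiM
          + P.negPos l.neg m.pos - P.negPos m.neg l.pos,
        sub_mem (add_mem (add_mem (P.comm_mem l.zero.2 m.zero.2) (P.L0.smul_mem _ P.xiM_mem))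
          (P.negPos_mem _ _)) (P.negPos_mem _ _)⟩
      pos := M.onPos (l.zero : P.M) m.pos - M.onPos (m.zero : P.M) l.pos
        + l.y • m.neg - m.y • l.neg
      y := M.onY (l.zero : P.M) m.y - M.onY (m.zero : P.M) l.y + P.omega l.pos m.pos }

lemma bracket_x (l m : P.L) : ⁅l, m⁆.x =
    M.onX (l.zero : P.M) m.x - M.onX (m.zero : P.M) l.x + P.omega l.neg m.neg := rfl
lemma bracket_neg (l m : P.L) : ⁅l, m⁆.neg =
    M.onNeg (l.zero : P.M) m.neg - M.onNeg (m.zero : P.M) l.neg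
      - l.x • m.pos + m.x • l.pos := rfl
lemma bracket_zero (l m : P.L) : (⁅l, m⁆.zero : P.M) =
    ((l.zero : P.M) * m.zero - m.zero * l.zero) + (l.x * m.y - m.x * l.y) • P.xiM
      + P.negPos l.neg m.pos - P.negPos m.neg l.pos := rfl
lemma bracket_pos (l m : P.L) : ⁅l, m⁆.pos =
    M.onPos (l.zero : P.M) m.pos - M.onPos (m.zero : P.M) l.pos
      + l.y • m.neg - m.y • l.neg := rfl
lemma bracket_y (l m : P.L) : ⁅l, m⁆.y =
    M.onY (l.zero : P.M) m.y - M.onY (m.zero : P.M) l.y + P.omega l.pos m.pos := rfl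

lemma skew (l m : P.L) : ⁅m, l⁆ = (-1 : k) • ⁅l, m⁆ := by
  apply L.ext
  · simp only [smul_x, bracket_x, P.omega_skew l.neg m.neg, smul_eq_mul]; ring
  · simp only [smul_neg, bracket_neg]; module
  · apply Subtype.ext
    simp only [smul_zero, Submodule.coe_smul, bracket_zero]; module
  · simp only [smul_pos, bracket_pos]; module
  · simp only [smul_y, bracket_y, P.omega_skew l.pos m.pos, smul_eq_mul]; ring

lemma lie_add' (l m n : P.L) : ⁅l, m + n⁆ = ⁅l, m⁆ + ⁅l, n⁆ := by
  apply L.ext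
  · simp only [bracket_x, add_x, add_neg, add_zero, Submodule.coe_add, map_add,
      LinearMap.add_apply, omega_add_right]; ring
  · simp only [bracket_neg, add_x, add_neg, add_zero, add_pos, Submodule.coe_add, map_add,
      LinearMap.add_apply]; module
  · apply Subtype.ext
    simp only [bracket_zero, add_x, add_y, add_neg, add_zero, add_pos, Submodule.coe_add,
      comm_add_right, negPos_add_left, negPos_add_right]; module
  · simp only [bracket_pos, add_y, add_neg, add_zero, add_pos, Submodule.coe_add, map_add,
      LinearMap.add_apply]; module
  · simp only [bracket_y, add_y, add_pos, add_zero, Submodule.coe_add, map_add,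
      LinearMap.add_apply, omega_add_right]; ring

lemma lie_smul' (r : k) (l m : P.L) : ⁅l, r • m⁆ = r • ⁅l, m⁆ := by
  apply L.ext
  · simp only [bracket_x, smul_x, smul_neg, smul_zero, Submodule.coe_smul, map_smul,
      LinearMap.smul_apply, omega_smul_right]; simp only [smul_eq_mul]; ring
  · simp only [bracket_neg, smul_x, smul_neg, smul_zero, smul_pos, Submodule.coe_smul, map_smul,
      LinearMap.smul_apply]; module
  · apply Subtype.ext
    simp only [bracket_zero, smul_x, smul_y, smul_neg, smul_zero, smul_pos, Submodule.coe_smul,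
      smul_eq_mul, mul_smul_comm, smul_mul_assoc, negPos_smul_left, negPos_smul_right]; module
  · simp only [bracket_pos, smul_y, smul_neg, smul_zero, smul_pos, Submodule.coe_smul, map_smul,
      LinearMap.smul_apply]; module
  · simp only [bracket_y, smul_y, smul_pos, smul_zero, Submodule.coe_smul, map_smul,
      LinearMap.smul_apply, omega_smul_right]; simp only [smul_eq_mul]; ring

lemma lie_self' (l : P.L) : ⁅l, l⁆ = 0 := by
  apply L.ext
  · simp [bracket_x, omega_self]
  · simp [bracket_neg]
  · apply Subtype.ext
    simp [bracket_zero]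
  · simp [bracket_pos]
  · simp [bracket_y, omega_self]

lemma exists_scalar {f : P.M} (hf : f ∈ P.L0) : ∃ a : k, (∀ t, M.onX f t = a * t) ∧
    (∀ t, M.onY f t = -(a * t)) ∧ (∀ q, M.onNeg f q = a • q + M.onPos f q) ∧
    ∀ p q, P.omega (M.onPos f p) q + P.omega p (M.onPos f q) = -(a * P.omega p q) := by
  have d := P.isDer_of_mem hf
  refine ⟨M.onX f 1, fun t => ?_, fun t => ?_, d.neg_eq, fun p q => ?_⟩
  · rw [end_apply, mul_comm]
  · rw [end_apply, d.onY_eq]; ring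
  · rw [d.omega_eq, d.onY_eq]; ring

lemma leibniz (l m n : P.L) : ⁅l, ⁅m, n⁆⁆ = ⁅⁅l, m⁆, n⁆ + ⁅m, ⁅l, n⁆⁆ := by
  obtain ⟨x₁, p₁, ⟨f₁, hf₁⟩, q₁, y₁⟩ := l
  obtain ⟨x₂, p₂, ⟨f₂, hf₂⟩, q₂, y₂⟩ := m
  obtain ⟨x₃, p₃, ⟨f₃, hf₃⟩, q₃, y₃⟩ := n
  obtain ⟨a₁, hx₁, hy₁, hn₁, hw₁⟩ := exists_scalar hf₁
  obtain ⟨a₂, hx₂, hy₂, hn₂, hw₂⟩ := exists_scalar hf₂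
  obtain ⟨a₃, hx₃, hy₃, hn₃, hw₃⟩ := exists_scalar hf₃
  have onXxi : ∀ t, M.onX P.xiM t = -2 * t := fun t => by simp [xiM]
  have onYxi : ∀ t, M.onY P.xiM t = 2 * t := fun t => by simp [xiM]
  have onNxi : ∀ q, M.onNeg P.xiM q = -q := fun t => by simp [xiM]
  have onPxi : ∀ q, M.onPos P.xiM q = q := fun t => by simp [xiM]
  have onNnp : ∀ p q r, M.onNeg (P.negPos p q) r = M.onPos (P.negPos q p) r := by
    intro p q r
    have := (P.isDer_of_mem (P.negPos_mem p q)).neg_eq r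
    rw [onX_negPos, mul_one] at this
    rw [this, P.negPos_skew p q, map_add, map_smul, LinearMap.add_apply, LinearMap.smul_apply,
      onPxi, add_comm]
  apply L.ext
  · simp only [add_x, bracket_x, bracket_neg, bracket_zero, map_add, map_sub, map_mul, map_smul,
      LinearMap.add_apply, LinearMap.sub_apply, LinearMap.smul_apply, Module.End.mul_apply,
      omega_add_left, omega_add_right, omega_sub_left, omega_sub_right, omega_smul_left,
      omega_smul_right, onX_negPos, hx₁, hx₂, hx₃, hn₁, hn₂, hn₃, onXxi, smul_eq_mul]
    linear_combination -hw₁ p₂ p₃ + hw₂ p₁ p₃ - hw₃ p₁ p₂ + P.omega_skew (M.onPos f₃ p₁) p₂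
      + a₃ * P.omega_skew p₁ p₂ - x₂ * P.omega_skew q₁ p₃ + x₁ * P.omega_skew q₂ p₃
  · simp only [add_neg, bracket_x, bracket_neg, bracket_zero, bracket_pos, map_add, map_sub,
      map_mul, map_smul,
      LinearMap.add_apply, LinearMap.sub_apply, LinearMap.smul_apply, Module.End.mul_apply,
      hx₁, hx₂, hx₃, hn₁, hn₂, hn₃, onNxi, onNnp]
    have h1 := P.onPos_negPos_sub q₁ p₂ p₃
    have h2 := P.onPos_negPos_sub q₂ p₁ p₃
    have h3 := P.onPos_negPos_sub q₃ p₁ p₂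
    linear_combination (norm := module) h1 - h2 + h3
  · apply Subtype.ext
    have n₁ := (P.isDer_of_mem hf₁).negPos_eq
    have n₂ := (P.isDer_of_mem hf₂).negPos_eq
    have n₃ := (P.isDer_of_mem hf₃).negPos_eq
    simp only [add_zero, Submodule.coe_add, bracket_x, bracket_y, bracket_neg, bracket_zero,
      bracket_pos, hx₁, hx₂, hx₃, hy₁, hy₂, hy₃, negPos_add_left, negPos_add_right,
      negPos_sub_left, negPos_sub_right, negPos_smul_left, negPos_smul_right, mul_add, add_mul,
      mul_sub, sub_mul, mul_smul_comm, smul_mul_assoc, xiM_comm, mul_assoc]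
    linear_combination (norm := module) n₁ p₂ q₃ - n₁ p₃ q₂ - n₂ p₁ q₃ + n₂ p₃ q₁ + n₃ p₁ q₂
      - n₃ p₂ q₁ - x₁ • P.negPos_skew q₂ q₃ + y₃ • P.negPos_skew p₁ p₂ - y₂ • P.negPos_skew p₁ p₃
      - x₃ • P.negPos_skew q₁ q₂ + y₁ • P.negPos_skew p₂ p₃ + x₂ • P.negPos_skew q₁ q₃
  · simp only [add_pos, bracket_y, bracket_neg, bracket_zero, bracket_pos, map_add, map_sub,
      map_mul, map_smul,
      LinearMap.add_apply, LinearMap.sub_apply, LinearMap.smul_apply, Module.End.mul_apply,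
      hy₁, hy₂, hy₃, hn₁, hn₂, hn₃, onPxi]
    have h1 := P.onPos_negPos_sub p₁ q₂ q₃
    have h2 := P.onPos_negPos_sub p₂ q₁ q₃
    have h3 := P.onPos_negPos_sub p₃ q₁ q₂
    linear_combination (norm := module) -h1 + h2 - h3
  · simp only [add_y, bracket_y, bracket_pos, bracket_zero, map_add, map_sub, map_mul, map_smul,
      LinearMap.add_apply, LinearMap.sub_apply, LinearMap.smul_apply, Module.End.mul_apply,
      omega_add_left, omega_add_right, omega_sub_left, omega_sub_right, omega_smul_left,
      omega_smul_right, onY_negPos, hy₁, hy₂, hy₃, onYxi, smul_eq_mul]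
    linear_combination -hw₁ q₂ q₃ + hw₂ q₁ q₃ - hw₃ q₁ q₂ + P.omega_skew (M.onPos f₃ q₁) q₂
      - y₃ * P.omega_skew p₂ q₁ + y₃ * P.omega_skew p₁ q₂ + y₂ * P.omega_skew q₁ p₃
      - y₁ * P.omega_skew q₂ p₃

instance : LieRing P.L where
  add_lie l m n := by rw [skew n, lie_add', smul_add, ← skew, ← skew]
  lie_add := lie_add'
  lie_self := lie_self'
  leibniz_lie := leibniz

instance : LieAlgebra k P.L where
  lie_smul := lie_smul'

end L

/-- The inclusion `L₋₂ → L`, `t ↦ tx`. -/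
def inclX : k →ₗ[k] P.L where
  toFun t := ⟨t, 0, 0, 0, 0⟩
  map_add' s t := by apply L.ext <;> simp
  map_smul' r t := by apply L.ext <;> simp

/-- The inclusion `L₋₁ → L`. -/
def inclNeg : P.Quad →ₗ[k] P.L where
  toFun q := ⟨0, q, 0, 0, 0⟩
  map_add' s t := by apply L.ext <;> simp
  map_smul' r t := by apply L.ext <;> simp

/-- The inclusion `L₀ → L`. -/
def inclZero : P.L0 →ₗ[k] P.L where
  toFun f := ⟨0, 0, f, 0, 0⟩
  map_add' s t := by apply L.ext <;> simp
  map_smul' r t := by apply L.ext <;> simp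

/-- The inclusion `L₁ → L`. -/
def inclPos : P.Quad →ₗ[k] P.L where
  toFun q := ⟨0, 0, 0, q, 0⟩
  map_add' s t := by apply L.ext <;> simp
  map_smul' r t := by apply L.ext <;> simp

/-- The inclusion `L₂ → L`, `t ↦ ty`. -/
def inclY : k →ₗ[k] P.L where
  toFun t := ⟨0, 0, 0, 0, t⟩
  map_add' s t := by apply L.ext <;> simp
  map_smul' r t := by apply L.ext <;> simp

/-- `λ ↦ (λ, 0, 0, 0)`. -/
def quad₁ : k →ₗ[k] P.Quad := LinearMap.inl k k (J × J' × k)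

/-- `b ↦ (0, b, 0, 0)`. -/
def quad₂ : J →ₗ[k] P.Quad := LinearMap.inr k k (J × J' × k) ∘ₗ LinearMap.inl k J (J' × k)

/-- `b' ↦ (0, 0, b', 0)`. -/
def quad₃ : J' →ₗ[k] P.Quad :=
  LinearMap.inr k k (J × J' × k) ∘ₗ LinearMap.inr k J (J' × k) ∘ₗ LinearMap.inl k J' k

/-- `μ ↦ (0, 0, 0, μ)`. -/
def quad₄ : k →ₗ[k] P.Quad :=
  LinearMap.inr k k (J × J' × k) ∘ₗ LinearMap.inr k J (J' × k) ∘ₗ LinearMap.inr k J' k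

/-- `J` as a subspace of `L₀ ≤ L`. -/
def inclJ : J →ₗ[k] P.L := P.inclZero ∘ₗ P.adJ.codRestrict P.L0 P.adJ_mem

/-- `J'` as a subspace of `L₀ ≤ L`. -/
def inclJ' : J' →ₗ[k] P.L := P.inclZero ∘ₗ P.adJ'.codRestrict P.L0 P.adJ'_mem

/-- `𝐝_{a,a'} ∈ L`. -/
def d (a : J) (a' : J') : P.L := P.inclZero ⟨P.dM a a', P.dM_mem a a'⟩

/-- `ξ ∈ L`. -/
def xi : P.L := P.inclZero ⟨P.xiM, P.xiM_mem⟩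

/-- `ζ ∈ L`. -/
def zeta : P.L := P.inclZero ⟨P.zetaM, P.zetaM_mem⟩

/-- `L_{0,0} = ⟨𝐝_{a,a'}⟩ + kζ + kξ` as a subspace of `L`. -/
def L00 : Submodule k P.L :=
  Submodule.span k (Set.range fun p : J × J' => P.d p.1 p.2) ⊔
    Submodule.span k {P.zeta} ⊔ Submodule.span k {P.xi}

/-- For submodules `l ≤ k`, `U ≤ J`, `U' ≤ J'` and `W ≤ L`, the family of submodules of `L` which
is the image of `l`, `U` or `U'` under the root homomorphism in the degree of a root of `G₂`
(with `G₂` identified with a set of twelve vectors in `ℤ²`; the six long roots are those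
parametrized by `k`), is `W` in degree `(0, 0)`, and is zero in the remaining degrees. -/
def rootPart (l : Ideal k) (U : Submodule k J) (U' : Submodule k J') (W : Submodule k P.L) :
    ℤ × ℤ → Submodule k P.L
  | (-2, -1) => Submodule.map P.inclX l
  | (-1, -2) => Submodule.map (P.inclNeg ∘ₗ P.quad₁) l
  | (-1, -1) => U.map (P.inclNeg ∘ₗ P.quad₂)
  | (-1, 0) => U'.map (P.inclNeg ∘ₗ P.quad₃)
  | (-1, 1) => Submodule.map (P.inclNeg ∘ₗ P.quad₄) l
  | (0, -1) => U'.map P.inclJ'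
  | (0, 0) => W
  | (0, 1) => U.map P.inclJ
  | (1, -1) => Submodule.map (P.inclPos ∘ₗ P.quad₁) l
  | (1, 0) => U.map (P.inclPos ∘ₗ P.quad₂)
  | (1, 1) => U'.map (P.inclPos ∘ₗ P.quad₃)
  | (1, 2) => Submodule.map (P.inclPos ∘ₗ P.quad₄) l
  | (2, 1) => Submodule.map P.inclY l
  | _ => ⊥

/-- The spaces `L_{i,j}` of the `G₂`-grading of `L` (zero if `(i, j)` is neither a root nor
zero). -/
def rootSpace : ℤ × ℤ → Submodule k P.L := P.rootPart ⊤ ⊤ ⊤ P.L00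

/-- An ideal `I` of `L` is graded if it is the (internal) direct sum of the `I ∩ L_α`. -/
def IsGraded (I : LieIdeal k P.L) : Prop :=
  iSupIndep (fun α => I.toSubmodule ⊓ P.rootSpace α) ∧
    ⨆ α, I.toSubmodule ⊓ P.rootSpace α = I.toSubmodule

/-- An ideal `(ℓ, U, U')` of the triple `(k, J, J')`. -/
@[ext]
structure TripleIdeal where
  /-- The ideal `ℓ` of `k`. -/
  l : Ideal k
  /-- The submodule `U` of `J`. -/
  U : Submodule k J
  /-- The submodule `U'` of `J'`. -/
  U' : Submodule k J'
  smul_mem : ∀ r ∈ l, ∀ b : J, r • b ∈ U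
  smul_mem' : ∀ r ∈ l, ∀ b' : J', r • b' ∈ U'
  T_mem : ∀ u ∈ U, ∀ b' : J', P.T u b' ∈ l
  T_mem' : ∀ u' ∈ U', ∀ b : J, P.T b u' ∈ l
  cross_mem : ∀ u ∈ U, ∀ b : J, P.cross u b ∈ U'
  cross'_mem : ∀ u' ∈ U', ∀ b' : J', P.cross' u' b' ∈ U

namespace TripleIdeal

/-- The trivial ideal `(0, 0, 0)`. -/
instance : Bot P.TripleIdeal where
  bot :=
    { l := ⊥, U := ⊥, U' := ⊥
      smul_mem := by simp +contextual
      smul_mem' := by simp +contextual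
      T_mem := by simp +contextual
      T_mem' := by simp +contextual
      cross_mem := by simp +contextual
      cross'_mem := by simp +contextual }

/-- The trivial ideal `(k, J, J')`. -/
instance : Top P.TripleIdeal where
  top :=
    { l := ⊤, U := ⊤, U' := ⊤
      smul_mem := by simp
      smul_mem' := by simp
      T_mem := by simp
      T_mem' := by simp
      cross_mem := by simp
      cross'_mem := by simp }

variable {P} (A : P.TripleIdeal)

/-- The submodule `ℓξ + ℓζ + ⟨𝐝_{a,a'} ∣ a ∈ U, a' ∈ J' or a ∈ J, a' ∈ U'⟩` of `L_{0,0}`. -/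
def zeroMin : Submodule k P.L :=
  Submodule.map (LinearMap.toSpanSingleton k P.L P.xi) A.l ⊔
    Submodule.map (LinearMap.toSpanSingleton k P.L P.zeta) A.l ⊔
    Submodule.span k {f | ∃ a a', (a ∈ A.U ∨ a' ∈ A.U') ∧ f = P.d a a'}

/-- The radical `Rad(ℓ, U, U')`: the elements `∑ λ_{a,a'} 𝐝_{a,a'} + λ_ξ ξ + λ_ζ ζ` of `L_{0,0}`
(the coefficients `λ_{a,a'}` being given by a finitely supported function `s`) such that
`λ_ζ + 2λ_ξ ∈ ℓ`, `∑ λ_{a,a'} T(a,a') ≡ 3λ_ξ` modulo `ℓ`, `∑ λ_{a,a'} D_{a,a'} ≡ 2λ_ξ id_J`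
modulo `U` and `∑ λ_{a,a'} D_{a',a} ≡ 2λ_ξ id_{J'}` modulo `U'`. -/
def rad : Submodule k P.L where
  carrier := {f | ∃ (s : J × J' →₀ k) (lxi lzeta : k),
    f = Finsupp.linearCombination k (fun p : J × J' => P.d p.1 p.2) s + lxi • P.xi + lzeta • P.zeta ∧
    lzeta + 2 * lxi ∈ A.l ∧
    Finsupp.linearCombination k (fun p : J × J' => P.T p.1 p.2) s - 3 * lxi ∈ A.l ∧
    (∀ b : J, Finsupp.linearCombination k (fun p : J × J' => P.D p.1 p.2) s b - (2 * lxi) • b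
      ∈ A.U) ∧
    (∀ b' : J', Finsupp.linearCombination k (fun p : J × J' => P.D' p.2 p.1) s b' - (2 * lxi) • b'
      ∈ A.U')}
  zero_mem' := ⟨0, 0, 0, by simp⟩
  add_mem' := by
    rintro f g ⟨s, x, z, rfl, h1, h2, h3, h4⟩ ⟨s', x', z', rfl, h1', h2', h3', h4'⟩
    refine ⟨s + s', x + x', z + z', ?_, ?_, ?_, fun b => ?_, fun b => ?_⟩
    · simp only [map_add]; module
    · convert add_mem h1 h1' using 1; ring
    · convert add_mem h2 h2' using 1; simp only [map_add]; ring
    · convert add_mem (h3 b) (h3' b) using 1; simp only [map_add, LinearMap.add_apply]; module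
    · convert add_mem (h4 b) (h4' b) using 1; simp only [map_add, LinearMap.add_apply]; module
  smul_mem' := by
    rintro r f ⟨s, x, z, rfl, h1, h2, h3, h4⟩
    refine ⟨r • s, r * x, r * z, ?_, ?_, ?_, fun b => ?_, fun b => ?_⟩
    · simp only [map_smul]; module
    · convert A.l.mul_mem_left r h1 using 1; ring
    · convert A.l.mul_mem_left r h2 using 1; simp only [map_smul, smul_eq_mul]; ring
    · convert A.U.smul_mem r (h3 b) using 1; simp only [map_smul, LinearMap.smul_apply]; module
    · convert A.U'.smul_mem r (h4 b) using 1; simp only [map_smul, LinearMap.smul_apply]; module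

/-- `L(ℓ, U, U')_min`. -/
def lieMin : Submodule k P.L := ⨆ α, P.rootPart A.l A.U A.U' A.zeroMin α

/-- `L(ℓ, U, U')_max`. -/
def lieMax : Submodule k P.L := ⨆ α, P.rootPart A.l A.U A.U' A.rad α

end TripleIdeal

/-- `(k, J, J')` is simple: it has only the trivial ideals. -/
def IsSimpleTriple : Prop := ∀ A : P.TripleIdeal, A = ⊥ ∨ A = ⊤

end LinearCubicNormPair


/-- The data of a cubic norm pair together with those axioms that do not refer to scalar
extensions.  The trace `T'` is the flip of `T`. -/
structure PreCubicNormPair (k : Type u) (J : Type v) (J' : Type w) [CommRing k]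
    [AddCommGroup J] [Module k J] [AddCommGroup J'] [Module k J'] where
  cross : J →ₗ[k] J →ₗ[k] J'
  cross' : J' →ₗ[k] J' →ₗ[k] J
  T : J →ₗ[k] J' →ₗ[k] k
  N : J → k
  N' : J' → k
  sharp : J → J'
  sharp' : J' → J
  cross_comm : ∀ a b, cross a b = cross b a
  cross'_comm : ∀ a b, cross' a b = cross' b a
  sharp_smul : ∀ (r : k) a, sharp (r • a) = r ^ 2 • sharp a
  sharp'_smul : ∀ (r : k) a, sharp' (r • a) = r ^ 2 • sharp' a
  sharp_add : ∀ a b, sharp (a + b) = sharp a + sharp b + cross a b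
  sharp'_add : ∀ a b, sharp' (a + b) = sharp' a + sharp' b + cross' a b
  N_smul : ∀ (r : k) a, N (r • a) = r ^ 3 * N a
  N'_smul : ∀ (r : k) a, N' (r • a) = r ^ 3 * N' a
  T_sharp : ∀ a, T a (sharp a) = 3 * N a
  T_sharp' : ∀ a, T (sharp' a) a = 3 * N' a
  N_add : ∀ a b, N (a + b) = N a + T b (sharp a) + T a (sharp b) + N b
  N'_add : ∀ a b, N' (a + b) = N' a + T (sharp' a) b + T (sharp' b) a + N' b

namespace PreCubicNormPair

variable {k : Type u} {J : Type v} {J' : Type w} [CommRing k]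
  [AddCommGroup J] [Module k J] [AddCommGroup J'] [Module k J']

open scoped TensorProduct in
/-- `E` is the scalar extension of `P` to the `k`-algebra `R` (the maps of `E` are uniquely
determined by this condition, as multilinear, quadratic or cubic maps are determined by their
values on the generators `1 ⊗ a`). -/
structure IsScalarExtension (P : PreCubicNormPair k J J') (R : Type u) [CommRing R] [Algebra k R]
    (E : PreCubicNormPair R (R ⊗[k] J) (R ⊗[k] J')) : Prop where
  cross : ∀ a b, E.cross (1 ⊗ₜ a) (1 ⊗ₜ b) = 1 ⊗ₜ P.cross a b
  cross' : ∀ a b, E.cross' (1 ⊗ₜ a) (1 ⊗ₜ b) = 1 ⊗ₜ P.cross' a b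
  T : ∀ a b, E.T (1 ⊗ₜ a) (1 ⊗ₜ b) = algebraMap k R (P.T a b)
  N : ∀ a, E.N (1 ⊗ₜ a) = algebraMap k R (P.N a)
  N' : ∀ a, E.N' (1 ⊗ₜ a) = algebraMap k R (P.N' a)
  sharp : ∀ a, E.sharp (1 ⊗ₜ a) = 1 ⊗ₜ P.sharp a
  sharp' : ∀ a, E.sharp' (1 ⊗ₜ a) = 1 ⊗ₜ P.sharp' a

/-- The identities `(a^♯)^♯ = N(a) a`, `N(a^♯) = N(a)²` and
`a × (a^♯ × b') = N(a) b' + T(a, b') a^♯`, and those with `J` and `J'` interchanged. -/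
structure Identities (P : PreCubicNormPair k J J') : Prop where
  adjoint : ∀ a, P.sharp' (P.sharp a) = P.N a • a
  adjoint' : ∀ a, P.sharp (P.sharp' a) = P.N' a • a
  norm_sharp : ∀ a, P.N' (P.sharp a) = P.N a ^ 2
  norm_sharp' : ∀ a, P.N (P.sharp' a) = P.N' a ^ 2
  cross_cross : ∀ a b', P.cross a (P.cross' (P.sharp a) b') = P.N a • b' + P.T a b' • P.sharp a
  cross'_cross' : ∀ a' b,
    P.cross' a' (P.cross (P.sharp' a') b) = P.N' a' • b + P.T b a' • P.sharp' a'

/-- Interchanging the roles of `J` and `J'`. -/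
def swap (P : PreCubicNormPair k J J') : PreCubicNormPair k J' J where
  cross := P.cross'
  cross' := P.cross
  T := P.T.flip
  N := P.N'
  N' := P.N
  sharp := P.sharp'
  sharp' := P.sharp
  cross_comm := P.cross'_comm
  cross'_comm := P.cross_comm
  sharp_smul := P.sharp'_smul
  sharp'_smul := P.sharp_smul
  sharp_add := P.sharp'_add
  sharp'_add := P.sharp_add
  N_smul := P.N'_smul
  N'_smul := P.N_smul
  T_sharp := P.T_sharp'
  T_sharp' := P.T_sharp
  N_add := P.N'_add
  N'_add := P.N_add

lemma T_cross (P : PreCubicNormPair k J J') (a b c : J) :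
    P.T c (P.cross a b) = P.T a (P.cross b c) := by
  have h := congrArg P.N (add_assoc a b c)
  simp only [P.N_add, P.sharp_add, map_add, LinearMap.add_apply] at h
  linear_combination h

end PreCubicNormPair

open scoped TensorProduct in
/-- A (proper) cubic norm pair: the three identities hold strictly, that is, in all scalar
extensions. -/
structure CubicNormPair (k : Type u) (J : Type v) (J' : Type w) [CommRing k]
    [AddCommGroup J] [Module k J] [AddCommGroup J'] [Module k J'] extends
    PreCubicNormPair k J J' where
  strict : ∀ (R : Type u) [CommRing R] [Algebra k R],
    ∃ E : PreCubicNormPair R (R ⊗[k] J) (R ⊗[k] J'),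
      toPreCubicNormPair.IsScalarExtension R E ∧ E.Identities

namespace CubicNormPair

variable {k : Type u} {J : Type v} {J' : Type w} [CommRing k]
  [AddCommGroup J] [Module k J] [AddCommGroup J'] [Module k J'] (P : CubicNormPair k J J')

open scoped TensorProduct

/-- Interchanging the roles of `J` and `J'`. -/
def swap : CubicNormPair k J' J where
  toPreCubicNormPair := P.toPreCubicNormPair.swap
  strict R _ _ := by
    obtain ⟨E, hE, hI⟩ := P.strict R
    exact ⟨E.swap, ⟨hE.cross', hE.cross, fun a b => hE.T b a, hE.N', hE.N, hE.sharp', hE.sharp⟩,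
      ⟨hI.adjoint', hI.adjoint, hI.norm_sharp', hI.norm_sharp, hI.cross'_cross', hI.cross_cross⟩⟩

/-- The coefficient of `X ^ n` of an element of `V[X]`. -/
noncomputable def coeffMap (V : Type*) [AddCommGroup V] [Module k V] (n : ℕ) :
    Polynomial k ⊗[k] V →ₗ[k] V :=
  (TensorProduct.lid k V).toLinearMap ∘ₗ (Polynomial.lcoeff k n).rTensor V

lemma coeffMap_tmul (V : Type*) [AddCommGroup V] [Module k V] (n : ℕ) (p : Polynomial k) (v : V) :
    coeffMap V n (p ⊗ₜ[k] v) = p.coeff n • v := by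
  simp [coeffMap]

lemma linearization (a b : J) : P.cross' (P.sharp a) (P.cross a b) =
    P.N a • b + P.T b (P.sharp a) • a := by
  obtain ⟨E, hE, hI⟩ := P.strict (Polynomial k)
  have h := hI.adjoint (1 ⊗ₜ a + (Polynomial.X : Polynomial k) • 1 ⊗ₜ b)
  simp only [E.sharp_add, E.sharp'_add, E.sharp_smul, E.sharp'_smul, E.N_add, E.N_smul, map_add,
    map_smul, LinearMap.add_apply, LinearMap.smul_apply, hE.sharp, hE.sharp', hE.cross, hE.cross',
    hE.N, hE.T, add_smul, smul_add, smul_smul] at h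
  have h' := congrArg (coeffMap J 1) h
  simp only [map_add, TensorProduct.smul_tmul', smul_eq_mul, mul_one, coeffMap_tmul] at h'
  have h4 : ((Polynomial.X : Polynomial k) ^ 4).coeff 1 = 0 := by simp [Polynomial.coeff_X_pow]
  simp [Polynomial.coeff_X, Polynomial.coeff_one, ← pow_mul, ← pow_succ', h4, add_mul, mul_assoc,
    Polynomial.coeff_X_pow] at h'
  rw [h', add_comm]

lemma strict_cross (a : J) (b' : J') :
    P.cross a (P.cross' (P.sharp a) b') = P.N a • b' + P.T a b' • P.sharp a := by
  obtain ⟨E, hE, hI⟩ := P.strict (Polynomial k)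
  have h := congrArg (coeffMap J' 0) (hI.cross_cross (1 ⊗ₜ a) (1 ⊗ₜ b'))
  simpa [hE.sharp, hE.cross, hE.cross', hE.N, hE.T, TensorProduct.smul_tmul', coeffMap_tmul] using h

lemma cross_cross (a b c d : J) :
    P.cross' (P.cross a b) (P.cross c d) + P.cross' (P.cross b c) (P.cross a d)
        + P.cross' (P.cross c a) (P.cross b d) =
      P.T c (P.cross a b) • d + P.T d (P.cross b c) • a + P.T a (P.cross c d) • b
        + P.T b (P.cross d a) • c := by
  have h1 := P.linearization (a + b + c) d
  have h2 := P.linearization (a + b) d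
  have h3 := P.linearization (a + c) d
  have h4 := P.linearization (b + c) d
  have h5 := P.linearization a d
  have h6 := P.linearization b d
  have h7 := P.linearization c d
  simp only [P.sharp_add, P.N_add, map_add, LinearMap.add_apply, add_smul, smul_add] at h1 h2 h3 h4
  rw [P.cross_comm c a, ← P.T_cross a c d, P.T_cross d a b]
  linear_combination (norm := module) h1 - h2 - h3 - h4 + h5 + h6 + h7

lemma cross_cross_cross (a c d : J) (b' : J') :
    P.cross a (P.cross' b' (P.cross c d)) + P.cross c (P.cross' b' (P.cross d a))
        + P.cross d (P.cross' b' (P.cross a c)) =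
      P.T a b' • P.cross c d + P.T c b' • P.cross d a + P.T d b' • P.cross a c
        + P.T d (P.cross a c) • b' := by
  have h1 := P.strict_cross (a + c + d) b'
  have h2 := P.strict_cross (a + c) b'
  have h3 := P.strict_cross (a + d) b'
  have h4 := P.strict_cross (c + d) b'
  have h5 := P.strict_cross a b'
  have h6 := P.strict_cross c b'
  have h7 := P.strict_cross d b'
  simp only [P.sharp_add, P.N_add, map_add, LinearMap.add_apply, add_smul, smul_add] at h1 h2 h3 h4
  rw [P.cross'_comm b', P.cross'_comm b', P.cross'_comm b', P.cross_comm d a]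
  linear_combination (norm := module) h1 - h2 - h3 - h4 + h5 + h6 + h7

/-- The linear cubic norm pair induced by a cubic norm pair. -/
def toLinear : LinearCubicNormPair k J J' where
  cross := P.cross
  cross' := P.cross'
  T := P.T
  cross_comm := P.cross_comm
  cross'_comm := P.cross'_comm
  T_cross := P.T_cross
  T_cross' := P.swap.T_cross
  cross_cross := P.cross_cross
  cross'_cross' := P.swap.cross_cross
  cross_cross_cross := P.cross_cross_cross
  cross'_cross'_cross' := P.swap.cross_cross_cross
  T_triple a c b' d' := by
    have h1 : P.T (P.cross' (P.cross a c) b') d' = P.T (P.cross' b' d') (P.cross a c) :=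
      P.swap.T_cross (P.cross a c) b' d'
    have h2 := P.T_cross c a (P.cross' b' d')
    rw [P.cross_comm c a, P.cross_comm a (P.cross' b' d')] at h2
    simp only [map_add, map_sub, map_smul, LinearMap.add_apply, LinearMap.sub_apply,
      LinearMap.smul_apply, smul_eq_mul, h1, h2]
    ring

end CubicNormPair

namespace LinearCubicNormPair

variable {k : Type u} {J : Type v} {J' : Type w} [CommRing k]
  [AddCommGroup J] [Module k J] [AddCommGroup J'] [Module k J']
  (P : LinearCubicNormPair k J J')

/-! In characteristic 2 or 3 distinct roots can have the same weights under `ξ` and `ζ`, so the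
grading of an ideal `I` cannot be found from eigenvalues. Instead, brackets with `x`, `y` and the
elements with coordinate 1 at a long root of `L₋₁` or `L₁` move a chosen coordinate of `m ∈ I` to
`kx` or `ky` and kill the others by degree. This gives `m.x • x, m.y • x ∈ I` (`inclX_x_mem`,
`inclX_y_mem`). If `t • x ∈ I`, then `t • L_{±1}`, `t • ξ`, `t • ζ` and `t • y` lie in `I` too, so
unwanted long-root terms can be subtracted. In this way `I` contains the `L_{±1}`-components of its
elements, and then every coordinate of these (`inclNeg_pos_mem`, `inclPos_neg_mem`,
`inclJ_mem_of_inclPos_mem`).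

A coefficient may be moved between any two roots of the same length and the same parameter module.
Hence three submodules `ℓ`, `U`, `U'` record all root coefficients of `I`, and the brackets of root
elements make them an ideal of the triple (`ofLieIdeal`).

Conversely, an ideal `A` of the triple yields the Lie ideal `A.lieIdeal`: coordinates in `A`, and an
`L₀`-component that maps `x` into `ℓx` and `L₁` into `(ℓ, U, U', ℓ)₊`. Closure under brackets
depends on the identity `onPos_negPos_sub`, which trades the two right-hand arguments of `[[p₋, q₊],
r₊]`. Always `I ≤ (ofLieIdeal I).lieIdeal` (`le_lieIdeal_ofLieIdeal`), and inside `L_{0,0}` the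
conditions defining `lieIdeal` are those of `Rad` in other coordinates (`mem_rad_of_mem_lieIdeal`).
Together with explicit orthogonal projections onto the root spaces this proves gradedness and both
inclusions. The minimal and the maximal submodule differ only in degree `(0, 0)`, so all remaining
freedom is `V = I ∩ L_{0,0}`.

For simplicity, `ofLieIdeal` and `lieIdeal` carry the extreme cases back and forth, while the triple
ideals `ofIdeal 𝔞`, built from an ideal `𝔞` of `k`, detect both proper ideals of `k` and the radical
of `T`. -/

lemma quad₁_apply (t : k) : P.quad₁ t = (t, 0, 0, 0) := rfl
lemma quad₂_apply (b : J) : P.quad₂ b = (0, b, 0, 0) := rfl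
lemma quad₃_apply (b' : J') : P.quad₃ b' = (0, 0, b', 0) := rfl
lemma quad₄_apply (t : k) : P.quad₄ t = (0, 0, 0, t) := rfl

lemma quad_sum (q : P.Quad) :
    P.quad₁ q.1 + P.quad₂ q.2.1 + P.quad₃ q.2.2.1 + P.quad₄ q.2.2.2 = q := by
  obtain ⟨l, b, b', m⟩ := q
  simp [quad₁_apply, quad₂_apply, quad₃_apply, quad₄_apply]

/-! ### Coordinates of elements of `L`. -/

section Components

namespace L

variable {P}

@[simp] lemma neg_x (l : P.L) : (-l).x = -l.x := rfl
@[simp] lemma neg_neg (l : P.L) : (-l).neg = -l.neg := rfl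
@[simp] lemma neg_zero (l : P.L) : (-l).zero = -l.zero := rfl
@[simp] lemma neg_pos (l : P.L) : (-l).pos = -l.pos := rfl
@[simp] lemma neg_y (l : P.L) : (-l).y = -l.y := rfl
@[simp] lemma sub_x (l m : P.L) : (l - m).x = l.x - m.x := rfl
@[simp] lemma sub_neg (l m : P.L) : (l - m).neg = l.neg - m.neg := rfl
@[simp] lemma sub_zero (l m : P.L) : (l - m).zero = l.zero - m.zero := rfl
@[simp] lemma sub_pos (l m : P.L) : (l - m).pos = l.pos - m.pos := rfl
@[simp] lemma sub_y (l m : P.L) : (l - m).y = l.y - m.y := rfl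

end L

@[simp] lemma inclX_x (t : k) : (P.inclX t).x = t := rfl
@[simp] lemma inclX_neg (t : k) : (P.inclX t).neg = 0 := rfl
@[simp] lemma inclX_zero (t : k) : (P.inclX t).zero = 0 := rfl
@[simp] lemma inclX_pos (t : k) : (P.inclX t).pos = 0 := rfl
@[simp] lemma inclX_y (t : k) : (P.inclX t).y = 0 := rfl
@[simp] lemma inclNeg_x (q : P.Quad) : (P.inclNeg q).x = 0 := rfl
@[simp] lemma inclNeg_neg (q : P.Quad) : (P.inclNeg q).neg = q := rfl
@[simp] lemma inclNeg_zero (q : P.Quad) : (P.inclNeg q).zero = 0 := rfl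
@[simp] lemma inclNeg_pos (q : P.Quad) : (P.inclNeg q).pos = 0 := rfl
@[simp] lemma inclNeg_y (q : P.Quad) : (P.inclNeg q).y = 0 := rfl
@[simp] lemma inclZero_x (f : P.L0) : (P.inclZero f).x = 0 := rfl
@[simp] lemma inclZero_neg (f : P.L0) : (P.inclZero f).neg = 0 := rfl
@[simp] lemma inclZero_zero (f : P.L0) : (P.inclZero f).zero = f := rfl
@[simp] lemma inclZero_pos (f : P.L0) : (P.inclZero f).pos = 0 := rfl
@[simp] lemma inclZero_y (f : P.L0) : (P.inclZero f).y = 0 := rfl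
@[simp] lemma inclPos_x (q : P.Quad) : (P.inclPos q).x = 0 := rfl
@[simp] lemma inclPos_neg (q : P.Quad) : (P.inclPos q).neg = 0 := rfl
@[simp] lemma inclPos_zero (q : P.Quad) : (P.inclPos q).zero = 0 := rfl
@[simp] lemma inclPos_pos (q : P.Quad) : (P.inclPos q).pos = q := rfl
@[simp] lemma inclPos_y (q : P.Quad) : (P.inclPos q).y = 0 := rfl
@[simp] lemma inclY_x (t : k) : (P.inclY t).x = 0 := rfl
@[simp] lemma inclY_neg (t : k) : (P.inclY t).neg = 0 := rfl
@[simp] lemma inclY_zero (t : k) : (P.inclY t).zero = 0 := rfl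
@[simp] lemma inclY_pos (t : k) : (P.inclY t).pos = 0 := rfl
@[simp] lemma inclY_y (t : k) : (P.inclY t).y = t := rfl

lemma coe_inclJ_zero (a : J) : ((P.inclJ a).zero : P.M) = P.adJ a := rfl
lemma coe_inclJ'_zero (a' : J') : ((P.inclJ' a').zero : P.M) = P.adJ' a' := rfl
lemma coe_d_zero (a : J) (a' : J') : ((P.d a a').zero : P.M) = P.dM a a' := rfl
lemma coe_xi_zero : (P.xi.zero : P.M) = P.xiM := rfl
lemma coe_zeta_zero : (P.zeta.zero : P.M) = P.zetaM := rfl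

lemma incl_sum (l : P.L) :
    P.inclX l.x + P.inclNeg l.neg + P.inclZero l.zero + P.inclPos l.pos + P.inclY l.y = l := by
  apply L.ext <;> simp

@[simp] lemma omega_zero_left (q : P.Quad) : P.omega 0 q = 0 := by simp [omega]
@[simp] lemma omega_zero_right (q : P.Quad) : P.omega q 0 = 0 := by simp [omega]
@[simp] lemma negPos_zero_left (q : P.Quad) : P.negPos 0 q = 0 := by
  simpa using P.negPos_smul_left 0 0 q
@[simp] lemma negPos_zero_right (q : P.Quad) : P.negPos q 0 = 0 := by
  simpa using P.negPos_smul_right 0 q 0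

end Components

/-! ### Brackets of homogeneous elements. -/

section Brackets

open L

lemma lie_inclX_inclPos (t : k) (q : P.Quad) : ⁅P.inclX t, P.inclPos q⁆ = -P.inclNeg (t • q) := by
  apply L.ext <;> simp [bracket_x, bracket_neg, bracket_pos, bracket_y]
  apply Subtype.ext; simp [bracket_zero]

lemma lie_inclY_inclNeg (t : k) (q : P.Quad) : ⁅P.inclY t, P.inclNeg q⁆ = P.inclPos (t • q) := by
  apply L.ext <;> simp [bracket_x, bracket_neg, bracket_pos, bracket_y]
  apply Subtype.ext; simp [bracket_zero]

lemma lie_inclNeg_inclNeg (p q : P.Quad) : ⁅P.inclNeg p, P.inclNeg q⁆ = P.inclX (P.omega p q) := by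
  apply L.ext <;> simp [bracket_x, bracket_neg, bracket_pos, bracket_y]
  apply Subtype.ext; simp [bracket_zero]

lemma lie_inclPos_inclPos (p q : P.Quad) : ⁅P.inclPos p, P.inclPos q⁆ = P.inclY (P.omega p q) := by
  apply L.ext <;> simp [bracket_x, bracket_neg, bracket_pos, bracket_y]
  apply Subtype.ext; simp [bracket_zero]

lemma lie_inclNeg_inclPos (p q : P.Quad) :
    ⁅P.inclNeg p, P.inclPos q⁆ = P.inclZero ⟨P.negPos p q, P.negPos_mem p q⟩ := by
  apply L.ext <;> simp [bracket_x, bracket_neg, bracket_pos, bracket_y]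
  apply Subtype.ext; simp [bracket_zero]

lemma lie_inclX_inclY (s t : k) : ⁅P.inclX s, P.inclY t⁆ = (s * t) • P.xi := by
  apply L.ext <;> simp [bracket_x, bracket_neg, bracket_pos, bracket_y, xi]
  apply Subtype.ext; simp [bracket_zero]

lemma lie_inclZero_inclPos (f : P.L0) (q : P.Quad) :
    ⁅P.inclZero f, P.inclPos q⁆ = P.inclPos (M.onPos (f : P.M) q) := by
  apply L.ext <;> simp [bracket_x, bracket_neg, bracket_pos, bracket_y]
  apply Subtype.ext; simp [bracket_zero]

lemma lie_inclJ'_inclJ (a : J) (a' : J') : ⁅P.inclJ' a', P.inclJ a⁆ = P.d a a' := by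
  apply L.ext <;> simp [bracket_x, bracket_neg, bracket_pos, bracket_y, inclJ, inclJ', d]
  apply Subtype.ext; simp [bracket_zero, dM]

lemma lie_inclX (l : P.L) : ⁅P.inclX 1, l⁆ =
    -P.inclX (M.onX (l.zero : P.M) 1) - P.inclNeg l.pos + l.y • P.xi := by
  apply L.ext <;> simp [bracket_x, bracket_neg, bracket_pos, bracket_y, xi]
  apply Subtype.ext; simp [bracket_zero]

lemma lie_inclY (l : P.L) : ⁅P.inclY 1, l⁆ =
    -P.inclY (M.onY (l.zero : P.M) 1) + P.inclPos l.neg - l.x • P.xi := by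
  apply L.ext <;> simp [bracket_x, bracket_neg, bracket_pos, bracket_y, xi]
  apply Subtype.ext; simp [bracket_zero]

/-- The double bracket lowers the degree by 3, so only the components of `l` in `L₁` and `L₂`
survive. It is the device that isolates coordinates of an element of an ideal. -/
lemma lie_inclX_inclNeg (q : P.Quad) (l : P.L) : ⁅P.inclX 1, ⁅P.inclNeg q, l⁆⁆ =
    -P.inclX (P.omega q l.pos) + P.inclNeg (l.y • q) := by
  apply L.ext <;> simp [bracket_x, bracket_neg, bracket_pos, bracket_y, bracket_zero, onX_negPos]
  apply Subtype.ext; simp [bracket_zero, bracket_y]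

lemma lie_inclY_inclPos (q : P.Quad) (l : P.L) : ⁅P.inclY 1, ⁅P.inclPos q, l⁆⁆ =
    -P.inclY (P.omega l.neg q) + P.inclPos (l.x • q) := by
  apply L.ext <;> simp [bracket_x, bracket_neg, bracket_pos, bracket_y, bracket_zero, onY_negPos]
  apply Subtype.ext; simp [bracket_zero, bracket_x]

lemma lie_quad₄_quad₂ (t : k) (b : J) :
    ⁅P.inclNeg (P.quad₄ t), P.inclPos (P.quad₂ b)⁆ = -P.inclJ (t • b) := by
  rw [lie_inclNeg_inclPos, ← map_neg, inclJ, LinearMap.comp_apply]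
  congr 1; apply Subtype.ext
  simp [negPos, quad₂_apply, quad₄_apply, dM_zero_right]

lemma lie_quad₁_quad₃ (t : k) (b' : J') :
    ⁅P.inclNeg (P.quad₁ t), P.inclPos (P.quad₃ b')⁆ = -P.inclJ' (t • b') := by
  rw [lie_inclNeg_inclPos, ← map_neg, inclJ', LinearMap.comp_apply]
  congr 1; apply Subtype.ext
  simp [negPos, quad₁_apply, quad₃_apply, dM_zero_left, dM_zero_right]

lemma lie_quad₁_quad₄ (s t : k) :
    ⁅P.inclNeg (P.quad₁ s), P.inclPos (P.quad₄ t)⁆ = (s * t) • P.zeta := by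
  rw [lie_inclNeg_inclPos, zeta, ← map_smul]
  congr 1; apply Subtype.ext
  simp [negPos, quad₁_apply, quad₄_apply, dM_zero_left]

lemma lie_inclNeg_quad₄ (q : P.Quad) :
    ⁅P.inclNeg q, P.inclPos (P.quad₄ 1)⁆ = q.1 • P.zeta - P.inclJ q.2.1 := by
  rw [lie_inclNeg_inclPos, zeta, ← map_smul, inclJ, LinearMap.comp_apply, ← map_sub]
  congr 1; apply Subtype.ext
  simp [negPos, quad₄_apply, dM_zero_left, dM_zero_right, sub_eq_add_neg]

lemma lie_inclNeg_quad₁ (q : P.Quad) :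
    ⁅P.inclNeg q, P.inclPos (P.quad₁ 1)⁆ = -q.2.2.2 • (P.xi - P.zeta) - P.inclJ' q.2.2.1 := by
  rw [lie_inclNeg_inclPos, zeta, xi, ← map_sub, ← map_smul, inclJ', LinearMap.comp_apply,
    ← map_sub]
  congr 1; apply Subtype.ext
  simp [negPos, quad₁_apply, dM_zero_left, dM_zero_right, sub_eq_add_neg, add_comm]

lemma lie_inclJ_inclPos (a : J) (q : P.Quad) :
    ⁅P.inclJ a, P.inclPos q⁆ = P.inclPos (P.actJ a q) :=
  P.lie_inclZero_inclPos _ q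

lemma lie_inclJ'_inclPos (a' : J') (q : P.Quad) :
    ⁅P.inclJ' a', P.inclPos q⁆ = P.inclPos (P.actJ' a' q) :=
  P.lie_inclZero_inclPos _ q

end Brackets

/-! ### Extracting the coordinates of an element of a Lie ideal. -/

section IdealCoefficients

variable {P} {I : LieIdeal k P.L}

lemma lie_mem_of_mem_left {l : P.L} (h : l ∈ I) (m : P.L) : ⁅l, m⁆ ∈ I :=
  lie_mem_left k P.L I l m h

lemma lie_mem_of_mem_right (m : P.L) {l : P.L} (h : l ∈ I) : ⁅m, l⁆ ∈ I :=
  lie_mem_right k P.L I m l h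

/-- This and the next lemmas spread a coefficient from `kx` to the rest of `L`. They supply the
correction terms subtracted in the extractions below. -/
lemma inclNeg_smul_mem {t : k} (h : P.inclX t ∈ I) (q : P.Quad) : P.inclNeg (t • q) ∈ I := by
  have := lie_mem_of_mem_left h (P.inclPos q)
  rwa [lie_inclX_inclPos, neg_mem_iff] at this

lemma inclPos_smul_mem {t : k} (h : P.inclX t ∈ I) (q : P.Quad) : P.inclPos (t • q) ∈ I := by
  have := lie_mem_of_mem_right (P.inclY 1) (inclNeg_smul_mem h q)
  rwa [lie_inclY_inclNeg, one_smul] at this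

lemma omega_quad₄_quad₁ : P.omega (P.quad₄ 1) (P.quad₁ 1) = 1 := by
  simp [omega, quad₁_apply, quad₄_apply]

lemma inclY_mem_of_inclX_mem {t : k} (h : P.inclX t ∈ I) : P.inclY t ∈ I := by
  have := lie_mem_of_mem_left (inclPos_smul_mem h (P.quad₄ 1)) (P.inclPos (P.quad₁ 1))
  rwa [lie_inclPos_inclPos, omega_smul_left, omega_quad₄_quad₁, mul_one] at this

lemma inclX_mem_of_inclY_mem {t : k} (h : P.inclY t ∈ I) : P.inclX t ∈ I := by
  have h1 := lie_mem_of_mem_left h (P.inclNeg (P.quad₄ 1))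
  rw [lie_inclY_inclNeg] at h1
  have h2 := lie_mem_of_mem_right (P.inclX 1) h1
  rw [lie_inclX_inclPos, neg_mem_iff, one_smul] at h2
  have h3 := lie_mem_of_mem_left h2 (P.inclNeg (P.quad₁ 1))
  rwa [lie_inclNeg_inclNeg, omega_smul_left, omega_quad₄_quad₁, mul_one] at h3

lemma smul_xi_mem {t : k} (h : P.inclX t ∈ I) : t • P.xi ∈ I := by
  have := lie_mem_of_mem_left h (P.inclY 1)
  rwa [lie_inclX_inclY, mul_one] at this

lemma inclNeg_quad₁_mem {t : k} (h : P.inclX t ∈ I) : P.inclNeg (P.quad₁ t) ∈ I := by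
  simpa [quad₁_apply, Prod.smul_def] using inclNeg_smul_mem h (P.quad₁ 1)

lemma inclNeg_quad₄_mem {t : k} (h : P.inclX t ∈ I) : P.inclNeg (P.quad₄ t) ∈ I := by
  simpa [quad₄_apply, Prod.smul_def] using inclNeg_smul_mem h (P.quad₄ 1)

lemma smul_zeta_mem {t : k} (h : P.inclX t ∈ I) : t • P.zeta ∈ I := by
  have := lie_mem_of_mem_left (inclNeg_quad₁_mem h) (P.inclPos (P.quad₄ 1))
  rwa [lie_quad₁_quad₄, mul_one] at this

/-- Three brackets of total degree -4 carry `L₂` to `L₋₂` and kill every other component. The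
quadruples `(1, 0, 0, 0)` and `(0, 0, 0, 1)` are chosen because `ω` pairs them to 1. -/
lemma inclX_y_mem {l : P.L} (h : l ∈ I) : P.inclX l.y ∈ I := by
  have h1 := lie_mem_of_mem_right (P.inclNeg (P.quad₄ 1)) (lie_mem_of_mem_right (P.inclX 1)
    (lie_mem_of_mem_right (P.inclNeg (P.quad₁ 1)) h))
  rw [lie_inclX_inclNeg, lie_add, lie_inclNeg_inclNeg, omega_smul_right, omega_quad₄_quad₁,
    mul_one] at h1
  convert h1 using 1
  -- The remaining summand is a bracket of `L₋₁` with `L₋₂`, zero by degree.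
  rw [right_eq_add]
  apply L.ext <;> simp [L.bracket_x, L.bracket_neg, L.bracket_pos, L.bracket_y]
  apply Subtype.ext; simp [L.bracket_zero]

lemma inclX_x_mem {l : P.L} (h : l ∈ I) : P.inclX l.x ∈ I := by
  have h1 := lie_mem_of_mem_right (P.inclPos (P.quad₄ 1)) (lie_mem_of_mem_right (P.inclY 1)
    (lie_mem_of_mem_right (P.inclPos (P.quad₁ 1)) h))
  rw [lie_inclY_inclPos, lie_add, lie_inclPos_inclPos, omega_smul_right, omega_quad₄_quad₁,
    mul_one] at h1
  apply inclX_mem_of_inclY_mem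
  convert h1 using 1
  rw [right_eq_add]
  apply L.ext <;> simp [L.bracket_x, L.bracket_neg, L.bracket_pos, L.bracket_y]
  apply Subtype.ext; simp [L.bracket_zero]

lemma inclX_omega_pos_mem {l : P.L} (h : l ∈ I) (q : P.Quad) : P.inclX (P.omega q l.pos) ∈ I := by
  have h1 := lie_mem_of_mem_right (P.inclX 1) (lie_mem_of_mem_right (P.inclNeg q) h)
  rwa [lie_inclX_inclNeg, add_mem_cancel_right (inclNeg_smul_mem (inclX_y_mem h) q),
    neg_mem_iff] at h1

/-- If `l ∈ I` has component `q₊` in `L₁`, then `q₋ ∈ I`. -/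
lemma inclNeg_pos_mem {l : P.L} (h : l ∈ I) : P.inclNeg l.pos ∈ I := by
  have h1 := lie_mem_of_mem_right (P.inclX 1) h
  -- In `[x, l]` the contribution of `l.zero` is a multiple of `x`, namely the `x`-coordinate of an
  -- element of `I`. It therefore lies in `I` by itself and can be removed.
  have h2 := inclX_x_mem h1
  rw [L.bracket_x] at h2
  rw [lie_inclX, add_mem_cancel_right (smul_xi_mem (inclX_y_mem h))] at h1
  simp only [inclX_zero, inclX_x, inclX_neg, omega_zero_left, ZeroMemClass.coe_zero, map_zero,
    LinearMap.zero_apply, zero_sub, add_zero, map_neg] at h2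
  have h3 := sub_mem h2 h1
  rwa [sub_sub_cancel] at h3

lemma inclPos_neg_mem {l : P.L} (h : l ∈ I) : P.inclPos l.neg ∈ I := by
  have h1 := lie_mem_of_mem_right (P.inclY 1) h
  have h2 := inclY_mem_of_inclX_mem (inclX_y_mem h1)
  rw [L.bracket_y] at h2
  rw [lie_inclY, sub_eq_add_neg, add_mem_cancel_right (neg_mem (smul_xi_mem (inclX_x_mem h)))] at h1
  simp only [inclY_zero, inclY_y, inclY_pos, omega_zero_left, ZeroMemClass.coe_zero, map_zero,
    LinearMap.zero_apply, zero_sub, add_zero, map_neg] at h2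
  rwa [add_mem_cancel_left h2] at h1

/-- Both copies of the quadruples thus see the same coefficients, so one triple can describe `L₋₁`
and `L₁`. -/
lemma inclPos_mem_iff {q : P.Quad} : P.inclPos q ∈ I ↔ P.inclNeg q ∈ I := by
  exact ⟨fun h => inclNeg_pos_mem h, fun h => inclPos_neg_mem h⟩

lemma inclX_fst_mem {q : P.Quad} (h : P.inclPos q ∈ I) : P.inclX q.1 ∈ I := by
  simpa [omega, quad₄_apply] using inclX_omega_pos_mem h (P.quad₄ 1)

lemma inclX_last_mem {q : P.Quad} (h : P.inclPos q ∈ I) : P.inclX q.2.2.2 ∈ I := by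
  simpa [omega, quad₁_apply] using inclX_omega_pos_mem h (P.quad₁ 1)

/-- Moving to `L₋₁` and bracketing with `(0, 0, 0, 1)₊` leaves the `J`-coordinate up to a multiple
of `ζ`. The factor is the first coordinate of `q`, so that multiple is already in `I`. -/
lemma inclJ_mem_of_inclPos_mem {q : P.Quad} (h : P.inclPos q ∈ I) : P.inclJ q.2.1 ∈ I := by
  have h1 := lie_mem_of_mem_left (inclPos_mem_iff.1 h) (P.inclPos (P.quad₄ 1))
  rw [lie_inclNeg_quad₄] at h1
  have h2 := sub_mem (smul_zeta_mem (inclX_fst_mem h)) h1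
  rwa [sub_sub_cancel] at h2

lemma inclJ'_mem_of_inclPos_mem {q : P.Quad} (h : P.inclPos q ∈ I) : P.inclJ' q.2.2.1 ∈ I := by
  have h1 := lie_mem_of_mem_left (inclPos_mem_iff.1 h) (P.inclPos (P.quad₁ 1))
  rw [lie_inclNeg_quad₁] at h1
  have h0 := inclX_last_mem h
  have h2 := sub_mem (neg_mem (sub_mem (smul_xi_mem h0) (smul_zeta_mem h0))) h1
  convert h2 using 1
  module

lemma inclPos_quad₂_mem {b : J} (h : P.inclJ b ∈ I) : P.inclPos (P.quad₂ b) ∈ I := by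
  simpa [lie_inclJ_inclPos, actJ_apply, quad₁_apply, quad₂_apply] using
    lie_mem_of_mem_left h (P.inclPos (P.quad₁ 1))

lemma inclPos_quad₃_mem {b' : J'} (h : P.inclJ' b' ∈ I) : P.inclPos (P.quad₃ b') ∈ I := by
  have h1 := lie_mem_of_mem_left h (P.inclPos (P.quad₄ 1))
  rw [lie_inclJ'_inclPos, actJ'_apply, map_neg, neg_mem_iff] at h1
  simpa [quad₃_apply, quad₄_apply] using h1

end IdealCoefficients

/-! ### From Lie ideals to ideals of the triple and back. -/

variable {P} in
/-- The ideal of `(k, J, J')` formed by the coefficients of a Lie ideal of `L`. -/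
def TripleIdeal.ofLieIdeal (I : LieIdeal k P.L) : P.TripleIdeal where
  l := I.toSubmodule.comap P.inclX
  U := I.toSubmodule.comap P.inclJ
  U' := I.toSubmodule.comap P.inclJ'
  smul_mem r hr b := by
    have h := lie_mem_of_mem_left (inclNeg_quad₄_mem (I := I) hr) (P.inclPos (P.quad₂ b))
    rwa [lie_quad₄_quad₂, neg_mem_iff] at h
  smul_mem' r hr b' := by
    have h := lie_mem_of_mem_left (inclNeg_quad₁_mem (I := I) hr) (P.inclPos (P.quad₃ b'))
    rwa [lie_quad₁_quad₃, neg_mem_iff] at h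
  T_mem u hu b' := by
    have h := lie_mem_of_mem_left (I := I) hu (P.inclPos (P.quad₃ b'))
    rw [lie_inclJ_inclPos] at h
    exact inclX_last_mem h
  T_mem' u' hu' b := by
    have h := lie_mem_of_mem_left (I := I) hu' (P.inclPos (P.quad₂ b))
    rw [lie_inclJ'_inclPos, actJ'_apply, map_neg, neg_mem_iff] at h
    exact inclX_fst_mem h
  cross_mem u hu b := by
    have h := lie_mem_of_mem_left (I := I) hu (P.inclPos (P.quad₂ b))
    rw [lie_inclJ_inclPos] at h
    exact inclJ'_mem_of_inclPos_mem h
  cross'_mem u' hu' b' := by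
    have h := lie_mem_of_mem_left (I := I) hu' (P.inclPos (P.quad₃ b'))
    rw [lie_inclJ'_inclPos, actJ'_apply, map_neg, neg_mem_iff] at h
    exact inclJ_mem_of_inclPos_mem h

namespace TripleIdeal

variable {P} (A : P.TripleIdeal)

/-- The submodule `(ℓ, U, U', ℓ)` of the quadruples. -/
def quad : Submodule k P.Quad := Submodule.prod A.l (A.U.prod (A.U'.prod A.l))

lemma mem_quad {q : P.Quad} :
    q ∈ A.quad ↔ q.1 ∈ A.l ∧ q.2.1 ∈ A.U ∧ q.2.2.1 ∈ A.U' ∧ q.2.2.2 ∈ A.l := Iff.rfl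

lemma smul_mem_quad {r : k} (hr : r ∈ A.l) (q : P.Quad) : r • q ∈ A.quad :=
  ⟨A.l.mul_mem_right _ hr, A.smul_mem r hr _, A.smul_mem' r hr _, A.l.mul_mem_right _ hr⟩

lemma omega_mem {p : P.Quad} (hp : p ∈ A.quad) (q : P.Quad) : P.omega p q ∈ A.l :=
  sub_mem (add_mem (sub_mem (A.T_mem _ hp.2.1 _) (A.T_mem' _ hp.2.2.1 _))
    (A.l.mul_mem_right _ hp.2.2.2)) (A.l.mul_mem_right _ hp.1)

lemma omega_mem' {q : P.Quad} (hq : q ∈ A.quad) (p : P.Quad) : P.omega p q ∈ A.l := by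
  rw [omega_skew]; exact neg_mem (A.omega_mem hq p)

lemma actJ_mem (a : J) {q : P.Quad} (hq : q ∈ A.quad) : P.actJ a q ∈ A.quad :=
  ⟨zero_mem _, A.smul_mem _ hq.1 _, by
      rw [actJ_apply, P.cross_comm]; exact A.cross_mem _ hq.2.1 _,
    A.T_mem' _ hq.2.2.1 _⟩

lemma actJ'_mem (a' : J') {q : P.Quad} (hq : q ∈ A.quad) : P.actJ' a' q ∈ A.quad :=
  neg_mem (S := Submodule k P.Quad) (x := (P.T q.2.1 a', P.cross' a' q.2.2.1, q.2.2.2 • a', 0))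
    ⟨A.T_mem _ hq.2.1 _, P.cross'_comm a' _ ▸ A.cross'_mem _ hq.2.2.1 _,
      A.smul_mem' _ hq.2.2.2 _, zero_mem _⟩

/-- On the generators of `L₀` this is a reading of the axioms for an ideal of the triple. The case
of `𝐝_{a,a'}` follows from those of `a` and `a'`, being their commutator. -/
lemma onPos_mem {f : P.M} (hf : f ∈ P.L0) {q : P.Quad} (hq : q ∈ A.quad) :
    M.onPos f q ∈ A.quad := by
  rw [L0_eq_span] at hf
  induction hf using Submodule.span_induction with
  | mem f hf =>
    simp only [genSet, Set.mem_union, Set.mem_range, Set.mem_singleton_iff, Prod.exists] at hf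
    obtain ((((⟨a', rfl⟩ | ⟨a, a', rfl⟩) | rfl) | rfl) | ⟨a, rfl⟩) := hf
    · exact A.actJ'_mem a' hq
    · rw [dM_eq, M.onPos_mk]
      exact sub_mem (A.actJ'_mem a' (A.actJ_mem a hq)) (A.actJ_mem a (A.actJ'_mem a' hq))
    · exact ⟨neg_mem hq.1, zero_mem _, hq.2.2.1, A.l.mul_mem_left _ hq.2.2.2⟩
    · exact hq
    · exact A.actJ_mem a hq
  | zero => rw [map_zero]; exact zero_mem _
  | add f g _ _ hf hg => rw [map_add]; exact add_mem hf hg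
  | smul r f _ hf => rw [map_smul]; exact A.quad.smul_mem r hf

/-- By `onPos_negPos_sub`, `q` and `r` may be exchanged at the cost of `ω(q, r) p`. After the
exchange an element of `L₀` acts on `q ∈ A.quad`, and the correction has its factor in `ℓ`. -/
lemma onPos_negPos_mem_right {q : P.Quad} (hq : q ∈ A.quad) (p r : P.Quad) :
    M.onPos (P.negPos p q) r ∈ A.quad := by
  rw [← sub_add_cancel (M.onPos (P.negPos p q) r) (M.onPos (P.negPos p r) q), onPos_negPos_sub]
  exact add_mem (neg_mem (A.smul_mem_quad (A.omega_mem hq r) p))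
    (A.onPos_mem (P.negPos_mem p r) hq)

/-- Swapping `p` and `q` changes `negPos` only by an `ω`-multiple of `ξ`, with factor in `ℓ`. -/
lemma onPos_negPos_mem_left {p : P.Quad} (hp : p ∈ A.quad) (q r : P.Quad) :
    M.onPos (P.negPos p q) r ∈ A.quad := by
  rw [P.negPos_skew q p, map_add, map_smul, LinearMap.add_apply, LinearMap.smul_apply]
  exact add_mem (A.onPos_negPos_mem_right hp q r) (A.smul_mem_quad (A.omega_mem' hp q) _)

/-- The largest Lie ideal of `L` whose coefficients lie in the ideal `A` of `(k, J, J')`. -/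
def lieIdeal : LieIdeal k P.L where
  -- Only the actions on `x` and on `L₁` are restricted: by `isDer_of_mem` they determine the
  -- actions on `L₋₁` and `y`.
  carrier := {l | l.x ∈ A.l ∧ l.neg ∈ A.quad ∧ l.pos ∈ A.quad ∧ l.y ∈ A.l ∧
    M.onX (l.zero : P.M) 1 ∈ A.l ∧ ∀ q, M.onPos (l.zero : P.M) q ∈ A.quad}
  zero_mem' := by
    simp only [Set.mem_ofPred_eq, L.zero_x, L.zero_neg, L.zero_zero, L.zero_pos, L.zero_y,
      ZeroMemClass.coe_zero, map_zero, LinearMap.zero_apply, zero_mem, implies_true, and_self]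
  add_mem' := by
    rintro l m ⟨h1, h2, h3, h4, h5, h6⟩ ⟨g1, g2, g3, g4, g5, g6⟩
    refine ⟨add_mem h1 g1, add_mem h2 g2, add_mem h3 g3, add_mem h4 g4, ?_, fun q => ?_⟩
    · simpa using add_mem h5 g5
    · simpa using add_mem (h6 q) (g6 q)
  smul_mem' := by
    rintro r l ⟨h1, h2, h3, h4, h5, h6⟩
    refine ⟨A.l.smul_mem r h1, A.quad.smul_mem r h2, A.quad.smul_mem r h3, A.l.smul_mem r h4, ?_,
      fun q => ?_⟩
    · simpa using A.l.smul_mem r h5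
    · simpa using A.quad.smul_mem r (h6 q)
  lie_mem := by
    rintro m l ⟨h1, h2, h3, h4, h5, h6⟩
    have hX (f : P.M) {t : k} (ht : t ∈ A.l) : M.onX f t ∈ A.l := by
      rw [end_apply]; exact A.l.mul_mem_right _ ht
    have hY (f : P.M) {t : k} (ht : t ∈ A.l) : M.onY f t ∈ A.l := by
      rw [end_apply]; exact A.l.mul_mem_right _ ht
    have hN {f : P.M} (hf : f ∈ P.L0) {q : P.Quad} (hq : q ∈ A.quad) :
        M.onNeg f q ∈ A.quad := by
      rw [(P.isDer_of_mem hf).neg_eq]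
      exact add_mem (A.quad.smul_mem _ hq) (A.onPos_mem hf hq)
    refine ⟨?_, ?_, ?_, ?_, ?_, fun q => ?_⟩
    · rw [L.bracket_x, end_apply (M.onX (l.zero : P.M))]
      exact add_mem (sub_mem (hX _ h1) (A.l.mul_mem_left _ h5)) (A.omega_mem' h2 _)
    · rw [L.bracket_neg, (P.isDer_of_mem l.zero.2).neg_eq]
      exact add_mem (sub_mem (sub_mem (hN m.zero.2 h2)
        (add_mem (A.smul_mem_quad h5 _) (h6 _))) (A.quad.smul_mem _ h3)) (A.smul_mem_quad h1 _)
    · rw [L.bracket_pos]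
      exact sub_mem (add_mem (sub_mem (A.onPos_mem m.zero.2 h3) (h6 _))
        (A.quad.smul_mem _ h2)) (A.smul_mem_quad h4 _)
    · rw [L.bracket_y, end_apply (M.onY (l.zero : P.M)), (P.isDer_of_mem l.zero.2).onY_eq]
      exact add_mem (sub_mem (hY _ h4) (A.l.mul_mem_left _ (neg_mem h5))) (A.omega_mem' h3 _)
    · rw [L.bracket_zero]
      simp only [map_add, map_sub, map_mul, map_smul, LinearMap.add_apply, LinearMap.sub_apply,
        LinearMap.smul_apply, Module.End.mul_apply, onX_negPos, mul_one]
      refine sub_mem (add_mem (add_mem (sub_mem (hX _ h5) ?_) ?_) (A.omega_mem' h3 _))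
        (A.omega_mem h2 _)
      · rw [end_apply]; exact A.l.mul_mem_left _ h5
      · exact A.l.mul_mem_right _ (sub_mem (A.l.mul_mem_left _ h4) (A.l.mul_mem_right _ h1))
    · rw [L.bracket_zero]
      simp only [map_add, map_sub, map_mul, map_smul, LinearMap.add_apply, LinearMap.sub_apply,
        LinearMap.smul_apply, Module.End.mul_apply]
      -- The four sources of an `L₀`-component: the commutator in `L₀`, the multiple of `ξ` from
      -- `[x, y]`, and the two brackets of `L₋₁` with `L₁`.
      exact sub_mem (add_mem (add_mem (sub_mem (A.onPos_mem m.zero.2 (h6 _)) (h6 _))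
        (A.smul_mem_quad (sub_mem (A.l.mul_mem_left _ h4) (A.l.mul_mem_right _ h1)) _))
        (A.onPos_negPos_mem_right h3 _ _)) (A.onPos_negPos_mem_left h2 _ _)

lemma mem_lieIdeal {l : P.L} : l ∈ A.lieIdeal ↔ l.x ∈ A.l ∧ l.neg ∈ A.quad ∧ l.pos ∈ A.quad ∧
    l.y ∈ A.l ∧ M.onX (l.zero : P.M) 1 ∈ A.l ∧ ∀ q, M.onPos (l.zero : P.M) q ∈ A.quad := Iff.rfl

lemma mem_quad_ofLieIdeal {I : LieIdeal k P.L} {q : P.Quad} (h : P.inclPos q ∈ I) :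
    q ∈ (ofLieIdeal I).quad :=
  ⟨inclX_fst_mem h, inclJ_mem_of_inclPos_mem h, inclJ'_mem_of_inclPos_mem h, inclX_last_mem h⟩

lemma pos_mem_quad_ofLieIdeal {I : LieIdeal k P.L} {l : P.L} (h : l ∈ I) :
    l.pos ∈ (ofLieIdeal I).quad :=
  mem_quad_ofLieIdeal (inclPos_mem_iff.2 (inclNeg_pos_mem h))

/-- The action of `l.zero` on `x` and on `q₊` can be read off as a coordinate of `[l, x]` and `[l,
q₊]`. These brackets lie in `I`, and coordinates of elements of `I` have been shown to lie in the
triple ideal. -/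
lemma le_lieIdeal_ofLieIdeal (I : LieIdeal k P.L) : I ≤ (ofLieIdeal I).lieIdeal := by
  intro l h
  refine ⟨inclX_x_mem h, mem_quad_ofLieIdeal (inclPos_neg_mem h), pos_mem_quad_ofLieIdeal h,
    inclX_y_mem h, ?_, fun q => ?_⟩
  · change P.inclX _ ∈ I
    simpa [L.bracket_x] using inclX_x_mem (lie_mem_of_mem_left h (P.inclX 1))
  · have := pos_mem_quad_ofLieIdeal (lie_mem_of_mem_left h (P.inclPos q))
    simpa [L.bracket_pos] using this

end TripleIdeal

/-! ### The projections onto the root spaces and the directness of their sum. -/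

section Projections

/-- The coefficient of `x`. -/
def coeffX : P.L →ₗ[k] k := ⟨⟨L.x, fun _ _ => rfl⟩, fun _ _ => rfl⟩

/-- The component in `L₋₁`. -/
def coeffNeg : P.L →ₗ[k] P.Quad := ⟨⟨L.neg, fun _ _ => rfl⟩, fun _ _ => rfl⟩

/-- The component in `L₀`. -/
def coeffZero : P.L →ₗ[k] P.L0 := ⟨⟨L.zero, fun _ _ => rfl⟩, fun _ _ => rfl⟩

/-- The component in `L₁`. -/
def coeffPos : P.L →ₗ[k] P.Quad := ⟨⟨L.pos, fun _ _ => rfl⟩, fun _ _ => rfl⟩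

/-- The coefficient of `y`. -/
def coeffY : P.L →ₗ[k] k := ⟨⟨L.y, fun _ _ => rfl⟩, fun _ _ => rfl⟩

/-- The component in `J ≤ L₀`, read off from the action on `(1, 0, 0, 0)₊`. -/
def coeffJ : P.L →ₗ[k] J where
  toFun l := (M.onPos (l.zero : P.M) (P.quad₁ 1)).2.1
  map_add' l m := by simp
  map_smul' r l := by simp

/-- The component in `J' ≤ L₀`, read off from the action on `(0, 0, 0, 1)₊`. -/
def coeffJ' : P.L →ₗ[k] J' where
  toFun l := -(M.onPos (l.zero : P.M) (P.quad₄ 1)).2.2.1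
  map_add' l m := by simp [add_comm]
  map_smul' r l := by simp

@[simp] lemma inclJ_x (a : J) : (P.inclJ a).x = 0 := rfl
@[simp] lemma inclJ_neg (a : J) : (P.inclJ a).neg = 0 := rfl
@[simp] lemma inclJ_pos (a : J) : (P.inclJ a).pos = 0 := rfl
@[simp] lemma inclJ_y (a : J) : (P.inclJ a).y = 0 := rfl
@[simp] lemma inclJ'_x (a' : J') : (P.inclJ' a').x = 0 := rfl
@[simp] lemma inclJ'_neg (a' : J') : (P.inclJ' a').neg = 0 := rfl
@[simp] lemma inclJ'_pos (a' : J') : (P.inclJ' a').pos = 0 := rfl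
@[simp] lemma inclJ'_y (a' : J') : (P.inclJ' a').y = 0 := rfl

@[simp] lemma quad₁_fst (t : k) : (P.quad₁ t).1 = t := rfl
@[simp] lemma quad₁_snd (t : k) : (P.quad₁ t).2 = 0 := rfl
@[simp] lemma quad₂_fst (b : J) : (P.quad₂ b).1 = 0 := rfl
@[simp] lemma quad₂_snd_fst (b : J) : (P.quad₂ b).2.1 = b := rfl
@[simp] lemma quad₂_snd_snd (b : J) : (P.quad₂ b).2.2 = 0 := rfl
@[simp] lemma quad₃_fst (b' : J') : (P.quad₃ b').1 = 0 := rfl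
@[simp] lemma quad₃_snd_fst (b' : J') : (P.quad₃ b').2.1 = 0 := rfl
@[simp] lemma quad₃_snd_snd (b' : J') : (P.quad₃ b').2.2 = (b', 0) := rfl
@[simp] lemma quad₄_fst (t : k) : (P.quad₄ t).1 = 0 := rfl
@[simp] lemma quad₄_snd_fst (t : k) : (P.quad₄ t).2.1 = 0 := rfl
@[simp] lemma quad₄_snd_snd (t : k) : (P.quad₄ t).2.2 = (0, t) := rfl

lemma coeffX_apply (l : P.L) : P.coeffX l = l.x := rfl
lemma coeffNeg_apply (l : P.L) : P.coeffNeg l = l.neg := rfl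
lemma coeffPos_apply (l : P.L) : P.coeffPos l = l.pos := rfl
lemma coeffY_apply (l : P.L) : P.coeffY l = l.y := rfl
lemma coeffJ_apply (l : P.L) : P.coeffJ l = (M.onPos (l.zero : P.M) (P.quad₁ 1)).2.1 := rfl
lemma coeffJ'_apply (l : P.L) : P.coeffJ' l = -(M.onPos (l.zero : P.M) (P.quad₄ 1)).2.2.1 := rfl

@[simp] lemma coeffJ_inclJ (a : J) : P.coeffJ (P.inclJ a) = a := by
  simp [coeffJ_apply, coe_inclJ_zero, onPos_adJ, actJ_apply, quad₁_apply]

@[simp] lemma coeffJ_inclJ' (a' : J') : P.coeffJ (P.inclJ' a') = 0 := by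
  simp [coeffJ_apply, coe_inclJ'_zero, onPos_adJ', actJ'_apply, quad₁_apply]

@[simp] lemma coeffJ'_inclJ (a : J) : P.coeffJ' (P.inclJ a) = 0 := by
  simp [coeffJ'_apply, coe_inclJ_zero, onPos_adJ, actJ_apply, quad₄_apply]

@[simp] lemma coeffJ'_inclJ' (a' : J') : P.coeffJ' (P.inclJ' a') = a' := by
  simp [coeffJ'_apply, coe_inclJ'_zero, onPos_adJ', actJ'_apply, quad₄_apply]

lemma coeffJ_eq_zero {l : P.L} (h : l.zero = 0) : P.coeffJ l = 0 := by simp [coeffJ_apply, h]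

lemma coeffJ'_eq_zero {l : P.L} (h : l.zero = 0) : P.coeffJ' l = 0 := by simp [coeffJ'_apply, h]

@[simp] lemma coeffJ_inclX (t : k) : P.coeffJ (P.inclX t) = 0 := P.coeffJ_eq_zero rfl
@[simp] lemma coeffJ_inclNeg (q : P.Quad) : P.coeffJ (P.inclNeg q) = 0 := P.coeffJ_eq_zero rfl
@[simp] lemma coeffJ_inclPos (q : P.Quad) : P.coeffJ (P.inclPos q) = 0 := P.coeffJ_eq_zero rfl
@[simp] lemma coeffJ_inclY (t : k) : P.coeffJ (P.inclY t) = 0 := P.coeffJ_eq_zero rfl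
@[simp] lemma coeffJ'_inclX (t : k) : P.coeffJ' (P.inclX t) = 0 := P.coeffJ'_eq_zero rfl
@[simp] lemma coeffJ'_inclNeg (q : P.Quad) : P.coeffJ' (P.inclNeg q) = 0 := P.coeffJ'_eq_zero rfl
@[simp] lemma coeffJ'_inclPos (q : P.Quad) : P.coeffJ' (P.inclPos q) = 0 := P.coeffJ'_eq_zero rfl
@[simp] lemma coeffJ'_inclY (t : k) : P.coeffJ' (P.inclY t) = 0 := P.coeffJ'_eq_zero rfl

lemma L00_le {N : Submodule k P.L} (hd : ∀ a a', P.d a a' ∈ N) (hzeta : P.zeta ∈ N)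
    (hxi : P.xi ∈ N) : P.L00 ≤ N := by
  refine sup_le (sup_le (Submodule.span_le.2 ?_) ?_) ?_
  · rintro _ ⟨p, rfl⟩; exact hd _ _
  · simpa [Submodule.span_le] using hzeta
  · simpa [Submodule.span_le] using hxi

lemma d_mem_L00 (a : J) (a' : J') : P.d a a' ∈ P.L00 :=
  Submodule.mem_sup_left (Submodule.mem_sup_left (Submodule.subset_span ⟨(a, a'), rfl⟩))

lemma zeta_mem_L00 : P.zeta ∈ P.L00 :=
  Submodule.mem_sup_left (Submodule.mem_sup_right (Submodule.mem_span_singleton_self _))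

lemma xi_mem_L00 : P.xi ∈ P.L00 :=
  Submodule.mem_sup_right (Submodule.mem_span_singleton_self _)

/-- Elements of `L_{0,0}` act diagonally on quadruples, so they send `(1, 0, 0, 0)₊` to a vector
without `J`-coordinate. This separates `J` from `L_{0,0}` inside `L₀`. -/
lemma L00_le_ker_coeffJ : P.L00 ≤ LinearMap.ker P.coeffJ := by
  refine P.L00_le (fun a a' => ?_) ?_ ?_ <;>
    simp [coeffJ_apply, coe_d_zero, coe_zeta_zero, coe_xi_zero, dM_eq, zetaM, xiM, actD_apply,
      zetaPos_apply, quad₁_apply]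

lemma L00_le_ker_coeffJ' : P.L00 ≤ LinearMap.ker P.coeffJ' := by
  refine P.L00_le (fun a a' => ?_) ?_ ?_ <;>
    simp [coeffJ'_apply, coe_d_zero, coe_zeta_zero, coe_xi_zero, dM_eq, zetaM, xiM, actD_apply,
      zetaPos_apply, quad₄_apply]

lemma L00_le_range_inclZero : P.L00 ≤ LinearMap.range P.inclZero :=
  P.L00_le (fun _ _ => ⟨_, rfl⟩) ⟨_, rfl⟩ ⟨_, rfl⟩

lemma inclZero_mem_sup (f : P.L0) :
    P.inclZero f ∈ LinearMap.range P.inclJ' ⊔ P.L00 ⊔ LinearMap.range P.inclJ := by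
  obtain ⟨f, hf⟩ := f
  have hf' := hf
  rw [L0_eq_span] at hf'
  -- Membership in `L₀` becomes part of the claim, since the induction runs over elements of `M`.
  suffices H : ∃ h : f ∈ P.L0,
      P.inclZero ⟨f, h⟩ ∈ LinearMap.range P.inclJ' ⊔ P.L00 ⊔ LinearMap.range P.inclJ from H.2
  clear hf
  have h00 : P.L00 ≤ LinearMap.range P.inclJ' ⊔ P.L00 ⊔ LinearMap.range P.inclJ :=
    le_sup_right.trans le_sup_left
  induction hf' using Submodule.span_induction with
  | mem f hf =>
    simp only [genSet, Set.mem_union, Set.mem_range, Set.mem_singleton_iff, Prod.exists] at hf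
    obtain ((((⟨a', rfl⟩ | ⟨a, a', rfl⟩) | rfl) | rfl) | ⟨a, rfl⟩) := hf
    · exact ⟨P.adJ'_mem a', Submodule.mem_sup_left (Submodule.mem_sup_left ⟨a', rfl⟩)⟩
    · exact ⟨P.dM_mem a a', h00 (P.d_mem_L00 a a')⟩
    · exact ⟨P.zetaM_mem, h00 P.zeta_mem_L00⟩
    · exact ⟨P.xiM_mem, h00 P.xi_mem_L00⟩
    · exact ⟨P.adJ_mem a, Submodule.mem_sup_right ⟨a, rfl⟩⟩
  | zero => exact ⟨zero_mem _, zero_mem _⟩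
  | add f g _ _ hf hg =>
    obtain ⟨h, hf⟩ := hf
    obtain ⟨h', hg⟩ := hg
    exact ⟨add_mem h h', by
      rw [← AddMemClass.mk_add_mk P.L0 f g h h', map_add]; exact add_mem hf hg⟩
  | smul r f _ hf =>
    obtain ⟨h, hf⟩ := hf
    exact ⟨P.L0.smul_mem r h, by
      rw [← SetLike.mk_smul_mk P.L0 r f h, map_smul]; exact Submodule.smul_mem _ r hf⟩

/-- The projection of `L` onto `L_{0,0}`. -/
def projZero : P.L →ₗ[k] P.L :=
  P.inclZero ∘ₗ P.coeffZero - P.inclJ ∘ₗ P.coeffJ - P.inclJ' ∘ₗ P.coeffJ'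

lemma projZero_apply (l : P.L) :
    P.projZero l = P.inclZero l.zero - P.inclJ (P.coeffJ l) - P.inclJ' (P.coeffJ' l) := rfl

lemma projZero_eq_zero {l : P.L} (h : l.zero = 0) : P.projZero l = 0 := by
  simp [projZero_apply, h, P.coeffJ_eq_zero h, P.coeffJ'_eq_zero h]

@[simp] lemma projZero_inclX (t : k) : P.projZero (P.inclX t) = 0 := P.projZero_eq_zero rfl
@[simp] lemma projZero_inclNeg (q : P.Quad) : P.projZero (P.inclNeg q) = 0 := P.projZero_eq_zero rfl
@[simp] lemma projZero_inclPos (q : P.Quad) : P.projZero (P.inclPos q) = 0 := P.projZero_eq_zero rfl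
@[simp] lemma projZero_inclY (t : k) : P.projZero (P.inclY t) = 0 := P.projZero_eq_zero rfl

lemma projZero_of_mem {l : P.L} (h : l ∈ P.L00) : P.projZero l = l := by
  have h1 : P.coeffJ l = 0 := P.L00_le_ker_coeffJ h
  have h2 : P.coeffJ' l = 0 := P.L00_le_ker_coeffJ' h
  rw [projZero_apply, h1, h2, map_zero, map_zero, sub_zero, sub_zero]
  obtain ⟨f, rfl⟩ := P.L00_le_range_inclZero h
  rfl

@[simp] lemma projZero_inclJ (a : J) : P.projZero (P.inclJ a) = 0 := by
  simp only [projZero_apply, coeffJ_inclJ, coeffJ'_inclJ, map_zero, sub_zero]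
  exact sub_self _

@[simp] lemma projZero_inclJ' (a' : J') : P.projZero (P.inclJ' a') = 0 := by
  simp only [projZero_apply, coeffJ_inclJ', coeffJ'_inclJ', map_zero, sub_zero]
  exact sub_self _

/-- Writing `l.zero` as a sum from `J'`, `L_{0,0}` and `J`, the projection kills the outer summands
and fixes the middle one. -/
lemma projZero_mem (l : P.L) : P.projZero l ∈ P.L00 := by
  have h : P.projZero l = P.projZero (P.inclZero l.zero) := rfl
  rw [h]
  obtain ⟨_, h', _, ⟨a, rfl⟩, h⟩ := Submodule.mem_sup.1 (P.inclZero_mem_sup l.zero)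
  obtain ⟨_, ⟨a', rfl⟩, z, hz, rfl⟩ := Submodule.mem_sup.1 h'
  rw [← h, map_add, map_add, projZero_inclJ, projZero_inclJ', P.projZero_of_mem hz]
  simpa using hz

/-- The projections of `L` onto the root spaces and onto `L_{0,0}`. -/
def rootProj : ℤ × ℤ → P.L →ₗ[k] P.L
  | (-2, -1) => P.inclX ∘ₗ P.coeffX
  | (-1, -2) => P.inclNeg ∘ₗ P.quad₁ ∘ₗ LinearMap.fst _ _ _ ∘ₗ P.coeffNeg
  | (-1, -1) => P.inclNeg ∘ₗ P.quad₂ ∘ₗ LinearMap.fst _ _ _ ∘ₗ LinearMap.snd _ _ _ ∘ₗ P.coeffNeg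
  | (-1, 0) => P.inclNeg ∘ₗ P.quad₃ ∘ₗ LinearMap.fst _ _ _ ∘ₗ LinearMap.snd _ _ _ ∘ₗ
      LinearMap.snd _ _ _ ∘ₗ P.coeffNeg
  | (-1, 1) => P.inclNeg ∘ₗ P.quad₄ ∘ₗ LinearMap.snd _ _ _ ∘ₗ LinearMap.snd _ _ _ ∘ₗ
      LinearMap.snd _ _ _ ∘ₗ P.coeffNeg
  | (0, -1) => P.inclJ' ∘ₗ P.coeffJ'
  | (0, 0) => P.projZero
  | (0, 1) => P.inclJ ∘ₗ P.coeffJ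
  | (1, -1) => P.inclPos ∘ₗ P.quad₁ ∘ₗ LinearMap.fst _ _ _ ∘ₗ P.coeffPos
  | (1, 0) => P.inclPos ∘ₗ P.quad₂ ∘ₗ LinearMap.fst _ _ _ ∘ₗ LinearMap.snd _ _ _ ∘ₗ P.coeffPos
  | (1, 1) => P.inclPos ∘ₗ P.quad₃ ∘ₗ LinearMap.fst _ _ _ ∘ₗ LinearMap.snd _ _ _ ∘ₗ
      LinearMap.snd _ _ _ ∘ₗ P.coeffPos
  | (1, 2) => P.inclPos ∘ₗ P.quad₄ ∘ₗ LinearMap.snd _ _ _ ∘ₗ LinearMap.snd _ _ _ ∘ₗ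
      LinearMap.snd _ _ _ ∘ₗ P.coeffPos
  | (2, 1) => P.inclY ∘ₗ P.coeffY
  | _ => 0

lemma rootProj_sum (l : P.L) :
    P.rootProj (-2, -1) l + (P.rootProj (-1, -2) l + P.rootProj (-1, -1) l +
      P.rootProj (-1, 0) l + P.rootProj (-1, 1) l) +
      (P.rootProj (0, -1) l + P.rootProj (0, 0) l + P.rootProj (0, 1) l) +
      (P.rootProj (1, -1) l + P.rootProj (1, 0) l + P.rootProj (1, 1) l + P.rootProj (1, 2) l) +
      P.rootProj (2, 1) l = l := by
  change P.inclX l.x + (P.inclNeg (P.quad₁ l.neg.1) + P.inclNeg (P.quad₂ l.neg.2.1) +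
      P.inclNeg (P.quad₃ l.neg.2.2.1) + P.inclNeg (P.quad₄ l.neg.2.2.2)) +
      (P.inclJ' (P.coeffJ' l) + P.projZero l + P.inclJ (P.coeffJ l)) +
      (P.inclPos (P.quad₁ l.pos.1) + P.inclPos (P.quad₂ l.pos.2.1) +
      P.inclPos (P.quad₃ l.pos.2.2.1) + P.inclPos (P.quad₄ l.pos.2.2.2)) + P.inclY l.y = l
  simp only [← map_add, quad_sum, projZero_apply]
  conv_rhs => rw [← P.incl_sum l]
  abel

variable {P} in
-- Allowing arbitrary `l`, `U`, `U'`, `W` lets the same case split serve for the root spaces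
-- themselves and for the coefficients of an ideal.
lemma rootProj_mem_rootPart {l : Ideal k} {U : Submodule k J} {U' : Submodule k J'}
    {W : Submodule k P.L} {m : P.L} (hx : m.x ∈ l)
    (hn : m.neg.1 ∈ l ∧ m.neg.2.1 ∈ U ∧ m.neg.2.2.1 ∈ U' ∧ m.neg.2.2.2 ∈ l)
    (hJ : P.coeffJ m ∈ U) (hJ' : P.coeffJ' m ∈ U') (hW : P.projZero m ∈ W)
    (hp : m.pos.1 ∈ l ∧ m.pos.2.1 ∈ U ∧ m.pos.2.2.1 ∈ U' ∧ m.pos.2.2.2 ∈ l) (hy : m.y ∈ l)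
    (α : ℤ × ℤ) : P.rootProj α m ∈ P.rootPart l U U' W α := by
  unfold rootPart
  split
  · exact ⟨_, hx, rfl⟩
  · exact ⟨_, hn.1, rfl⟩
  · exact ⟨_, hn.2.1, rfl⟩
  · exact ⟨_, hn.2.2.1, rfl⟩
  · exact ⟨_, hn.2.2.2, rfl⟩
  · exact ⟨_, hJ', rfl⟩
  · exact hW
  · exact ⟨_, hJ, rfl⟩
  · exact ⟨_, hp.1, rfl⟩
  · exact ⟨_, hp.2.1, rfl⟩
  · exact ⟨_, hp.2.2.1, rfl⟩
  · exact ⟨_, hp.2.2.2, rfl⟩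
  · exact ⟨_, hy, rfl⟩
  -- Outside the thirteen listed degrees both the projection and the target are zero; the listed
  -- degrees contradict the hypotheses of this branch.
  · unfold rootProj
    split <;> first | exact zero_mem (⊥ : Submodule k P.L) | simp_all

lemma rootProj_mem_rootSpace (α : ℤ × ℤ) (l : P.L) : P.rootProj α l ∈ P.rootSpace α :=
  rootProj_mem_rootPart (l := ⊤) (U := ⊤) (U' := ⊤) trivial ⟨trivial, trivial, trivial, trivial⟩
    trivial trivial (P.projZero_mem l) ⟨trivial, trivial, trivial, trivial⟩ trivial α

lemma rootPart_mono {l₁ l₂ : Ideal k} {U₁ U₂ : Submodule k J} {U₁' U₂' : Submodule k J'}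
    {W₁ W₂ : Submodule k P.L} (hl : l₁ ≤ l₂) (hU : U₁ ≤ U₂) (hU' : U₁' ≤ U₂') (hW : W₁ ≤ W₂)
    (α : ℤ × ℤ) : P.rootPart l₁ U₁ U₁' W₁ α ≤ P.rootPart l₂ U₂ U₂' W₂ α := by
  unfold rootPart
  split
  case h_7 => exact hW
  case h_14 => exact le_rfl
  all_goals first | exact Submodule.map_mono hl | exact Submodule.map_mono hU |
    exact Submodule.map_mono hU'

lemma rootPart_of_ne_zero (l : Ideal k) (U : Submodule k J) (U' : Submodule k J')
    (W₁ W₂ : Submodule k P.L) {α : ℤ × ℤ} (h : α ≠ (0, 0)) :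
    P.rootPart l U U' W₁ α = P.rootPart l U U' W₂ α := by
  unfold rootPart
  split
  case h_7 => exact absurd rfl h
  all_goals rfl

lemma rootProj_of_mem {α : ℤ × ℤ} {m : P.L} (h : m ∈ P.rootSpace α) : P.rootProj α m = m := by
  unfold rootSpace rootPart at h
  unfold rootProj
  split at h
  case h_7 => exact P.projZero_of_mem h
  case h_14 => rw [(Submodule.mem_bot k).1 h, map_zero]
  all_goals
    obtain ⟨t, -, rfl⟩ := h
    simp [coeffX_apply, coeffNeg_apply, coeffPos_apply, coeffY_apply]

/-- With `rootProj_of_mem` this says that the projections are orthogonal idempotents, which is all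
that independence of the root spaces requires. -/
lemma rootProj_of_mem_of_ne {α β : ℤ × ℤ} (hne : β ≠ α) {m : P.L} (h : m ∈ P.rootSpace α) :
    P.rootProj β m = 0 := by
  unfold rootSpace rootPart at h
  split at h
  case h_7 =>
    have h1 : P.coeffJ m = 0 := P.L00_le_ker_coeffJ h
    have h2 : P.coeffJ' m = 0 := P.L00_le_ker_coeffJ' h
    obtain ⟨f, rfl⟩ := P.L00_le_range_inclZero h
    unfold rootProj
    split <;> first
      | exact absurd rfl hne
      | simp [coeffX_apply, coeffNeg_apply, coeffPos_apply, coeffY_apply, h1, h2]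
  case h_14 => rw [(Submodule.mem_bot k).1 h, map_zero]
  all_goals
    obtain ⟨t, -, rfl⟩ := h
    unfold rootProj
    split <;> first
      | exact absurd rfl hne
      | simp [coeffX_apply, coeffNeg_apply, coeffPos_apply, coeffY_apply]

variable {P}

lemma iSupIndep_of_le_rootSpace {N : ℤ × ℤ → Submodule k P.L} (hN : ∀ α, N α ≤ P.rootSpace α) :
    iSupIndep N := by
  intro α
  rw [Submodule.disjoint_def]
  intro m hm hm'
  rw [← P.rootProj_of_mem (hN α hm)]
  have h : ⨆ β, ⨆ (_ : β ≠ α), N β ≤ LinearMap.ker (P.rootProj α) :=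
    iSup₂_le fun β hβ n hn => P.rootProj_of_mem_of_ne hβ.symm (hN β hn)
  exact h hm'

lemma mem_iSup_of_rootProj_mem {N : ℤ × ℤ → Submodule k P.L} {m : P.L}
    (h : ∀ α, P.rootProj α m ∈ N α) : m ∈ ⨆ α, N α := by
  have h' (α) : P.rootProj α m ∈ ⨆ α, N α := Submodule.mem_iSup_of_mem α (h α)
  rw [← P.rootProj_sum m]
  exact add_mem (add_mem (add_mem (add_mem (h' _)
    (add_mem (add_mem (add_mem (h' _) (h' _)) (h' _)) (h' _)))
    (add_mem (add_mem (h' _) (h' _)) (h' _)))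
    (add_mem (add_mem (add_mem (h' _) (h' _)) (h' _)) (h' _))) (h' _)

/-- Converse of `mem_iSup_of_rootProj_mem` for families inside the root spaces. It makes membership
in `lieMin` and `lieMax` testable degree by degree. -/
lemma rootProj_mem_of_mem_iSup {N : ℤ × ℤ → Submodule k P.L} (hN : ∀ α, N α ≤ P.rootSpace α)
    {m : P.L} (h : m ∈ ⨆ α, N α) (α : ℤ × ℤ) : P.rootProj α m ∈ N α := by
  have h' : ⨆ β, N β ≤ (N α).comap (P.rootProj α) := by
    refine iSup_le fun β n hn => ?_
    rw [Submodule.mem_comap]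
    obtain rfl | hne := eq_or_ne α β
    · rwa [P.rootProj_of_mem (hN α hn)]
    · rw [P.rootProj_of_mem_of_ne hne (hN β hn)]; exact zero_mem _
  exact h' h

end Projections

/-! ### The action of elements of `L_{0,0}` in terms of their coefficients. -/

section Representation

lemma onX_linearCombination_d (s : J × J' →₀ k) (t : k) :
    M.onX ((Finsupp.linearCombination k (fun p : J × J' => P.d p.1 p.2) s).zero : P.M) t = 0 := by
  induction s using Finsupp.induction_linear with
  | zero => simp
  | add s s' h h' => simp [h, h']
  | single p r => simp [coe_d_zero, dM_eq]

/-- Linear extension of `actD_apply`; it exhibits the three sums of `T`, `D` and `D'` that occur in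
the definition of `rad`. -/
lemma onPos_linearCombination_d (s : J × J' →₀ k) (q : P.Quad) :
    M.onPos ((Finsupp.linearCombination k (fun p : J × J' => P.d p.1 p.2) s).zero : P.M) q =
      (-(q.1 * Finsupp.linearCombination k (fun p : J × J' => P.T p.1 p.2) s),
        Finsupp.linearCombination k (fun p : J × J' => P.D p.1 p.2) s q.2.1 -
          Finsupp.linearCombination k (fun p : J × J' => P.T p.1 p.2) s • q.2.1,
        -Finsupp.linearCombination k (fun p : J × J' => P.D' p.2 p.1) s q.2.2.1 +
          Finsupp.linearCombination k (fun p : J × J' => P.T p.1 p.2) s • q.2.2.1,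
        q.2.2.2 * Finsupp.linearCombination k (fun p : J × J' => P.T p.1 p.2) s) := by
  induction s using Finsupp.induction_linear with
  | zero =>
    simp only [map_zero, L.zero_zero, ZeroMemClass.coe_zero, LinearMap.zero_apply, zero_smul,
      mul_zero, neg_zero, sub_zero, add_zero]
    rfl
  | add s s' h h' =>
    simp only [map_add, L.add_zero, Submodule.coe_add, LinearMap.add_apply, h, h']
    refine Prod.ext ?_ (Prod.ext ?_ (Prod.ext ?_ ?_)) <;>
      simp only [Prod.fst_add, Prod.snd_add]
    · ring
    · module
    · module
    · ring
  | single p r =>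
    simp only [Finsupp.linearCombination_single, L.smul_zero, Submodule.coe_smul, map_smul,
      LinearMap.smul_apply, coe_d_zero, dM_eq, M.onPos_mk, actD_apply]
    refine Prod.ext ?_ (Prod.ext ?_ (Prod.ext ?_ ?_)) <;>
      simp only [Prod.smul_fst, Prod.smul_snd, smul_eq_mul]
    · ring
    · module
    · module
    · ring

lemma exists_of_mem_L00 {f : P.L} (hf : f ∈ P.L00) : ∃ (s : J × J' →₀ k) (lxi lzeta : k),
    f = Finsupp.linearCombination k (fun p : J × J' => P.d p.1 p.2) s + lxi • P.xi
      + lzeta • P.zeta := by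
  obtain ⟨_, h, _, hx, rfl⟩ := Submodule.mem_sup.1 hf
  obtain ⟨_, hd, _, hz, rfl⟩ := Submodule.mem_sup.1 h
  rw [← Finsupp.range_linearCombination] at hd
  obtain ⟨s, rfl⟩ := hd
  obtain ⟨r, rfl⟩ := Submodule.mem_span_singleton.1 hx
  obtain ⟨t, rfl⟩ := Submodule.mem_span_singleton.1 hz
  exact ⟨s, r, t, by abel⟩

end Representation

/-! ### Comparison of a Lie ideal with the minimal and the maximal submodule. -/

namespace TripleIdeal

variable {P} (A : P.TripleIdeal)

lemma rad_le_L00 : A.rad ≤ P.L00 := by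
  rintro _ ⟨s, r, t, rfl, -⟩
  refine add_mem (add_mem ?_ (P.L00.smul_mem _ P.xi_mem_L00)) (P.L00.smul_mem _ P.zeta_mem_L00)
  rw [Finsupp.linearCombination_apply]
  exact sum_mem fun p _ => P.L00.smul_mem _ (P.d_mem_L00 _ _)

lemma zeroMin_le_L00 : A.zeroMin ≤ P.L00 := by
  refine sup_le (sup_le ?_ ?_) (Submodule.span_le.2 ?_)
  · rintro _ ⟨t, -, rfl⟩; exact P.L00.smul_mem _ P.xi_mem_L00
  · rintro _ ⟨t, -, rfl⟩; exact P.L00.smul_mem _ P.zeta_mem_L00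
  · rintro _ ⟨a, a', -, rfl⟩; exact P.d_mem_L00 a a'

/-- For an arbitrary expression of `f` in the generators, the action on `x` gives the condition on
`λ_ζ + 2λ_ξ`. The action on the first three coordinates of `L₁` gives the other conditions, up to
combinations already known to lie in `A`. -/
lemma mem_rad_of_mem_lieIdeal {f : P.L} (hf : f ∈ P.L00) (h : f ∈ A.lieIdeal) : f ∈ A.rad := by
  obtain ⟨-, -, -, -, hX, hQ⟩ := h
  obtain ⟨s, r, t, rfl⟩ := P.exists_of_mem_L00 hf
  have hT : t + 2 * r ∈ A.l := by
    convert neg_mem hX using 1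
    simp only [L.add_zero, L.smul_zero, Submodule.coe_add, Submodule.coe_smul, map_add, map_smul,
      LinearMap.add_apply, LinearMap.smul_apply, onX_linearCombination_d, coe_xi_zero,
      coe_zeta_zero, xiM, zetaM, M.onX_mk, LinearMap.neg_apply, Module.End.one_apply,
      Module.End.ofNat_apply, smul_eq_mul]
    ring
  have key (q : P.Quad) := hQ q
  simp only [L.add_zero, L.smul_zero, Submodule.coe_add, Submodule.coe_smul, map_add, map_smul,
    LinearMap.add_apply, LinearMap.smul_apply, onPos_linearCombination_d, coe_xi_zero,
    coe_zeta_zero, xiM, zetaM, M.onPos_mk, Module.End.one_apply, zetaPos_apply, mem_quad,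
    Prod.fst_add, Prod.snd_add, Prod.smul_fst, Prod.smul_snd, smul_eq_mul] at key
  -- On `(1, 0, 0, 0)₊` the scalar is `r - t` minus the sum of the `T`-values; adding `t + 2r`
  -- eliminates `t`.
  have hS : Finsupp.linearCombination k (fun p : J × J' => P.T p.1 p.2) s - 3 * r ∈ A.l := by
    have h1 := (key (P.quad₁ 1)).1
    convert neg_mem (add_mem h1 hT) using 1
    simp only [quad₁_fst]
    ring
  refine ⟨s, r, t, rfl, hT, hS, fun b => ?_, fun b' => ?_⟩
  -- Since `ζ` kills the `J`-coordinate of `L₁`, only the difference in `hS`, applied to `b`, has to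
  -- be added to reach the shift `2r`.
  · have h2 := (key (P.quad₂ b)).2.1
    simp only [quad₂_snd_fst] at h2
    convert add_mem h2 (A.smul_mem _ hS b) using 1
    module
  -- Here `ζ` acts as 1, so both `hS` and `hT` enter the correction.
  · have h3 := (key (P.quad₃ b')).2.2.1
    simp only [quad₃_snd_snd] at h3
    convert add_mem (neg_mem h3) (add_mem (A.smul_mem' _ hS b') (A.smul_mem' _ hT b')) using 1
    module

lemma rootPart_zeroMin_le (α : ℤ × ℤ) :
    P.rootPart A.l A.U A.U' A.zeroMin α ≤ P.rootSpace α :=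
  P.rootPart_mono le_top le_top le_top A.zeroMin_le_L00 α

lemma rootPart_rad_le (α : ℤ × ℤ) : P.rootPart A.l A.U A.U' A.rad α ≤ P.rootSpace α :=
  P.rootPart_mono le_top le_top le_top A.rad_le_L00 α

/-- This is gradedness in precise form: each projection of `m` is a root element with coefficient in
the triple ideal of `I`, or lies in `I ∩ L_{0,0}`. The two occurrences of `hQ` apply the action to
the vectors that define `coeffJ` and `coeffJ'`. -/
lemma rootProj_mem_of_mem {I : LieIdeal k P.L} {m : P.L} (h : m ∈ I) (α : ℤ × ℤ) :
    P.rootProj α m ∈ P.rootPart (ofLieIdeal I).l (ofLieIdeal I).U (ofLieIdeal I).U'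
      (I.toSubmodule ⊓ P.L00) α := by
  obtain ⟨hx, hn, hp, hy, -, hQ⟩ := le_lieIdeal_ofLieIdeal I h
  have hJ : P.coeffJ m ∈ (ofLieIdeal I).U := (hQ _).2.1
  have hJ' : P.coeffJ' m ∈ (ofLieIdeal I).U' := neg_mem (hQ _).2.2.1
  -- The other four homogeneous components of `m` are in `I`, so their sum is subtracted from `m`.
  have h0 : P.inclZero m.zero ∈ I := by
    have h1 := sub_mem h (add_mem (add_mem (inclX_x_mem h) (inclPos_mem_iff.1 (inclPos_neg_mem h)))
      (add_mem (inclPos_mem_iff.2 (inclNeg_pos_mem h)) (inclY_mem_of_inclX_mem (inclX_y_mem h))))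
    convert h1 using 1
    conv_rhs => rw [← P.incl_sum m]
    simp only [L.add_x, L.add_neg, L.add_pos, L.add_y, inclX_x, inclX_neg, inclX_pos, inclX_y,
      inclNeg_x, inclNeg_neg, inclNeg_pos, inclNeg_y, inclZero_x, inclZero_neg, inclZero_pos,
      inclZero_y, inclPos_x, inclPos_neg, inclPos_pos, inclPos_y, inclY_x, inclY_neg, inclY_pos,
      inclY_y, add_zero, zero_add]
    abel
  have h00 : P.projZero m ∈ I.toSubmodule ⊓ P.L00 :=
    ⟨sub_mem (H := I) (sub_mem (H := I) h0 hJ) hJ', P.projZero_mem m⟩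
  exact rootProj_mem_rootPart hx hn hJ hJ' h00 hp hy α

/-- The triple is defined by one root each for `k`, `J` and `J'`; here the coefficients are carried
from these to all the other roots. -/
lemma rootPart_ofLieIdeal_le {I : LieIdeal k P.L} {W : Submodule k P.L} (hW : W ≤ I.toSubmodule)
    (α : ℤ × ℤ) : P.rootPart (ofLieIdeal I).l (ofLieIdeal I).U (ofLieIdeal I).U' W α ≤
      I.toSubmodule := by
  have h₁ {t : k} (ht : P.inclX t ∈ I) : P.inclPos (P.quad₁ t) ∈ I :=
    inclPos_mem_iff.2 (inclNeg_quad₁_mem ht)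
  have h₄ {t : k} (ht : P.inclX t ∈ I) : P.inclPos (P.quad₄ t) ∈ I :=
    inclPos_mem_iff.2 (inclNeg_quad₄_mem ht)
  unfold rootPart
  split
  case h_7 => exact hW
  case h_14 => exact bot_le
  all_goals rintro _ ⟨t, ht, rfl⟩
  · exact ht
  · exact inclNeg_quad₁_mem ht
  · exact inclPos_mem_iff.1 (inclPos_quad₂_mem ht)
  · exact inclPos_mem_iff.1 (inclPos_quad₃_mem ht)
  · exact inclNeg_quad₄_mem ht
  · exact ht
  · exact ht
  · exact h₁ ht
  · exact inclPos_quad₂_mem ht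
  · exact inclPos_quad₃_mem ht
  · exact h₄ ht
  · exact inclY_mem_of_inclX_mem ht

lemma zeroMin_ofLieIdeal_le (I : LieIdeal k P.L) : (ofLieIdeal I).zeroMin ≤ I.toSubmodule := by
  refine sup_le (sup_le ?_ ?_) (Submodule.span_le.2 ?_)
  · rintro _ ⟨t, ht, rfl⟩; exact smul_xi_mem (I := I) ht
  · rintro _ ⟨t, ht, rfl⟩; exact smul_zeta_mem (I := I) ht
  · rintro _ ⟨a, a', ha | ha', rfl⟩ <;> rw [← lie_inclJ'_inclJ]
    · exact lie_mem_of_mem_right (I := I) _ ha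
    · exact lie_mem_of_mem_left (I := I) ha' _

lemma lieMin_ofLieIdeal_le (I : LieIdeal k P.L) : (ofLieIdeal I).lieMin ≤ I.toSubmodule :=
  iSup_le (rootPart_ofLieIdeal_le (zeroMin_ofLieIdeal_le I))

lemma le_lieMax_ofLieIdeal (I : LieIdeal k P.L) : I.toSubmodule ≤ (ofLieIdeal I).lieMax := by
  intro m hm
  refine mem_iSup_of_rootProj_mem fun α =>
    P.rootPart_mono le_rfl le_rfl le_rfl ?_ α (rootProj_mem_of_mem hm α)
  rintro f ⟨hf, hf0⟩
  exact (ofLieIdeal I).mem_rad_of_mem_lieIdeal hf0 (le_lieIdeal_ofLieIdeal I hf)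

lemma inclX_mem_lieMin {t : k} (ht : t ∈ A.l) : P.inclX t ∈ A.lieMin :=
  Submodule.mem_iSup_of_mem (-2, -1) (Submodule.mem_map_of_mem ht)

lemma inclJ_mem_lieMin {u : J} (hu : u ∈ A.U) : P.inclJ u ∈ A.lieMin :=
  Submodule.mem_iSup_of_mem (0, 1) (Submodule.mem_map_of_mem hu)

lemma inclJ'_mem_lieMin {u' : J'} (hu' : u' ∈ A.U') : P.inclJ' u' ∈ A.lieMin :=
  Submodule.mem_iSup_of_mem (0, -1) (Submodule.mem_map_of_mem hu')

lemma mem_l_of_inclX_mem_lieMax {t : k} (h : P.inclX t ∈ A.lieMax) : t ∈ A.l := by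
  obtain ⟨s, hs, e⟩ := rootProj_mem_of_mem_iSup A.rootPart_rad_le h (-2, -1)
  have : s = t := congrArg L.x e
  exact this ▸ hs

lemma mem_U_of_inclJ_mem_lieMax {u : J} (h : P.inclJ u ∈ A.lieMax) : u ∈ A.U := by
  obtain ⟨s, hs, e⟩ := rootProj_mem_of_mem_iSup A.rootPart_rad_le h (0, 1)
  have : s = u := by simpa [rootProj] using congrArg P.coeffJ e
  exact this ▸ hs

lemma mem_U'_of_inclJ'_mem_lieMax {u' : J'} (h : P.inclJ' u' ∈ A.lieMax) : u' ∈ A.U' := by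
  obtain ⟨s, hs, e⟩ := rootProj_mem_of_mem_iSup A.rootPart_rad_le h (0, -1)
  have : s = u' := by simpa [rootProj] using congrArg P.coeffJ' e
  exact this ▸ hs

variable {A} in
/-- An ideal of the triple with `L(ℓ, U, U')_min ≤ I ≤ L(ℓ, U, U')_max` is determined by `I`. -/
lemma eq_ofLieIdeal {I : LieIdeal k P.L} (h : A.lieMin ≤ I.toSubmodule)
    (h' : I.toSubmodule ≤ A.lieMax) : A = ofLieIdeal I := by
  -- At the roots `(-2, -1)`, `(0, 1)`, `(0, -1)` the minimal and the maximal submodule have the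
  -- same component, so `I` is squeezed there and its coefficients are forced.
  ext t
  · exact ⟨fun ht => h (A.inclX_mem_lieMin ht), fun ht => A.mem_l_of_inclX_mem_lieMax (h' ht)⟩
  · exact ⟨fun ht => h (A.inclJ_mem_lieMin ht), fun ht => A.mem_U_of_inclJ_mem_lieMax (h' ht)⟩
  · exact ⟨fun ht => h (A.inclJ'_mem_lieMin ht), fun ht => A.mem_U'_of_inclJ'_mem_lieMax (h' ht)⟩

lemma zeroMin_le_lieMin : A.zeroMin ≤ A.lieMin :=
  le_iSup (P.rootPart A.l A.U A.U' A.zeroMin) (0, 0)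

lemma lieMax_inf_L00_le : A.lieMax ⊓ P.L00 ≤ A.rad := by
  rintro f ⟨hf, hf0⟩
  have h := rootProj_mem_of_mem_iSup A.rootPart_rad_le hf (0, 0)
  rwa [P.rootProj_of_mem (α := (0, 0)) hf0] at h

lemma lieMin_inf_L00_le : A.lieMin ⊓ P.L00 ≤ A.zeroMin := by
  rintro f ⟨hf, hf0⟩
  have h := rootProj_mem_of_mem_iSup A.rootPart_zeroMin_le hf (0, 0)
  rwa [P.rootProj_of_mem (α := (0, 0)) hf0] at h

/-- An element of `L(ℓ, U, U')_max` is congruent to its component in `L_{0,0}` modulo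
`L(ℓ, U, U')_min`. -/
lemma sub_projZero_mem_lieMin {m : P.L} (hm : m ∈ A.lieMax) : m - P.projZero m ∈ A.lieMin := by
  refine mem_iSup_of_rootProj_mem fun α => ?_
  rw [map_sub]
  obtain rfl | hα := eq_or_ne α (0, 0)
  · rw [P.rootProj_of_mem (α := (0, 0)) (P.projZero_mem m)]
    change P.projZero m - P.projZero m ∈ A.zeroMin
    rw [sub_self]; exact zero_mem _
  -- Away from degree `(0, 0)` the summands of `lieMin` and `lieMax` coincide.
  · rw [P.rootProj_of_mem_of_ne hα (P.projZero_mem m), sub_zero,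
      P.rootPart_of_ne_zero _ _ _ _ A.rad hα]
    exact rootProj_mem_of_mem_iSup A.rootPart_rad_le hm α

/-! ### Extreme ideals, in preparation for simplicity. -/

/-- An element of `L₀` that kills `x` and `L₁` also kills `L₋₁` and `y`, by the derivation
identities, and so is zero in `M`. -/
lemma lieIdeal_bot : (⊥ : P.TripleIdeal).lieIdeal = ⊥ := by
  rw [eq_bot_iff]
  rintro m ⟨hx, hn, hp, hy, hX, hQ⟩
  have hq {q : P.Quad} (h : q ∈ (⊥ : P.TripleIdeal).quad) : q = 0 :=
    Prod.ext h.1 (Prod.ext h.2.1 (Prod.ext h.2.2.1 h.2.2.2))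
  have hX' : M.onX (m.zero : P.M) 1 = 0 := hX
  have d := P.isDer_of_mem m.zero.2
  rw [LieSubmodule.mem_bot]
  refine L.ext hx (hq hn) (Subtype.ext (M.ext ?_ ?_ ?_ ?_)) (hq hp) hy
  · apply LinearMap.ext; intro t
    rw [end_apply, hX', mul_zero]; simp
  · apply LinearMap.ext; intro q
    rw [d.neg_eq, hX', zero_smul, hq (hQ q)]; simp
  · apply LinearMap.ext; intro q
    rw [hq (hQ q)]; simp
  · apply LinearMap.ext; intro t
    rw [end_apply, d.onY_eq, hX', neg_zero, mul_zero]; simp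

lemma eq_top_of_ofLieIdeal_eq_top {I : LieIdeal k P.L} (h : ofLieIdeal I = ⊤) : I = ⊤ := by
  rw [eq_top_iff]
  rintro m -
  have hl (t : k) : P.inclX t ∈ I := by
    have : t ∈ (ofLieIdeal I).l := h ▸ Submodule.mem_top
    exact this
  have hU (b : J) : P.inclJ b ∈ I := by
    have : b ∈ (ofLieIdeal I).U := h ▸ Submodule.mem_top
    exact this
  have hU' (b' : J') : P.inclJ' b' ∈ I := by
    have : b' ∈ (ofLieIdeal I).U' := h ▸ Submodule.mem_top
    exact this
  have h0 : P.L00 ≤ I.toSubmodule := by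
    refine P.L00_le (fun a a' => ?_) ?_ ?_
    · rw [← lie_inclJ'_inclJ]; exact lie_mem_of_mem_left (I := I) (hU' a') _
    · rw [← one_smul k P.zeta]; exact smul_zeta_mem (I := I) (hl 1)
    · rw [← one_smul k P.xi]; exact smul_xi_mem (I := I) (hl 1)
  have h0' : P.inclZero m.zero ∈ I.toSubmodule := by
    refine sup_le (sup_le ?_ h0) ?_ (P.inclZero_mem_sup m.zero)
    · rintro _ ⟨b', rfl⟩; exact hU' b'
    · rintro _ ⟨b, rfl⟩; exact hU b
  have hN (q : P.Quad) : P.inclNeg q ∈ I := by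
    rw [← one_smul k q]; exact inclNeg_smul_mem (hl 1) q
  rw [← P.incl_sum m]
  exact add_mem (add_mem (add_mem (add_mem (hl _) (hN _)) h0') (inclPos_mem_iff.2 (hN _)))
    (inclY_mem_of_inclX_mem (hl _))

/-- The ideal `(𝔞, {u ∣ T(u, J') ⊆ 𝔞}, {u' ∣ T(J, u') ⊆ 𝔞})` of `(k, J, J')`. -/
def ofIdeal (𝔞 : Ideal k) : P.TripleIdeal where
  l := 𝔞
  U := ⨅ b' : J', Submodule.comap (P.T.flip b') 𝔞
  U' := ⨅ b : J, Submodule.comap (P.T b) 𝔞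
  smul_mem r hr b := by
    simpa [Submodule.mem_iInf] using fun b' => 𝔞.mul_mem_right _ hr
  smul_mem' r hr b' := by
    simpa [Submodule.mem_iInf] using fun b => 𝔞.mul_mem_right _ hr
  T_mem u hu b' := (Submodule.mem_iInf _).1 hu b'
  T_mem' u' hu' b := (Submodule.mem_iInf _).1 hu' b
  cross_mem u hu b := by
    refine (Submodule.mem_iInf _).2 fun c => ?_
    -- Associativity of `T` moves the product off `u`: `T(c, u × b) = T(u, b × c)`.
    rw [Submodule.mem_comap, P.T_cross]
    exact (Submodule.mem_iInf _).1 hu (P.cross b c)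
  cross'_mem u' hu' b' := by
    refine (Submodule.mem_iInf _).2 fun c => ?_
    rw [Submodule.mem_comap, LinearMap.flip_apply, P.T_cross']
    exact (Submodule.mem_iInf _).1 hu' (P.cross' b' c)

lemma eq_top_of_l_eq_top (h : A.l = ⊤) : A = ⊤ := by
  have h1 : (1 : k) ∈ A.l := h ▸ Submodule.mem_top
  ext t
  · rw [h]; rfl
  · exact ⟨fun _ => trivial, fun _ => by simpa using A.smul_mem 1 h1 t⟩
  · exact ⟨fun _ => trivial, fun _ => by simpa using A.smul_mem' 1 h1 t⟩

end TripleIdeal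

/-! ### The assertions of the theorem. -/

open TripleIdeal

lemma isGraded (I : LieIdeal k P.L) : P.IsGraded I := by
  refine ⟨iSupIndep_of_le_rootSpace fun α => inf_le_right, le_antisymm (iSup_le fun α => inf_le_left)
    fun m hm => mem_iSup_of_rootProj_mem fun α => ⟨?_, P.rootProj_mem_rootSpace α m⟩⟩
  exact rootPart_ofLieIdeal_le inf_le_left α (rootProj_mem_of_mem hm α)

lemma existsUnique_tripleIdeal (I : LieIdeal k P.L) : ∃! A : P.TripleIdeal,
    A.lieMin ≤ I.toSubmodule ∧ I.toSubmodule ≤ A.lieMax :=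
  ⟨ofLieIdeal I, ⟨lieMin_ofLieIdeal_le I, le_lieMax_ofLieIdeal I⟩,
    fun _ h => eq_ofLieIdeal h.1 h.2⟩

/-- The module is `I ∩ L_{0,0}`. It suffices together with `lieMin` because `I ≤ lieMax` and the two
bounds agree modulo `L_{0,0}`. -/
lemma existsUnique_zeroPart (I : LieIdeal k P.L) (A : P.TripleIdeal)
    (h : A.lieMin ≤ I.toSubmodule) (h' : I.toSubmodule ≤ A.lieMax) :
    ∃! V : Submodule k P.L, A.zeroMin ≤ V ∧ V ≤ A.rad ∧ I.toSubmodule = A.lieMin ⊔ V := by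
  refine ⟨I.toSubmodule ⊓ P.L00, ⟨le_inf (A.zeroMin_le_lieMin.trans h) A.zeroMin_le_L00,
    (inf_le_inf_right _ h').trans A.lieMax_inf_L00_le, le_antisymm (fun m hm => ?_)
    (sup_le h inf_le_left)⟩, ?_⟩
  · have h1 := A.sub_projZero_mem_lieMin (h' hm)
    have h2 : P.projZero m ∈ I.toSubmodule := by
      have := sub_mem hm (h h1)
      rwa [sub_sub_cancel] at this
    rw [← sub_add_cancel m (P.projZero m)]
    exact Submodule.add_mem_sup h1 ⟨h2, P.projZero_mem m⟩
  · rintro V ⟨hV, hV', e⟩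
    refine le_antisymm (le_inf (e ▸ le_sup_right) (hV'.trans A.rad_le_L00)) ?_
    -- A modular law argument: the `lieMin`-summand of `f` lies in `L_{0,0}` as well, hence in
    -- `zeroMin`, which `V` contains.
    rintro f ⟨hf, hf0⟩
    rw [e] at hf
    obtain ⟨m, hm, v, hv, rfl⟩ := Submodule.mem_sup.1 hf
    have hm0 : m ∈ P.L00 := by
      have := sub_mem hf0 (A.rad_le_L00 (hV' hv))
      rwa [add_sub_cancel_right] at this
    exact add_mem (hV (A.lieMin_inf_L00_le ⟨hm, hm0⟩)) hv

variable {P}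

lemma IsSimpleTriple.isSimple (h : P.IsSimpleTriple) (I : LieIdeal k P.L) : I = ⊥ ∨ I = ⊤ := by
  refine (h (ofLieIdeal I)).imp (fun e => ?_) eq_top_of_ofLieIdeal_eq_top
  have := le_lieIdeal_ofLieIdeal I
  rwa [e, lieIdeal_bot, le_bot_iff] at this

/-- The hypothesis is applied to `A.lieIdeal`. `A` is recovered from it in `L₋₂` and `L₋₁`, where
membership is a condition on coordinates and not on an action. -/
lemma isSimpleTriple_of_isSimple (h : ∀ I : LieIdeal k P.L, I = ⊥ ∨ I = ⊤) :
    P.IsSimpleTriple := by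
  intro A
  have hx {t : k} (ht : t ∈ A.l) : P.inclX t ∈ A.lieIdeal := by
    refine A.mem_lieIdeal.2 ⟨ht, zero_mem _, zero_mem _, zero_mem _, ?_, fun q => ?_⟩
    · simp
    · simp
  have hn {q : P.Quad} (hq : q ∈ A.quad) : P.inclNeg q ∈ A.lieIdeal := by
    refine A.mem_lieIdeal.2 ⟨zero_mem _, hq, zero_mem _, zero_mem _, ?_, fun q => ?_⟩
    · simp
    · simp
  obtain e | e := h A.lieIdeal
  · left
    rw [e] at hx hn
    ext t
    · refine ⟨fun ht => congrArg L.x ((LieSubmodule.mem_bot _).1 (hx ht)), fun ht => ?_⟩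
      rw [(Submodule.mem_bot k).1 ht]; exact zero_mem _
    · refine ⟨fun ht => congrArg (fun m : P.L => m.neg.2.1) ((LieSubmodule.mem_bot _).1
        (hn (q := P.quad₂ t) ⟨zero_mem _, ht, zero_mem _, zero_mem _⟩)), fun ht => ?_⟩
      rw [(Submodule.mem_bot k).1 ht]; exact zero_mem _
    · refine ⟨fun ht => congrArg (fun m : P.L => m.neg.2.2.1) ((LieSubmodule.mem_bot _).1
        (hn (q := P.quad₃ t) ⟨zero_mem _, zero_mem _, ht, zero_mem _⟩)), fun ht => ?_⟩
      rw [(Submodule.mem_bot k).1 ht]; exact zero_mem _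
  · right
    refine A.eq_top_of_l_eq_top (Ideal.eq_top_iff_one _ |>.2 ?_)
    have h1 : P.inclX 1 ∈ A.lieIdeal := e ▸ LieSubmodule.mem_top _
    exact (A.mem_lieIdeal.1 h1).1

lemma IsSimpleTriple.ideal_eq (h : P.IsSimpleTriple) (𝔞 : Ideal k) : 𝔞 = ⊥ ∨ 𝔞 = ⊤ :=
  (h (ofIdeal 𝔞)).imp (congrArg TripleIdeal.l) (congrArg TripleIdeal.l)

/-- The ideal `ofIdeal ⊥` has the left and right radicals of `T` as its module parts. -/
lemma IsSimpleTriple.nondegenerate (h : P.IsSimpleTriple) : P.T.Nondegenerate := by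
  obtain e | e := h (ofIdeal ⊥)
  · refine ⟨fun a ha => ?_, fun a' ha' => ?_⟩
    · have : a ∈ (ofIdeal ⊥ : P.TripleIdeal).U := (Submodule.mem_iInf _).2 fun b' => ha b'
      rw [e] at this
      exact this
    · have : a' ∈ (ofIdeal ⊥ : P.TripleIdeal).U' := (Submodule.mem_iInf _).2 fun b => ha' b
      rw [e] at this
      exact this
  -- If this ideal is everything, then `1 = 0` in `k`, and `J` and `J'` vanish with it.
  · have h1 : (1 : k) ∈ (ofIdeal ⊥ : P.TripleIdeal).l := e ▸ Submodule.mem_top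
    have h1' : (1 : k) = 0 := h1
    refine ⟨fun a _ => ?_, fun a' _ => ?_⟩
    · rw [← one_smul k a, h1', zero_smul]
    · rw [← one_smul k a', h1', zero_smul]

/-- The part `ℓ` decides: `ℓ = k` forces everything because `ℓJ ⊆ U` and `ℓJ' ⊆ U'`, while `ℓ = 0`
puts `U` and `U'` into the radicals of `T`. -/
lemma isSimpleTriple_of_nondegenerate (h : ∀ 𝔞 : Ideal k, 𝔞 = ⊥ ∨ 𝔞 = ⊤)
    (hT : P.T.Nondegenerate) : P.IsSimpleTriple := by
  intro A
  refine (h A.l).imp (fun e => ?_) A.eq_top_of_l_eq_top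
  ext t
  · rw [e]; rfl
  · refine ⟨fun ht => hT.1 t fun b' => ?_, fun ht => ?_⟩
    · have := A.T_mem t ht b'
      rwa [e] at this
    · rw [(Submodule.mem_bot k).1 ht]; exact zero_mem _
  · refine ⟨fun ht => hT.2 t fun b => ?_, fun ht => ?_⟩
    · have := A.T_mem' t ht b
      rwa [e] at this
    · rw [(Submodule.mem_bot k).1 ht]; exact zero_mem _

variable (P)

lemma simple_tfae : List.TFAE [
    P.IsSimpleTriple,
    ∀ I : LieIdeal k P.L, I = ⊥ ∨ I = ⊤,
    (∀ 𝔞 : Ideal k, 𝔞 = ⊥ ∨ 𝔞 = ⊤) ∧ P.T.Nondegenerate] := by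
  tfae_have 1 → 2 := fun h => h.isSimple
  tfae_have 2 → 1 := isSimpleTriple_of_isSimple
  tfae_have 1 → 3 := fun h => ⟨h.ideal_eq, h.nondegenerate⟩
  tfae_have 3 → 1 := fun h => isSimpleTriple_of_nondegenerate h.1 h.2
  tfae_finish

end LinearCubicNormPair

theorem mainTheorem3 {k : Type u} {J : Type v} {J' : Type w} [CommRing k]
    [AddCommGroup J] [Module k J] [AddCommGroup J'] [Module k J']
    (P : LinearCubicNormPair k J J') :
    (∀ I : LieIdeal k P.L, P.IsGraded I) ∧
    (∀ I : LieIdeal k P.L, ∃! A : P.TripleIdeal,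
      A.lieMin ≤ I.toSubmodule ∧ I.toSubmodule ≤ A.lieMax) ∧
    (∀ (I : LieIdeal k P.L) (A : P.TripleIdeal),
      A.lieMin ≤ I.toSubmodule → I.toSubmodule ≤ A.lieMax →
      ∃! V : Submodule k P.L, A.zeroMin ≤ V ∧ V ≤ A.rad ∧ I.toSubmodule = A.lieMin ⊔ V) ∧
    List.TFAE [
      P.IsSimpleTriple,
      ∀ I : LieIdeal k P.L, I = ⊥ ∨ I = ⊤,
      (∀ 𝔞 : Ideal k, 𝔞 = ⊥ ∨ 𝔞 = ⊤) ∧ P.T.Nondegenerate] ∧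
    (Nontrivial k →
      ((∀ I : LieIdeal k P.L, I = ⊥ ∨ I = ⊤) ↔ IsField k ∧ P.T.Nondegenerate)) := by
  refine ⟨P.isGraded, P.existsUnique_tripleIdeal, P.existsUnique_zeroPart, P.simple_tfae,
    fun _ => ?_⟩
  refine (P.simple_tfae.out 1 2).trans ?_
  -- A simple order must be nontrivial as well, which is where `k ≠ 0` is needed; the condition on
  -- ideals alone also holds for the zero ring.
  rw [Ring.isField_iff_isSimpleOrder_ideal]
  exact and_congr_left fun _ => ⟨fun h => ⟨h⟩, fun h => h.eq_bot_or_eq_top⟩
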